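/- Let $n,m\ge 1$ be integers. Let $P_{n,m}$ be the regular $(nm+2)$-gon. An $m$-diagonal of $P_{n,m}$ is a diagonal (not a side) that divides $P_{n,m}$ into two polygons whose numbers of sides are both congruent to $2$ modulo $m$. An $(m+2)$-angulation of $P_{n,m}$ is a maximal set $\Delta$ of $m$-diagonals no two of which cross in the interior of $P_{n,m}$; such a set consists of $n-1$ diagonals and divides $P_{n,m}$ into $(m+2)$-gons. Let $\mathcal{T}_{n,m}$ be the set of these angulations, and write $\Delta\sim\Delta'$ if $\Delta'$ is obtained from $\Delta$ by a rotation of $P_{n,m}$. The coloured quiver $Q_\Delta$ of $\Delta\in\mathcal{T}_{n,m}$ has the diagonals of $\Delta$ as vertices. For distinct $\alpha,\beta\in\Delta$ there is one arrow from $\alpha$ to $\beta$ if $\alpha$ and $\beta$ are sides of a common $(m+2)$-gon of $\Delta$, and none otherwise; the colour of this arrow, an element of $\{0,1,\dots,m\}$, is the number of sides of that $(m+2)$-gon lying strictly between $\alpha$ and $\beta$, counterclockwise from $\alpha$. The mutation of a coloured quiver (with colours $0,\dots,m$) at a vertex $j$ is defined in three steps. (1) For each pair of arrows $i\to j$ of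 colour $c$ and $j\to k$ of colour $0$ with $i\ne k$, add an arrow $i\to k$ of colour $c$ and an arrow $k\to i$ of colour $m-c$. (2) For all vertices $i,k$, cancel equal numbers of arrows from $i$ to $k$ of different colours until only arrows of one colour are left. (3) Add $1$ to the colour of every arrow into $j$ and subtract $1$ from the colour of every arrow out of $j$ (modulo $m+1$). Fix any orientation of the Dynkin diagram $A_{n-1}$ ($A_0$ being empty) and regard it as a coloured quiver: each arrow $i\to k$ has colour $0$ and is accompanied by one arrow $k\to i$ of colour $m$. Let $\mathcal{M}_{n-1,m}$ be the mutation class of coloured quivers of type $A_{n-1}$, that is, the set of isomorphism classes of the coloured quivers obtained from it by finitely many mutations. Theorem. For all $n,m\ge1$ (and for every choice of the orientation), the assignment $\Delta\mapsto Q_\Delta$ induces a well-defined map $$\widetilde{\sigma}_{n,m}\colon \mathcal{T}_{n,m}/{\sim}\;\longrightarrow\;\mathcal{M}_{n-1,m},$$ and this map is bijective. -/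

import Mathlib

noncomputable section

open scoped Classical

/-! ### Coloured quivers with colours `0, 1, …, m` and their mutation -/

/-- A coloured quiver with colour set `{0, 1, …, m}`: a set of vertices and, for all vertices
`i`, `k` and every colour `c`, the number `arrows i k c` of arrows of colour `c` from `i` to `k`. -/
structure ColouredQuiver (m : ℕ) : Type 1 where
  V : Type
  arrows : V → V → Fin (m + 1) → ℕ

namespace ColouredQuiver

variable {m : ℕ}

/-- Isomorphism of coloured quivers: a bijection of the vertices that preserves the number of
arrows of every colour. -/
def Iso (Q R : ColouredQuiver m) : Prop :=
  ∃ e : Q.V ≃ R.V, ∀ i k c, R.arrows (e i) (e k) c = Q.arrows i k c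

instance isoSetoid (m : ℕ) : Setoid (ColouredQuiver m) where
  r := Iso
  iseqv :=
    { refl := fun Q => ⟨Equiv.refl Q.V, fun _ _ _ => rfl⟩
      symm := fun {Q R} h => by
        obtain ⟨e, he⟩ := h
        exact ⟨e.symm, fun i k c => by
          have h := he (e.symm i) (e.symm k) c
          simp only [Equiv.apply_symm_apply] at h
          exact h.symm⟩
      trans := fun {Q R S} h h' => by
        obtain ⟨e, he⟩ := h
        obtain ⟨f, hf⟩ := h'
        exact ⟨e.trans f, fun i k c => by
          simp only [Equiv.trans_apply]
          rw [hf, he]⟩ }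

/-- Isomorphism classes of coloured quivers. -/
abbrev IsoClass (m : ℕ) : Type 1 := Quotient (isoSetoid m)

/-- First step of the mutation at `j`: for each pair of arrows `x ⟶ j` of colour `c` and `j ⟶ y`
of colour `0` with `x ≠ y`, add an arrow `x ⟶ y` of colour `c` and an arrow `y ⟶ x` of colour
`m - c`. The two new summands collect the arrows `i ⟶ k` of colour `c` that arise from
`(x, y) = (i, k)` and from `(x, y) = (k, i)`; note that `c.rev` is the colour `m - c`. -/
def addArrows (Q : ColouredQuiver m) (j : Q.V) : ColouredQuiver m where
  V := Q.V
  arrows i k c := Q.arrows i k c +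
    if i = k then 0
    else Q.arrows i j c * Q.arrows j k 0 + Q.arrows k j c.rev * Q.arrows j i 0

/-- Second step: cancel arrows `i ⟶ k` of different colours against each other, until only arrows
of one colour are left (the truncated subtraction is intended). -/
def cancelArrows (Q : ColouredQuiver m) : ColouredQuiver m where
  V := Q.V
  arrows i k c := Q.arrows i k c - ∑ t ∈ Finset.univ.erase c, Q.arrows i k t

/-- Third step: add one to the colour of the arrows into `j` and subtract one from the colour of
the arrows out of `j` (colours are read modulo `m + 1`). -/
def shiftColours (Q : ColouredQuiver m) (j : Q.V) : ColouredQuiver m where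
  V := Q.V
  arrows i k c := Q.arrows i k (c - (if k = j then 1 else 0) + (if i = j then 1 else 0))

/-- Mutation of a coloured quiver at the vertex `j`. -/
def mutate (Q : ColouredQuiver m) (j : Q.V) : ColouredQuiver m :=
  shiftColours (cancelArrows (addArrows Q j)) j

/-- The mutation class of `Q`: the isomorphism classes of the coloured quivers obtained from `Q`
by finitely many mutations. -/
def mutationClass (Q : ColouredQuiver m) : Set (IsoClass m) :=
  {x | ∃ R : ColouredQuiver m,
    Relation.ReflTransGen (fun S S' => ∃ j : S.V, S' = mutate S j) Q R ∧ x = ⟦R⟧}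

/-- The coloured quiver of the orientation `ε` of the Dynkin diagram `0 — 1 — ⋯ — (N - 1)` of type
`A_N`. The edge `u — u + 1` is oriented `u ⟶ u + 1` if `ε u` is true and `u + 1 ⟶ u` otherwise.
Each arrow of the oriented diagram is an arrow of colour `0`, accompanied by one opposite arrow of
colour `m`, and there are no other arrows. -/
def dynkinA (m N : ℕ) (ε : Fin N → Bool) : ColouredQuiver m where
  V := Fin N
  arrows u v c :=
    if u.val + 1 = v.val then (if c = (if ε u then 0 else Fin.last m) then 1 else 0)
    else if v.val + 1 = u.val then (if c = (if ε v then Fin.last m else 0) then 1 else 0)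
    else 0

end ColouredQuiver

/-! ### The polygon with `n * m + 2` vertices and its `(m + 2)`-angulations -/

namespace Polygon

/-- The vertices of the regular `(n * m + 2)`-gon, labelled clockwise. -/
abbrev Vertex (n m : ℕ) : Type := Fin (n * m + 2)

/-- The segments between two vertices of the polygon. -/
abbrev Segment (n m : ℕ) : Type := Sym2 (Vertex n m)

variable {n m : ℕ}

/-- The border edges: the sides of the polygon. -/
def IsBorderEdge (e : Segment n m) : Prop := ∃ i : Vertex n m, e = s(i, i + 1)

/-- `m`-diagonals: the segment from `a` to `b` divides the polygon into two polygons (with at least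
three sides each, so that border edges are excluded) whose numbers of sides are both congruent to
`2` modulo `m`. -/
def IsMDiagonal (e : Segment n m) : Prop :=
  ∃ a b : Vertex n m, a < b ∧ e = s(a, b) ∧
    3 ≤ (b.val - a.val) + 1 ∧ 3 ≤ (n * m + 2 - (b.val - a.val)) + 1 ∧
    (b.val - a.val) + 1 ≡ 2 [MOD m] ∧ (n * m + 2 - (b.val - a.val)) + 1 ≡ 2 [MOD m]

/-- Two segments cross in the interior of the polygon: their endpoints alternate. -/
def Cross (e f : Segment n m) : Prop :=
  ∃ a b c d : Vertex n m, a < b ∧ b < c ∧ c < d ∧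
    ((e = s(a, c) ∧ f = s(b, d)) ∨ (e = s(b, d) ∧ f = s(a, c)))

/-- `(m + 2)`-angulations: maximal sets of pairwise non-crossing `m`-diagonals. -/
def IsAngulation (D : Set (Segment n m)) : Prop :=
  Maximal (fun E : Set (Segment n m) =>
    (∀ e ∈ E, IsMDiagonal e) ∧ ∀ e ∈ E, ∀ f ∈ E, ¬ Cross e f) D

/-- The set of `(m + 2)`-angulations of the `(n * m + 2)`-gon. -/
def Angulation (n m : ℕ) : Type := {D : Set (Segment n m) // IsAngulation D}

/-- Rotation of the polygon by one step in the counterclockwise direction. -/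
def rotation (n m : ℕ) : Equiv.Perm (Vertex n m) := Equiv.subRight 1

/-- `(m + 2)`-angulations are equivalent if one is a rotation of the other. -/
instance rotationSetoid (n m : ℕ) : Setoid (Angulation n m) where
  r D E := ∃ i : ℤ, E.1 = Sym2.map ((rotation n m) ^ i : Equiv.Perm (Vertex n m)) '' D.1
  iseqv :=
    { refl := fun D => ⟨0, by simp⟩
      symm := fun {D E} h => by
        obtain ⟨i, hi⟩ := h
        refine ⟨-i, ?_⟩
        rw [hi, Set.image_image]
        simp [Sym2.map_map]
      trans := fun {D E F} h h' => by
        obtain ⟨i, hi⟩ := h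
        obtain ⟨j, hj⟩ := h'
        refine ⟨j + i, ?_⟩
        rw [hj, hi, Set.image_image]
        simp [Sym2.map_map, zpow_add, Function.comp_def] }

/-- The `i`-th side of the polygon with vertices `p 0, p 1, …, p (m + 1)` (cyclically). -/
def side (p : Fin (m + 2) → Vertex n m) (i : Fin (m + 2)) : Segment n m := s(p i, p (i + 1))

/-- `p` lists, clockwise, the vertices of one of the `(m + 2)`-gons into which `D` divides the
polygon: every side is a border edge or belongs to `D`. -/
def IsCell (D : Set (Segment n m)) (p : Fin (m + 2) → Vertex n m) : Prop :=
  StrictMono p ∧ ∀ i, IsBorderEdge (side p i) ∨ side p i ∈ D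

/-- The coloured quiver of an `(m + 2)`-angulation. Its vertices are the diagonals. There is an
arrow from `α` to `β` if they are distinct sides of a common `(m + 2)`-gon of the angulation; its
colour is the number of sides of this `(m + 2)`-gon strictly between `α` and `β`, counterclockwise
from `α`. The sides of a cell are indexed clockwise, so there are `i - j - 1` (modulo `m + 2`)
sides strictly between the `i`-th and the `j`-th one, counterclockwise from the `i`-th. -/
def quiver (D : Angulation n m) : ColouredQuiver m where
  V := {e : Segment n m // e ∈ D.1}
  arrows α β c :=
    if ∃ (p : Fin (m + 2) → Vertex n m) (i j : Fin (m + 2)), IsCell D.1 p ∧ i ≠ j ∧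
        side p i = α.1 ∧ side p j = β.1 ∧ c.val = (i - j - 1).val
    then 1 else 0

end Polygon

end

/-! An angulation is encoded by the relation `R a b` of its edges on the vertices `0, …, n * m + 1`,
where border edges and the root edge `(0, n * m + 1)` count as edges. Edges are then nested like the
nodes of a tree: every edge that is not a single step has exactly one cell below it, and every edge
except the root is a lower side of exactly one cell. Lengths of edges are congruent to `1` modulo
`m`, and this forces an edge joining two vertices of a cell to be a side of it.

Mutation is rotation of one diagonal. The two cells at a diagonal `e` form a `(2 * m + 2)`-gon,
which `m + 1` chords cut into two `(m + 2)`-gons; the flip replaces `e` by the next chord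
counterclockwise. Arrows of colour `0` leaving `e` can only go to the two sides that follow `e`
immediately counterclockwise, and these are exactly the sides that change cells under the flip. Step
(1) of the mutation gives such a side an arrow to each of its new companions. With an old companion
it already had an arrow, and the added one has a neighbouring colour, so step (2) removes both. Step
(3) records that each remaining side is now one step nearer to or farther from the rotated diagonal.
This is `IsExchange.iso_mutate`, applied to polygons in `IsDoubleCell.iso_mutate`.

Consequently the quivers of angulations are closed under mutation. Flips connect all angulations,
because each can be flipped to the fan at vertex `0` (`of_flip_invariant`). A chain of nested
diagonals, growing by `m` vertices on the right or on the left, realises any prescribed orientation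
of `A_{n-1}` (`iso_dynkinA`). Hence the mutation class is exactly the set of quivers of angulations
(`mem_mutationClass_iff`), which gives that the map takes values in it and is surjective.

For injectivity (`rotate_eq_of_iso`), take a shortest diagonal: one of its two cells contains no
other diagonal, and this is visible in the quiver, since its neighbours are then pairwise adjacent.
So it and its image can both be rotated to the chord that cuts off one cell next to the root. From
there the colours determine the angulation downwards, cell by cell (`rel_of_iso`). -/

noncomputable section

open scoped Classical

/-! ### Angulations as edge relations on natural numbers, and their cells. -/

namespace EdgeRel

/-- `p 0 < p 1 < ⋯ < p (m + 1)` are the vertices of an `(m + 2)`-gon whose sides are edges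
of `R`. -/
structure IsCell (m : ℕ) (R : ℕ → ℕ → Prop) (p : ℕ → ℕ) : Prop where
  step : ∀ i ≤ m, R (p i) (p (i + 1))
  top : R (p 0) (p (m + 1))

/-- `R` is the set of all edges (border edges and diagonals, written with increasing endpoints) of
an `(m + 2)`-angulation of the polygon with vertices `0, 1, …, n * m + 1`. -/
structure IsAngulation (n m : ℕ) (R : ℕ → ℕ → Prop) : Prop where
  one_le : 1 ≤ m
  lt : ∀ {a b}, R a b → a < b
  le : ∀ {a b}, R a b → b ≤ n * m + 1
  dvd : ∀ {a b}, R a b → (m : ℤ) ∣ (b : ℤ) - a - 1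
  border : ∀ {a}, a < n * m + 1 → R a (a + 1)
  root : R 0 (n * m + 1)
  noncross : ∀ {a b c d}, R a b → R c d → a < c → c < b → b < d → False
  cell : ∀ {a b}, R a b → a + 1 < b → ∃ p, IsCell m R p ∧ p 0 = a ∧ p (m + 1) = b

/-- The sides of a cell, indexed periodically; the side with index `m + 1` joins the smallest and
the largest vertex. -/
def side (m : ℕ) (p : ℕ → ℕ) (i : ℕ) : ℕ × ℕ :=
  if i % (m + 2) = m + 1 then (p 0, p (m + 1)) else (p (i % (m + 2)), p (i % (m + 2) + 1))

theorem side_mod (m : ℕ) (p : ℕ → ℕ) (i : ℕ) : side m p (i % (m + 2)) = side m p i := by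
  simp [side]

theorem side_add (m : ℕ) (p : ℕ → ℕ) (i : ℕ) : side m p (i + (m + 2)) = side m p i := by
  simp [side]

theorem side_of_le {m : ℕ} (p : ℕ → ℕ) {i : ℕ} (h : i ≤ m) : side m p i = (p i, p (i + 1)) := by
  have : i % (m + 2) = i := Nat.mod_eq_of_lt (by omega)
  rw [side, this, if_neg (by omega)]

theorem side_top (m : ℕ) (p : ℕ → ℕ) : side m p (m + 1) = (p 0, p (m + 1)) := by
  have : (m + 1) % (m + 2) = m + 1 := Nat.mod_eq_of_lt (by omega)
  rw [side, this, if_pos rfl]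

theorem side_congr {m : ℕ} {p q : ℕ → ℕ} (h : ∀ i ≤ m + 1, p i = q i) (i : ℕ) :
    side m p i = side m q i := by
  have := Nat.mod_lt i (show 0 < m + 2 by omega)
  unfold side
  split_ifs with h1
  · rw [h 0 (by omega), h (m + 1) le_rfl]
  · rw [h _ (by omega), h _ (by omega)]

/-- `β` is the `d`-th side after `α`, clockwise, in a common cell. -/
def Follows (m : ℕ) (R : ℕ → ℕ → Prop) (α : ℕ × ℕ) (d : ℕ) (β : ℕ × ℕ) : Prop :=
  ∃ p, IsCell m R p ∧ ∃ i, side m p i = α ∧ side m p (i + d) = β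

/-- The edge `x` is a diagonal of the polygon with vertices `0, 1, …, n * m + 1`. -/
def IsDiag (n m : ℕ) (R : ℕ → ℕ → Prop) (x : ℕ × ℕ) : Prop :=
  R x.1 x.2 ∧ x.1 + 1 < x.2 ∧ ¬ (x.1 = 0 ∧ x.2 = n * m + 1)

/-- The coloured quiver of the diagonals of `R`. -/
def quiver (n m : ℕ) (R : ℕ → ℕ → Prop) : ColouredQuiver m where
  V := {x : ℕ × ℕ // IsDiag n m R x}
  arrows α β c := if Follows m R α.1 (m + 1 - c.val) β.1 then 1 else 0

theorem exists_step {p : ℕ → ℕ} {x : ℕ} (k : ℕ) (h0 : p 0 ≤ x) (hk : x < p k) :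
    ∃ i < k, p i ≤ x ∧ x < p (i + 1) := by
  induction k with
  | zero => omega
  | succ k ih =>
    by_cases h : x < p k
    · obtain ⟨i, hi, h⟩ := ih h
      exact ⟨i, by omega, h⟩
    · exact ⟨k, by omega, by omega, hk⟩

namespace IsAngulation

variable {n m : ℕ} {R : ℕ → ℕ → Prop}

theorem cell_lt (hR : IsAngulation n m R) {p : ℕ → ℕ} (hp : IsCell m R p) {i j : ℕ} (hij : i < j)
    (hj : j ≤ m + 1) : p i < p j := by
  induction j with
  | zero => omega
  | succ j ih =>
    have h := hR.lt (hp.step j (by omega))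
    rcases Nat.lt_succ_iff_lt_or_eq.1 hij with h1 | rfl
    · exact (ih h1 (by omega)).trans h
    · exact h

theorem cell_le (hR : IsAngulation n m R) {p : ℕ → ℕ} (hp : IsCell m R p) {i j : ℕ} (hij : i ≤ j)
    (hj : j ≤ m + 1) : p i ≤ p j := by
  rcases hij.lt_or_eq with h | rfl
  · exact (hR.cell_lt hp h hj).le
  · rfl

theorem cell_lt_iff (hR : IsAngulation n m R) {p : ℕ → ℕ} (hp : IsCell m R p) {i j : ℕ}
    (hi : i ≤ m + 1) (hj : j ≤ m + 1) : p i < p j ↔ i < j :=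
  ⟨fun h => by
    by_contra h1
    exact absurd (hR.cell_le hp (not_lt.1 h1) hi) (by omega), fun h => hR.cell_lt hp h hj⟩

theorem cell_le_iff (hR : IsAngulation n m R) {p : ℕ → ℕ} (hp : IsCell m R p) {i j : ℕ}
    (hi : i ≤ m + 1) (hj : j ≤ m + 1) : p i ≤ p j ↔ i ≤ j := by
  rw [← not_lt, hR.cell_lt_iff hp hj hi, not_lt]

theorem cell_inj (hR : IsAngulation n m R) {p : ℕ → ℕ} (hp : IsCell m R p) {i j : ℕ}
    (hi : i ≤ m + 1) (hj : j ≤ m + 1) (h : p i = p j) : i = j :=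
  le_antisymm ((hR.cell_le_iff hp hi hj).1 h.le) ((hR.cell_le_iff hp hj hi).1 h.ge)

theorem cell_dvd (hR : IsAngulation n m R) {p : ℕ → ℕ} (hp : IsCell m R p) {i j : ℕ} (hij : i ≤ j)
    (hj : j ≤ m + 1) : (m : ℤ) ∣ (p j : ℤ) - p i - (j - i) := by
  induction j, hij using Nat.le_induction with
  | base => simp
  | succ j hij ih =>
    have h := dvd_add (ih (by omega)) (hR.dvd (hp.step j (by omega)))
    rw [show (p (j + 1) : ℤ) - p i - ((j + 1 : ℕ) - i) =
      p j - p i - (j - i) + (p (j + 1) - p j - 1) by push_cast; ring]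
    exact h

/-- Modulo `m` the chord from `p i` to `p j` has length `j - i`, so `m` divides `j - i - 1`, a
number between `0` and `m`. This is the only place where the congruence of lengths is turned into
geometry. -/
theorem cell_chord_of_dvd (hR : IsAngulation n m R) {p : ℕ → ℕ} (hp : IsCell m R p) {i j : ℕ}
    (hij : i < j) (hj : j ≤ m + 1) (h : (m : ℤ) ∣ (p j : ℤ) - p i - 1) :
    j = i + 1 ∨ (i = 0 ∧ j = m + 1) := by
  have h1 := dvd_sub h (hR.cell_dvd hp hij.le hj)
  have h2 : (m : ℤ) ∣ (j : ℤ) - i - 1 := by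
    rwa [show (p j : ℤ) - p i - 1 - (p j - p i - (j - i)) = (j : ℤ) - i - 1 by ring] at h1
  by_contra h3
  have h4 := Int.le_of_dvd (by omega) h2
  omega

/-- The position of an edge relative to a cell. -/
theorem locate (hR : IsAngulation n m R) {p : ℕ → ℕ} (hp : IsCell m R p) {x y : ℕ} (h : R x y) :
    (∃ i ≤ m, p i ≤ x ∧ y ≤ p (i + 1)) ∨ (x ≤ p 0 ∧ p (m + 1) ≤ y) ∨ y ≤ p 0 ∨ p (m + 1) ≤ x := by
  by_contra! hc
  obtain ⟨h1, h2, h3, h4⟩ := hc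
  have hxy := hR.lt h
  have hx : p 0 ≤ x := by
    by_contra! hx
    exact hR.noncross h hp.top hx h3 (h2 hx.le)
  have hy : y ≤ p (m + 1) := by
    by_contra! hy
    have : p 0 < x := by
      by_contra! h5
      exact absurd (h2 h5) (by omega)
    exact hR.noncross hp.top h this h4 hy
  obtain ⟨i, hi, hi1, hi2⟩ := exists_step (m + 1) hx h4
  have hyi := h1 i (by omega) hi1
  have hxi : x = p i := by
    by_contra hne
    exact hR.noncross (hp.step i (by omega)) h (by omega) hi2 hyi
  obtain ⟨l, hl, hl1, hl2⟩ := exists_step (p := p) (x := y - 1) (m + 1) (by omega) (by omega)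
  have hil : p (i + 1) ≤ p l := by
    rw [hR.cell_le_iff hp (by omega) (by omega)]
    by_contra hc
    have := hR.cell_le hp (show l + 1 ≤ i + 1 by omega) (by omega)
    omega
  have hyl : y = p (l + 1) := by
    by_contra hne
    exact hR.noncross h (hp.step l (by omega)) (by omega) (by omega) (by omega)
  subst hxi hyl
  rcases hR.cell_chord_of_dvd hp ((hR.cell_lt_iff hp (by omega) (by omega)).1 hxy) (by omega)
      (hR.dvd h) with
    h5 | ⟨rfl, h5⟩
  · rw [h5] at hyi
    omega
  · rw [h5] at h2
    exact absurd (h2 le_rfl) (by omega)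

/-- A cell is determined by its longest side. -/
theorem cell_unique_top (hR : IsAngulation n m R) {p q : ℕ → ℕ} (hp : IsCell m R p)
    (hq : IsCell m R q) (h0 : p 0 = q 0) (h1 : p (m + 1) = q (m + 1)) :
    ∀ i ≤ m + 1, p i = q i := by
  have hm := hR.one_le
  -- Two cells that agree up to index `i` leave that vertex by edges, neither of which can reach
  -- past the other; the equality follows by symmetry.
  have key : ∀ {p q : ℕ → ℕ}, IsCell m R p → IsCell m R q → p (m + 1) = q (m + 1) →
      ∀ i ≤ m, p i = q i → p (i + 1) ≤ q (i + 1) := by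
    intro p q hp hq h1 i hi h
    have hlt := hR.lt (hp.step i hi)
    have hlt' := hR.cell_lt hq (show i < m + 1 by omega) le_rfl
    have hle' := hR.cell_le hq (show 0 ≤ i by omega) (by omega)
    rcases hR.locate hq (hp.step i hi) with ⟨j, hj, h2, h3⟩ | ⟨h2, h3⟩ | h2 | h2
    · rw [h, hR.cell_le_iff hq (by omega) (by omega)] at h2
      exact h3.trans (hR.cell_le hq (by omega) (by omega))
    · have h4 : i = 0 := by
        have := (hR.cell_le_iff hq (by omega) (by omega)).1 (h ▸ h2)
        omega
      rw [← h1, hR.cell_le_iff hp le_rfl (by omega)] at h3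
      omega
    · omega
    · omega
  intro i
  induction i with
  | zero => exact fun _ => h0
  | succ i ih =>
    intro hi
    have := ih (by omega)
    exact le_antisymm (key hp hq h1 i (by omega) this) (key hq hp h1.symm i (by omega) this.symm)

/-- A cell is determined by any of its sides other than the longest one. -/
theorem cell_unique_step (hR : IsAngulation n m R) {p q : ℕ → ℕ} (hp : IsCell m R p)
    (hq : IsCell m R q) {i j : ℕ} (hi : i ≤ m) (hj : j ≤ m) (h0 : p i = q j)
    (h1 : p (i + 1) = q (j + 1)) : ∀ t ≤ m + 1, p t = q t := by
  have hm := hR.one_le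
  -- With a lower side in common, the longest side of `p` cannot lie below a side of `q`, so it lies
  -- above all of `q`. By symmetry the longest sides coincide.
  have key : ∀ {p q : ℕ → ℕ}, IsCell m R p → IsCell m R q → ∀ {i j : ℕ}, i ≤ m → j ≤ m →
      p i = q j → p (i + 1) = q (j + 1) → p 0 ≤ q 0 ∧ q (m + 1) ≤ p (m + 1) := by
    intro p q hp hq i j hi hj h0 h1
    have a1 := hR.cell_le hp (show 0 ≤ i by omega) (by omega)
    have a2 := hR.cell_le hp (show i + 1 ≤ m + 1 by omega) (by omega)
    have a3 := hR.cell_le hq (show 0 ≤ j by omega) (by omega)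
    have a4 := hR.cell_le hq (show j + 1 ≤ m + 1 by omega) (by omega)
    have a5 := hR.cell_lt hp (show i < i + 1 by omega) (by omega)
    rcases hR.locate hq hp.top with ⟨l, hl, h2, h3⟩ | h2 | h2 | h2
    · have h4 : l ≤ j := (hR.cell_le_iff hq (by omega) (by omega)).1 (by omega)
      have h5 : j + 1 ≤ l + 1 := (hR.cell_le_iff hq (by omega) (by omega)).1 (by omega)
      obtain rfl : l = j := by omega
      have h6 := hR.cell_inj hp (show 0 ≤ m + 1 by omega) (show i ≤ m + 1 by omega) (by omega)
      have h7 := hR.cell_inj hp (show m + 1 ≤ m + 1 by omega) (show i + 1 ≤ m + 1 by omega)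
        (by omega)
      omega
    · exact h2
    · omega
    · omega
  have h2 := key hp hq hi hj h0 h1
  have h3 := key hq hp hj hi h0.symm h1.symm
  exact hR.cell_unique_top hp hq (by omega) (by omega)

/-- Every edge except the root is a side, other than the longest one, of a cell. -/
theorem exists_parent (hR : IsAngulation n m R) {a b : ℕ} (h : R a b)
    (hne : ¬ (a = 0 ∧ b = n * m + 1)) : ∃ p, IsCell m R p ∧ ∃ k ≤ m, p k = a ∧ p (k + 1) = b := by
  have hab := hR.lt h
  have hb := hR.le h
  -- The parent is the cell below a shortest edge lying strictly above `a, b`: a lower side strictly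
  -- above `a, b` would be shorter.
  have hex : ∃ l x y, R x y ∧ x ≤ a ∧ b ≤ y ∧ ¬ (x = a ∧ y = b) ∧ y - x = l :=
    ⟨_, 0, n * m + 1, hR.root, by omega, by omega, by omega, rfl⟩
  obtain ⟨x, y, hxy, hx, hy, hn, hl⟩ := Nat.find_spec hex
  have hmin := fun l => Nat.find_min (m := l) hex
  obtain ⟨p, hp, hp0, hp1⟩ := hR.cell hxy (by omega)
  rcases hR.locate hp h with ⟨i, hi, h1, h2⟩ | h1 | h1 | h1
  · refine ⟨p, hp, i, hi, ?_⟩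
    by_contra hc
    have a1 := hR.cell_le hp (show 0 ≤ i by omega) (by omega)
    have a2 := hR.cell_le hp (show i + 1 ≤ m + 1 by omega) (by omega)
    refine hmin (p (i + 1) - p i) ?_ ⟨_, _, hp.step i hi, h1, h2, hc, rfl⟩
    have hm := hR.one_le
    have : 0 < i ∨ i + 1 < m + 1 := by omega
    rcases this with h3 | h3
    · have := hR.cell_lt hp h3 (by omega)
      omega
    · have := hR.cell_lt hp h3 (by omega)
      omega
  · omega
  · omega
  · omega

end IsAngulation

end EdgeRel

/-! ### Sides common to two cells. -/

namespace EdgeRel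

namespace IsAngulation

variable {n m : ℕ} {R : ℕ → ℕ → Prop}

theorem exists_side_eq (p : ℕ → ℕ) (i : ℕ) :
    ∃ j ≤ m + 1, i % (m + 2) = j ∧ j % (m + 2) = j ∧ side m p i = side m p j :=
  ⟨i % (m + 2), by have := Nat.mod_lt i (show 0 < m + 2 by omega); omega, rfl, by simp,
    (side_mod m p i).symm⟩

theorem side_rel {p : ℕ → ℕ} (hp : IsCell m R p) (i : ℕ) :
    R (side m p i).1 (side m p i).2 := by
  obtain ⟨j, hj, -, -, h⟩ := exists_side_eq (m := m) p i
  rw [h]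
  rcases Nat.lt_or_eq_of_le hj with hj | rfl
  · rw [side_of_le p (by omega)]
    exact hp.step j (by omega)
  · rw [side_top]
    exact hp.top

theorem side_sub (hR : IsAngulation n m R) {p : ℕ → ℕ} (hp : IsCell m R p) (i : ℕ) :
    p 0 ≤ (side m p i).1 ∧ (side m p i).2 ≤ p (m + 1) := by
  obtain ⟨j, hj, -, -, h⟩ := exists_side_eq (m := m) p i
  rw [h]
  rcases Nat.lt_or_eq_of_le hj with hj | rfl
  · rw [side_of_le p (by omega)]
    exact ⟨hR.cell_le hp (by omega) (by omega), hR.cell_le hp (by omega) (by omega)⟩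
  · rw [side_top]
    exact ⟨le_rfl, le_rfl⟩

/-- No side of a cell lies below another one, except the longest one. -/
theorem side_eq_of_sub (hR : IsAngulation n m R) {p : ℕ → ℕ} (hp : IsCell m R p) {i k : ℕ}
    (hk : k ≤ m) (h0 : p k ≤ (side m p i).1) (h1 : (side m p i).2 ≤ p (k + 1)) :
    i % (m + 2) = k := by
  have hm := hR.one_le
  obtain ⟨j, hj, hij, -, h⟩ := exists_side_eq (m := m) p i
  rw [hij]
  rw [h] at h0 h1
  rcases Nat.lt_or_eq_of_le hj with hj | rfl
  · rw [side_of_le p (by omega)] at h0 h1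
    have := (hR.cell_le_iff hp (by omega) (by omega)).1 h0
    have := (hR.cell_le_iff hp (by omega) (by omega)).1 h1
    omega
  · rw [side_top] at h0 h1
    have := (hR.cell_le_iff hp (by omega) (by omega)).1 h0
    have := (hR.cell_le_iff hp (by omega) (by omega)).1 h1
    omega

theorem side_inj (hR : IsAngulation n m R) {p : ℕ → ℕ} (hp : IsCell m R p) {i j : ℕ}
    (h : side m p i = side m p j) : i % (m + 2) = j % (m + 2) := by
  obtain ⟨i', hi', hi, -, h1⟩ := exists_side_eq (m := m) p i
  obtain ⟨j', hj', hj, -, h2⟩ := exists_side_eq (m := m) p j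
  rw [hi, hj]
  rcases Nat.lt_or_eq_of_le hj' with hj1 | rfl
  · rw [← hi]
    rw [h2, side_of_le p (show j' ≤ m by omega)] at h
    exact hR.side_eq_of_sub hp (by omega) (by rw [h]) (by rw [h])
  · rcases Nat.lt_or_eq_of_le hi' with hi1 | rfl
    · rw [← hj]
      rw [h1, side_of_le p (show i' ≤ m by omega)] at h
      exact (hR.side_eq_of_sub hp (by omega) (by rw [← h]) (by rw [← h])).symm
    · rfl

/-- Two different cells have at most one side in common. -/
theorem cell_unique (hR : IsAngulation n m R) {p q : ℕ → ℕ} (hp : IsCell m R p)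
    (hq : IsCell m R q) {i i' j j' : ℕ} (hne : i % (m + 2) ≠ i' % (m + 2))
    (h : side m p i = side m q j) (h' : side m p i' = side m q j') :
    ∀ t ≤ m + 1, p t = q t := by
  have key : ∀ {p q : ℕ → ℕ}, IsCell m R p → IsCell m R q → ∀ {i i' j j' : ℕ}, i ≤ m + 1 →
      j ≤ m + 1 → i' ≤ m + 1 → j' ≤ m + 1 → i ≠ i' → j ≠ j' → side m p i = side m q j →
      side m p i' = side m q j' → (i ≤ m ∨ i' = m + 1) → ∀ t ≤ m + 1, p t = q t := by
    intro p q hp hq i i' j j' hi hj hi' hj' hii hjj h h' hor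
    have s1 := hR.side_sub hp i
    have s3 := hR.side_sub hq j'
    rw [h] at s1
    rw [← h'] at s3
    by_cases h1 : i ≤ m
    · by_cases h2 : j ≤ m
      · rw [side_of_le p h1, side_of_le q h2, Prod.mk.injEq] at h
        exact hR.cell_unique_step hp hq h1 h2 h.1 h.2
      · obtain rfl : j = m + 1 := by omega
        rw [side_top] at s1
        -- Here a lower side of `p` is the longest side of `q`. If the longest side of `p` is in
        -- turn a side of `q`, both cells span the same interval; otherwise the other common side is
        -- a lower side of both.
        by_cases h3 : i' = m + 1
        · subst h3
          rw [side_top] at s3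
          exact hR.cell_unique_top hp hq (by simp at s1 s3; omega) (by simp at s1 s3; omega)
        · rw [side_of_le p (by omega), side_of_le q (by omega), Prod.mk.injEq] at h'
          exact hR.cell_unique_step hp hq (by omega) (by omega) h'.1 h'.2
    · obtain rfl : i = m + 1 := by omega
      omega
  obtain ⟨a, ha, hia, haa, h1⟩ := exists_side_eq (m := m) p i
  obtain ⟨a', ha', hia', haa', h1'⟩ := exists_side_eq (m := m) p i'
  obtain ⟨b, hb, hjb, hbb, h2⟩ := exists_side_eq (m := m) q j
  obtain ⟨b', hb', hjb', hbb', h2'⟩ := exists_side_eq (m := m) q j'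
  rw [h1, h2] at h
  rw [h1', h2'] at h'
  have hb2 : b ≠ b' := by
    rintro rfl
    have := hR.side_inj hp (h.trans h'.symm)
    omega
  by_cases h3 : a ≤ m ∨ a' = m + 1
  · exact key hp hq ha hb ha' hb' (by omega) hb2 h h' h3
  · exact key hp hq ha' hb' ha hb (by omega) hb2.symm h' h (by omega)

/-- A cell containing a lower side of `q` is either `q` itself or lies below that side; in both
cases all its sides lie below side `k` of `p`. Thus sides on opposite sides of the edge between two
cells never share a cell. -/
theorem cell_unique_of_sub {p q r : ℕ → ℕ} (hR : IsAngulation n m R) (hp : IsCell m R p)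
    (hq : IsCell m R q) (hr : IsCell m R r) {k i l s s' : ℕ} (hk : k ≤ m)
    (h0 : q 0 = p k) (h1 : q (m + 1) = p (k + 1)) (hl : l % (m + 2) ≤ m)
    (hs : side m r s = side m p i) (hs' : side m r s' = side m q l) : i % (m + 2) = k := by
  obtain ⟨l', hl', hl1, -, h2⟩ := exists_side_eq (m := m) q l
  obtain ⟨t, ht, -, -, h3⟩ := exists_side_eq (m := m) r s'
  have a1 := hR.side_sub hr s
  have a2 := hR.side_sub hq l
  rw [hs] at a1
  rw [hl1] at hl
  rw [← hs', h3] at a2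
  rw [h2, h3] at hs'
  by_cases h4 : t ≤ m
  · rw [side_of_le _ h4, side_of_le _ hl, Prod.mk.injEq] at hs'
    have h5 := hR.cell_unique_step hr hq h4 hl hs'.1 hs'.2
    rw [h5 0 (by omega), h5 (m + 1) (by omega)] at a1
    exact hR.side_eq_of_sub hp hk (by omega) (by omega)
  · obtain rfl : t = m + 1 := by omega
    rw [side_top] at a2
    simp only at a2
    exact hR.side_eq_of_sub hp hk (by omega) (by omega)

theorem side_ne_of_sub {p q : ℕ → ℕ} (hR : IsAngulation n m R) (hp : IsCell m R p)
    (hq : IsCell m R q) {k i l : ℕ} (hk : k ≤ m)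
    (h0 : q 0 = p k) (h1 : q (m + 1) = p (k + 1)) (h : side m p i = side m q l) :
    i % (m + 2) = k := by
  have a2 := hR.side_sub hq l
  rw [← h] at a2
  exact hR.side_eq_of_sub hp hk (by omega) (by omega)

end IsAngulation

/-! ### The two cells at a diagonal, and flips. -/

/-- Two cells of `R` with the common side `v k, v (k + m + 1)`, whose union is the polygon with
vertices `v 0 < v 1 < ⋯ < v (2 * m + 1)`. -/
structure IsDoubleCell (m : ℕ) (R : ℕ → ℕ → Prop) (v : ℕ → ℕ) (k : ℕ) : Prop where
  le : k ≤ m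
  step : ∀ t ≤ 2 * m, R (v t) (v (t + 1))
  top : R (v 0) (v (2 * m + 1))
  diag : R (v k) (v (k + m + 1))

/-- The cell above the diagonal `v k, v (k + m + 1)`. -/
def outerCell (m : ℕ) (v : ℕ → ℕ) (k i : ℕ) : ℕ := if i ≤ k then v i else v (i + m)

/-- The cell below the diagonal `v k, v (k + m + 1)`. -/
def innerCell (v : ℕ → ℕ) (k i : ℕ) : ℕ := v (k + i)

/-- Replace the diagonal `v k, v (k + m + 1)` by `v k', v (k' + m + 1)`. -/
def flip (m : ℕ) (R : ℕ → ℕ → Prop) (v : ℕ → ℕ) (k k' : ℕ) (a b : ℕ) : Prop :=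
  (R a b ∧ ¬ (a = v k ∧ b = v (k + m + 1))) ∨ (a = v k' ∧ b = v (k' + m + 1))

namespace IsDoubleCell

variable {n m : ℕ} {R : ℕ → ℕ → Prop} {v : ℕ → ℕ} {k : ℕ}

theorem isCell_outer (h : IsDoubleCell m R v k) : IsCell m R (outerCell m v k) := by
  have hk := h.le
  refine ⟨fun i hi => ?_, ?_⟩
  · unfold outerCell
    rcases lt_trichotomy i k with h1 | rfl | h1
    · rw [if_pos (by omega), if_pos (by omega)]
      exact h.step i (by omega)
    · rw [if_pos (by omega), if_neg (by omega), show i + 1 + m = i + m + 1 by omega]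
      exact h.diag
    · rw [if_neg (by omega), if_neg (by omega), show i + 1 + m = i + m + 1 by omega]
      exact h.step _ (by omega)
  · unfold outerCell
    rw [if_pos (by omega), if_neg (by omega), show m + 1 + m = 2 * m + 1 by omega]
    exact h.top

theorem isCell_inner (h : IsDoubleCell m R v k) : IsCell m R (innerCell v k) :=
  ⟨fun i hi => h.step (k + i) (by have := h.le; omega), h.diag⟩

theorem outerCell_left : outerCell m v k k = v k := by simp [outerCell]

theorem outerCell_right : outerCell m v k (k + 1) = v (k + m + 1) := by
  rw [outerCell, if_neg (by omega)]
  congr 1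
  omega

theorem lt (h : IsDoubleCell m R v k) (hR : IsAngulation n m R) {s t : ℕ} (hst : s < t)
    (ht : t ≤ 2 * m + 1) : v s < v t := by
  induction t with
  | zero => omega
  | succ t ih =>
    have h := hR.lt (h.step t (by omega))
    rcases Nat.lt_succ_iff_lt_or_eq.1 hst with h1 | rfl
    · exact (ih h1 (by omega)).trans h
    · exact h

theorem le_of_le (h : IsDoubleCell m R v k) (hR : IsAngulation n m R) {s t : ℕ} (hst : s ≤ t)
    (ht : t ≤ 2 * m + 1) : v s ≤ v t := by
  rcases hst.lt_or_eq with h1 | rfl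
  · exact (h.lt hR h1 ht).le
  · rfl

theorem inj (h : IsDoubleCell m R v k) (hR : IsAngulation n m R) {s t : ℕ}
    (hs : s ≤ 2 * m + 1) (ht : t ≤ 2 * m + 1) (hst : v s = v t) : s = t := by
  rcases lt_trichotomy s t with h1 | h1 | h1
  · have := h.lt hR h1 ht
    omega
  · exact h1
  · have := h.lt hR h1 hs
    omega

/-- The diagonals other than the one that is present are not edges of `R`. -/
theorem not_rel (h : IsDoubleCell m R v k) (hR : IsAngulation n m R) {k' : ℕ} (hk' : k' ≤ m)
    (hne : k' ≠ k) : ¬ R (v k') (v (k' + m + 1)) := fun h' => by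
  have hk := h.le
  rcases lt_or_gt_of_ne hne with h1 | h1
  · exact hR.noncross h' h.diag (h.lt hR h1 (by omega)) (h.lt hR (by omega) (by omega))
      (h.lt hR (by omega) (by omega))
  · exact hR.noncross h.diag h' (h.lt hR h1 (by omega)) (h.lt hR (by omega) (by omega))
      (h.lt hR (by omega) (by omega))

/-- Locate the edge with respect to the outer cell and, if it falls below the diagonal, with respect
to the inner cell as well. -/
theorem locate (h : IsDoubleCell m R v k) (hR : IsAngulation n m R) {x y : ℕ} (hxy : R x y)
    (hne : ¬ (x = v k ∧ y = v (k + m + 1))) :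
    (∃ t ≤ 2 * m, v t ≤ x ∧ y ≤ v (t + 1)) ∨ (x ≤ v 0 ∧ v (2 * m + 1) ≤ y) ∨ y ≤ v 0 ∨
      v (2 * m + 1) ≤ x := by
  have hk := h.le
  have e1 : outerCell m v k 0 = v 0 := by simp [outerCell]
  have e2 : outerCell m v k (m + 1) = v (2 * m + 1) := by
    rw [outerCell, if_neg (by omega)]
    congr 1
    omega
  rcases hR.locate h.isCell_outer hxy with ⟨i, hi, h1, h2⟩ | h1 | h1 | h1
  · rcases lt_trichotomy i k with h3 | rfl | h3
    · rw [outerCell, if_pos (by omega)] at h1 h2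
      exact Or.inl ⟨i, by omega, h1, h2⟩
    · rw [outerCell_left] at h1
      rw [outerCell_right] at h2
      have hlt := hR.lt hxy
      rcases hR.locate h.isCell_inner hxy with ⟨j, hj, h3, h4⟩ | h3 | h3 | h3
      · exact Or.inl ⟨i + j, by omega, h3, h4⟩
      · simp only [innerCell, add_zero, ← add_assoc] at h3
        omega
      · simp only [innerCell, add_zero] at h3
        omega
      · simp only [innerCell, ← add_assoc] at h3
        omega
    · rw [outerCell, if_neg (by omega)] at h1 h2
      rw [show i + 1 + m = i + m + 1 by omega] at h2
      exact Or.inl ⟨i + m, by omega, h1, h2⟩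
  · rw [e1, e2] at h1
    exact Or.inr (Or.inl h1)
  · rw [e1] at h1
    exact Or.inr (Or.inr (Or.inl h1))
  · rw [e2] at h1
    exact Or.inr (Or.inr (Or.inr h1))

theorem flip (h : IsDoubleCell m R v k) (hR : IsAngulation n m R) {k' : ℕ} (hk' : k' ≤ m) :
    IsDoubleCell m (flip m R v k k') v k' := by
  have hk := h.le
  have hm := hR.one_le
  refine ⟨hk', fun t ht => Or.inl ⟨h.step t ht, ?_⟩, Or.inl ⟨h.top, ?_⟩, Or.inr ⟨rfl, rfl⟩⟩
  · rintro ⟨h1, h2⟩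
    have := h.inj hR (by omega) (by omega) h1
    have := h.inj hR (by omega) (by omega) h2
    omega
  · rintro ⟨h1, h2⟩
    have := h.inj hR (by omega) (by omega) h1
    have := h.inj hR (by omega) (by omega) h2
    omega

theorem dvd (h : IsDoubleCell m R v k) (hR : IsAngulation n m R) {s t : ℕ} (hst : s ≤ t)
    (ht : t ≤ 2 * m + 1) : (m : ℤ) ∣ (v t : ℤ) - v s - (t - s) := by
  induction t, hst using Nat.le_induction with
  | base => simp
  | succ t hst ih =>
    have h := dvd_add (ih (by omega)) (hR.dvd (h.step t (by omega)))
    rw [show (v (t + 1) : ℤ) - v s - ((t + 1 : ℕ) - s) =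
      v t - v s - (t - s) + (v (t + 1) - v t - 1) by push_cast; ring]
    exact h

theorem noncross_diag (h : IsDoubleCell m R v k) (hR : IsAngulation n m R) {k' : ℕ} (hk' : k' ≤ m)
    {x y : ℕ} (hxy : R x y) (hne : ¬ (x = v k ∧ y = v (k + m + 1))) :
    ¬ (x < v k' ∧ v k' < y ∧ y < v (k' + m + 1)) ∧
      ¬ (v k' < x ∧ x < v (k' + m + 1) ∧ v (k' + m + 1) < y) := by
  have a1 := h.le_of_le hR (show 0 ≤ k' by omega) (by omega)
  have a2 := h.le_of_le hR (show k' + m + 1 ≤ 2 * m + 1 by omega) (by omega)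
  rcases h.locate hR hxy hne with ⟨t, ht, h1, h2⟩ | h1 | h1 | h1
  · by_cases h3 : t + 1 ≤ k'
    · have := h.le_of_le hR h3 (by omega)
      omega
    · have b1 := h.le_of_le hR (show k' ≤ t by omega) (by omega)
      by_cases h4 : t + 1 ≤ k' + m + 1
      · have := h.le_of_le hR h4 (by omega)
        omega
      · have := h.le_of_le hR (show k' + m + 1 ≤ t by omega) (by omega)
        omega
  · omega
  · omega
  · omega

/-- Other edges lie below one side of the `(2 * m + 2)`-gon or outside it, so they do not cross the
new chord, whose length is `m + 1`, that is `1`, modulo `m`. A cell with the old diagonal as a lower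
side is the outer one, and the new outer cell has the same longest side; cells without the old
diagonal survive. -/
theorem isAngulation_flip (h : IsDoubleCell m R v k) (hR : IsAngulation n m R) {k' : ℕ}
    (hk' : k' ≤ m) : IsAngulation n m (EdgeRel.flip m R v k k') := by
  have hk := h.le
  have hm := hR.one_le
  have hlt := h.lt hR (show k' < k' + m + 1 by omega) (by omega)
  refine ⟨hm, ?_, ?_, ?_, fun {a} ha => Or.inl ⟨hR.border ha, ?_⟩, Or.inl ⟨hR.root, ?_⟩, ?_, ?_⟩
  · rintro a b (⟨h1, -⟩ | ⟨rfl, rfl⟩)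
    · exact hR.lt h1
    · exact hlt
  · rintro a b (⟨h1, -⟩ | ⟨rfl, rfl⟩)
    · exact hR.le h1
    · exact (h.le_of_le hR (show k' + m + 1 ≤ 2 * m + 1 by omega) le_rfl).trans (hR.le h.top)
  · rintro a b (⟨h1, -⟩ | ⟨rfl, rfl⟩)
    · exact hR.dvd h1
    · have h1 := h.dvd hR (show k' ≤ k' + m + 1 by omega) (by omega)
      have h2 := dvd_add h1 (dvd_refl (m : ℤ))
      rwa [show (v (k' + m + 1) : ℤ) - v k' - ((k' + m + 1 : ℕ) - k') + m =
        v (k' + m + 1) - v k' - 1 by push_cast; ring] at h2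
  · rintro ⟨rfl, h2⟩
    have := h.lt hR (show k < k + 1 by omega) (by omega)
    have := h.lt hR (show k + 1 < k + m + 1 by omega) (by omega)
    omega
  · rintro ⟨h1, h2⟩
    have := hR.le h.top
    rcases Nat.eq_zero_or_pos k with rfl | h3
    · have := h.lt hR (show 0 + m + 1 < 2 * m + 1 by omega) (by omega)
      omega
    · have := h.lt hR h3 (by omega)
      omega
  · rintro a b c d (⟨h1, h1'⟩ | ⟨rfl, rfl⟩) (⟨h2, h2'⟩ | ⟨rfl, rfl⟩) h3 h4 h5
    · exact hR.noncross h1 h2 h3 h4 h5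
    · exact (h.noncross_diag hR hk' h1 h1').1 ⟨h3, h4, h5⟩
    · exact (h.noncross_diag hR hk' h2 h2').2 ⟨h3, h4, h5⟩
    · omega
  · have hd := h.flip hR hk'
    rintro a b (⟨h1, h1'⟩ | ⟨rfl, rfl⟩) hab
    · obtain ⟨q, hq, rfl, rfl⟩ := hR.cell h1 hab
      by_cases hc : ∃ i ≤ m, q i = v k ∧ q (i + 1) = v (k + m + 1)
      · obtain ⟨i, hi, h2, h3⟩ := hc
        have := hR.cell_unique_step hq h.isCell_outer hi hk (h2.trans outerCell_left.symm)
          (h3.trans outerCell_right.symm)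
        refine ⟨_, hd.isCell_outer, ?_, ?_⟩
        · rw [this 0 (by omega)]
          simp [outerCell]
        · rw [this _ le_rfl, outerCell, outerCell, if_neg (by omega), if_neg (by omega)]
      · push Not at hc
        exact ⟨q, ⟨fun i hi => Or.inl ⟨hq.step i hi, fun h2 => hc i hi h2.1 h2.2⟩,
          Or.inl ⟨hq.top, h1'⟩⟩, rfl, rfl⟩
    · exact ⟨_, hd.isCell_inner, rfl, rfl⟩

theorem flip_flip (h : IsDoubleCell m R v k) (hR : IsAngulation n m R) {k' k'' : ℕ}
    (hk' : k' ≤ m) : EdgeRel.flip m (EdgeRel.flip m R v k k') v k' k'' =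
      EdgeRel.flip m R v k k'' := by
  have h1 : k' ≠ k → ¬ R (v k') (v (k' + m + 1)) := h.not_rel hR hk'
  funext a b
  unfold EdgeRel.flip
  by_cases hkk : k' = k
  · subst hkk
    apply propext
    tauto
  · have h1 := h1 hkk
    have : a = v k' ∧ b = v (k' + m + 1) → ¬ R a b := by
      rintro ⟨rfl, rfl⟩
      exact h1
    apply propext
    tauto

theorem flip_self (h : IsDoubleCell m R v k) : EdgeRel.flip m R v k k = R := by
  funext a b
  unfold EdgeRel.flip
  have : a = v k ∧ b = v (k + m + 1) → R a b := by
    rintro ⟨rfl, rfl⟩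
    exact h.diag
  apply propext
  tauto

end IsDoubleCell

/-- Every diagonal is the common side of two cells. -/
theorem IsAngulation.exists_doubleCell {n m : ℕ} {R : ℕ → ℕ → Prop} (hR : IsAngulation n m R)
    {x : ℕ × ℕ} (hx : IsDiag n m R x) :
    ∃ v k, IsDoubleCell m R v k ∧ x = (v k, v (k + m + 1)) := by
  obtain ⟨p, hp, k, hk, h0, h1⟩ := hR.exists_parent hx.1 hx.2.2
  obtain ⟨q, hq, h2, h3⟩ := hR.cell hx.1 hx.2.1
  -- The big polygon runs through `p` up to index `k`, then through `q`, then through the rest of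
  -- `p`. The formulas agree at both junctions, as recorded in `e` and `e'`.
  have e : ∀ t, k ≤ t → t ≤ k + m + 1 → (if t ≤ k then p t else if t ≤ k + m + 1 then q (t - k)
      else p (t - m)) = q (t - k) := by
    intro t h4 h5
    split_ifs with h6
    · obtain rfl : t = k := by omega
      simp [h0, h2]
    · rfl
  have e' : ∀ t, k + m + 1 ≤ t → (if t ≤ k then p t else if t ≤ k + m + 1 then q (t - k)
      else p (t - m)) = p (t - m) := by
    intro t h4
    rw [if_neg (by omega)]
    split_ifs with h6
    · obtain rfl : t = k + m + 1 := by omega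
      rw [show k + m + 1 - k = m + 1 by omega, show k + m + 1 - m = k + 1 by omega, h1, h3]
    · rfl
  refine ⟨fun t => if t ≤ k then p t else if t ≤ k + m + 1 then q (t - k) else p (t - m), k,
    ⟨hk, fun t ht => ?_, ?_, ?_⟩, ?_⟩
  · rcases lt_or_ge t k with h4 | h4
    · simp only [if_pos h4.le, if_pos (Nat.succ_le_of_lt h4)]
      exact hp.step t (by omega)
    · rcases lt_or_ge t (k + m + 1) with h5 | h5
      · simp only [e t h4 h5.le, e (t + 1) (by omega) (by omega)]
        rw [show t + 1 - k = t - k + 1 by omega]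
        exact hq.step _ (by omega)
      · simp only [e' t h5, e' (t + 1) (by omega)]
        rw [show t + 1 - m = t - m + 1 by omega]
        exact hp.step _ (by omega)
  · simp only [e' (2 * m + 1) (by omega), Nat.zero_le, if_true]
    rw [show 2 * m + 1 - m = m + 1 by omega]
    exact hp.top
  · simp only [e k le_rfl (by omega), e (k + m + 1) (by omega) le_rfl]
    rw [show k - k = 0 by omega, show k + m + 1 - k = m + 1 by omega]
    exact hq.top
  · simp only [e k le_rfl (by omega), e (k + m + 1) (by omega) le_rfl]
    rw [show k - k = 0 by omega, show k + m + 1 - k = m + 1 by omega, h2, h3]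

end EdgeRel

/-! ### Cancellation of arrows in the second step of the mutation. -/

namespace ColouredQuiver

variable {m : ℕ}

theorem cancel_eq_self {f : Fin (m + 1) → ℕ} (h : ∀ c c', f c ≠ 0 → f c' ≠ 0 → c = c')
    (c : Fin (m + 1)) : f c - ∑ t ∈ Finset.univ.erase c, f t = f c := by
  by_cases hc : f c = 0
  · simp [hc]
  · rw [Finset.sum_eq_zero, Nat.sub_zero]
    intro t ht
    by_contra h1
    exact Finset.ne_of_mem_erase ht (h t c h1 hc)

/-- Two single arrows of different colours annihilate each other; this happens to pairs of sides
that the flip separates. -/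
theorem cancel_eq_zero {f : Fin (m + 1) → ℕ} {a b : ℕ} (ha : a ≤ m) (hb : b ≤ m) (hab : a ≠ b)
    (hf : ∀ t, f t = (if t.val = a then 1 else 0) + if t.val = b then 1 else 0)
    (c : Fin (m + 1)) : f c - ∑ t ∈ Finset.univ.erase c, f t = 0 := by
  have key : ∀ {a b : ℕ}, b ≤ m → a ≠ b →
      (∀ t, f t = (if t.val = a then 1 else 0) + if t.val = b then 1 else 0) → c.val = a →
      f c - ∑ t ∈ Finset.univ.erase c, f t = 0 := by
    intro a b hb hab hf hc
    have h1 : f ⟨b, by omega⟩ ≤ ∑ t ∈ Finset.univ.erase c, f t := by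
      apply Finset.single_le_sum (f := f) (fun _ _ => Nat.zero_le _)
      simp [Fin.ext_iff]
      omega
    rw [hf, if_neg (by simpa using hab.symm), if_pos rfl] at h1
    rw [hf c, if_pos hc, if_neg (by omega)]
    omega
  by_cases h1 : c.val = a
  · exact key hb hab hf h1
  · by_cases h2 : c.val = b
    · exact key ha hab.symm (fun t => (hf t).trans (add_comm _ _)) h2
    · rw [hf c, if_neg h1, if_neg h2, Nat.zero_sub]

end ColouredQuiver

/-! ### The mutation rule, derived from the cyclic order of sides around a diagonal. -/

namespace EdgeRel

theorem ite_eq_ite {p q : Prop} {_ : Decidable p} {_ : Decidable q} (h : p ↔ q) :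
    (if p then 1 else 0 : ℕ) = if q then 1 else 0 := by
  simp only [h]

/-- The neighbours of `e` with respect to the relation `G`, where `G α d β` means that `β` is the
`d`-th side after `α` in a common cell: the vertex `e` lies in two cells, and the other sides of
these are `x 1, …, x (m + 1)` and `y 1, …, y (m + 1)`, in this order. -/
structure IsStar {E : Type} (m : ℕ) (G : E → ℕ → E → Prop) (e : E) (x y : ℕ → E) : Prop where
  xx : ∀ {i j d}, 1 ≤ i → i ≤ m + 1 → 1 ≤ j → j ≤ m + 1 → 1 ≤ d → d ≤ m + 1 →
    (G (x i) d (x j) ↔ i + d = j ∨ i + d = j + m + 2)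
  yy : ∀ {i j d}, 1 ≤ i → i ≤ m + 1 → 1 ≤ j → j ≤ m + 1 → 1 ≤ d → d ≤ m + 1 →
    (G (y i) d (y j) ↔ i + d = j ∨ i + d = j + m + 2)
  xy : ∀ {i j d}, 1 ≤ i → i ≤ m + 1 → 1 ≤ j → j ≤ m + 1 → ¬ G (x i) d (y j)
  yx : ∀ {i j d}, 1 ≤ i → i ≤ m + 1 → 1 ≤ j → j ≤ m + 1 → ¬ G (y i) d (x j)
  ex : ∀ {d β}, 1 ≤ d → d ≤ m + 1 → (G e d β ↔ β = x d ∨ β = y d)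
  xe : ∀ {d β}, 1 ≤ d → d ≤ m + 1 → (G β d e ↔ β = x (m + 2 - d) ∨ β = y (m + 2 - d))
  x_inj : ∀ {i j}, 1 ≤ i → i ≤ m + 1 → 1 ≤ j → j ≤ m + 1 → (x i = x j ↔ i = j)
  y_inj : ∀ {i j}, 1 ≤ i → i ≤ m + 1 → 1 ≤ j → j ≤ m + 1 → (y i = y j ↔ i = j)
  x_ne_y : ∀ {i j}, 1 ≤ i → i ≤ m + 1 → 1 ≤ j → j ≤ m + 1 → x i ≠ y j
  irrefl : ∀ {α d}, 1 ≤ d → d ≤ m + 1 → ¬ G α d α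
  uniq : ∀ {α β d d'}, 1 ≤ d → d ≤ m + 1 → 1 ≤ d' → d' ≤ m + 1 → G α d β → G α d' β → d = d'

theorem IsStar.swap {E : Type} {m : ℕ} {G : E → ℕ → E → Prop} {e : E} {x y : ℕ → E}
    (h : IsStar m G e x y) : IsStar m G e y x where
  xx := h.yy
  yy := h.xx
  xy := h.yx
  yx := h.xy
  ex h1 h2 := by rw [h.ex h1 h2, or_comm]
  xe h1 h2 := by rw [h.xe h1 h2, or_comm]
  x_inj := h.y_inj
  y_inj := h.x_inj
  x_ne_y h1 h2 h3 h4 := (h.x_ne_y h3 h4 h1 h2).symm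
  irrefl := h.irrefl
  uniq := h.uniq

/-- The data for the rotation of the diagonal `e` to `e'`. -/
structure IsExchange {E : Type} (m : ℕ) (G G' : E → ℕ → E → Prop) (e e' : E) (x y x' y' : ℕ → E) :
    Prop where
  one_le : 1 ≤ m
  star : IsStar m G e x y
  star' : IsStar m G' e' x' y'
  x_one : x' 1 = y (m + 1)
  y_one : y' 1 = x (m + 1)
  x_succ : ∀ {i}, 1 ≤ i → i ≤ m → x' (i + 1) = x i
  y_succ : ∀ {i}, 1 ≤ i → i ≤ m → y' (i + 1) = y i
  outside : ∀ {α β d}, α ≠ e → β ≠ e → α ≠ e' → β ≠ e' →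
    ((∀ i, 1 ≤ i → i ≤ m + 1 → α ≠ x i ∧ α ≠ y i) ∨
      (∀ i, 1 ≤ i → i ≤ m + 1 → β ≠ x i ∧ β ≠ y i)) → (G α d β ↔ G' α d β)

namespace IsExchange

variable {E : Type} {m : ℕ} {G G' : E → ℕ → E → Prop} {e e' : E} {x y x' y' : ℕ → E}

theorem swap (h : IsExchange m G G' e e' x y x' y') : IsExchange m G G' e e' y x y' x' where
  one_le := h.one_le
  star := h.star.swap
  star' := h.star'.swap
  x_one := h.y_one
  y_one := h.x_one
  x_succ := h.y_succ
  y_succ := h.x_succ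
  outside h1 h2 h3 h4 h5 := h.outside h1 h2 h3 h4 (by simpa only [and_comm] using h5)

/-- The number of arrows of colour `t` from `α` to `β` after the first step of the mutation
at `e`. -/
def count (m : ℕ) (G : E → ℕ → E → Prop) (e α β : E) (t : Fin (m + 1)) : ℕ :=
  (if G α (m + 1 - t.val) β then 1 else 0) +
    ((if G α (m + 1 - t.val) e then 1 else 0) * (if G e (m + 1) β then 1 else 0) +
      (if G β (m + 1 - t.rev.val) e then 1 else 0) * (if G e (m + 1) α then 1 else 0))

/-- Two sides share at most one cell, so their distance, and hence the colour, is unique and nothing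
cancels. -/
theorem cancel_eq (h : IsStar m G e x y) {α β : E} {f : Fin (m + 1) → ℕ}
    (hf : ∀ t, f t = if G α (m + 1 - t.val) β then 1 else 0) (c : Fin (m + 1)) :
    f c - ∑ t ∈ Finset.univ.erase c, f t = if G α (m + 1 - c.val) β then 1 else 0 := by
  rw [ColouredQuiver.cancel_eq_self, hf]
  intro a b ha hb
  rw [hf] at ha hb
  have h1 : G α (m + 1 - a.val) β := by
    by_contra h1
    simp [h1] at ha
  have h2 : G α (m + 1 - b.val) β := by
    by_contra h2
    simp [h2] at hb
  have := h.uniq (by omega) (by omega) (by omega) (by omega) h1 h2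
  ext
  omega

/-- An element is `x i` with `i ≤ m`, or `x (m + 1)`, or `y i` with `i ≤ m`, or `y (m + 1)`, or
none of these. -/
theorem cases (m : ℕ) (x y : ℕ → E) (α : E) :
    (∃ i, 1 ≤ i ∧ i ≤ m ∧ α = x i) ∨ α = x (m + 1) ∨ (∃ i, 1 ≤ i ∧ i ≤ m ∧ α = y i) ∨
      α = y (m + 1) ∨ ∀ i, 1 ≤ i → i ≤ m + 1 → α ≠ x i ∧ α ≠ y i := by
  by_contra! hc
  obtain ⟨h1, h2, h3, h4, i, hi, hi', h5⟩ := hc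
  rcases Nat.lt_or_eq_of_le hi' with h6 | rfl
  · exact h3 i hi (by omega) (h5 (h1 i hi (by omega)))
  · exact h4 (h5 h2)

/-- The side `x (m + 1)` receives a colour `0` arrow from `e` and moves to the other cell. Its arrow
to an old companion `x i` has colour `m - i` and meets an added arrow of colour `m + 1 - i`; its
only arrow to a new companion `y i` with `i ≤ m` is an added one. -/
theorem cancel_of_left_last (h : IsExchange m G G' e e' x y x' y') {β : E}
    (hβ : β ≠ e) (hβ' : β ≠ e') (hx : x (m + 1) ≠ e) (hx' : x (m + 1) ≠ e')
    (hne : x (m + 1) ≠ β) (c : Fin (m + 1)) :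
    count m G e (x (m + 1)) β c - ∑ t ∈ Finset.univ.erase c, count m G e (x (m + 1)) β t =
      if G' (x (m + 1)) (m + 1 - c.val) β then 1 else 0 := by
  have hm := h.one_le
  have hs := h.star
  have hE : G e (m + 1) (x (m + 1)) := (hs.ex (by omega) le_rfl).2 (Or.inl rfl)
  rcases cases m x y β with ⟨i, hi, him, rfl⟩ | rfl | ⟨i, hi, him, rfl⟩ | rfl | hn
  · have hN : ¬ G e (m + 1) (x i) := by
      rw [hs.ex (by omega) le_rfl, hs.x_inj hi (by omega) (by omega) le_rfl]
      have := hs.x_ne_y hi (show i ≤ m + 1 by omega) (show 1 ≤ m + 1 by omega) le_rfl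
      simp only [this, or_false]
      omega
    have hG : ¬ G' (x (m + 1)) (m + 1 - c.val) (x i) := by
      rw [← h.y_one, ← h.x_succ hi him]
      exact h.star'.yx le_rfl (by omega) (by omega) (by omega)
    rw [if_neg hG]
    refine ColouredQuiver.cancel_eq_zero (a := m - i) (b := m + 1 - i) (by omega) (by omega)
      (by omega) (fun t => ?_) c
    have ht := t.isLt
    have hr : t.rev.val = m - t.val := by simp [Fin.val_rev]
    simp only [count, hE, hN, if_true, if_false, hr, mul_one, mul_zero, zero_add]
    rw [hs.xx (by omega) le_rfl hi (by omega) (by omega) (by omega),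
      hs.xe (by omega) (by omega), hs.x_inj hi (by omega) (by omega) (by omega)]
    have := hs.x_ne_y hi (show i ≤ m + 1 by omega)
      (show 1 ≤ m + 2 - (m + 1 - (m - t.val)) by omega) (by omega)
    simp only [this, or_false]
    congr 1 <;> refine ite_eq_ite ?_ <;> omega
  · exact absurd rfl hne
  · have hN : ¬ G e (m + 1) (y i) := by
      rw [hs.ex (by omega) le_rfl, hs.y_inj hi (by omega) (by omega) le_rfl]
      have := hs.x_ne_y (show 1 ≤ m + 1 by omega) le_rfl hi (show i ≤ m + 1 by omega)
      simp only [this.symm, false_or]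
      omega
    refine cancel_eq (α := x (m + 1)) (β := y i) h.star' (fun t => ?_) c
    have ht := t.isLt
    have hr : t.rev.val = m - t.val := by simp [Fin.val_rev]
    have hN2 : ¬ G (x (m + 1)) (m + 1 - t.val) (y i) :=
      hs.xy (by omega) le_rfl hi (by omega)
    simp only [count, hE, hN, hN2, if_true, if_false, hr, mul_one, mul_zero, zero_add]
    rw [hs.xe (by omega) (by omega), hs.y_inj hi (by omega) (by omega) (by omega),
      ← h.y_one, ← h.y_succ hi him, h.star'.yy le_rfl (by omega) (by omega) (by omega) (by omega)
        (by omega), h.y_succ hi him]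
    have := hs.x_ne_y (show 1 ≤ m + 2 - (m + 1 - (m - t.val)) by omega) (by omega) hi
      (show i ≤ m + 1 by omega)
    simp only [this.symm, false_or]
    refine ite_eq_ite ?_
    omega
  · have hE2 : G e (m + 1) (y (m + 1)) := (hs.ex (by omega) le_rfl).2 (Or.inr rfl)
    have hG : ¬ G' (x (m + 1)) (m + 1 - c.val) (y (m + 1)) := by
      rw [← h.y_one, ← h.x_one]
      exact h.star'.yx le_rfl (by omega) (by omega) (by omega)
    rw [if_neg hG]
    -- The two moving sides exchange cells and stay apart. Paths through `e` in both directions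
    -- contribute the colours `m` and `0`, which differ because `1 ≤ m`.
    refine ColouredQuiver.cancel_eq_zero (a := m) (b := 0) (by omega) (by omega)
      (by omega) (fun t => ?_) c
    have ht := t.isLt
    have hr : t.rev.val = m - t.val := by simp [Fin.val_rev]
    have hN2 : ¬ G (x (m + 1)) (m + 1 - t.val) (y (m + 1)) :=
      hs.xy (by omega) le_rfl (by omega) (by omega)
    simp only [count, hE, hE2, hN2, if_true, if_false, hr, mul_one, zero_add]
    rw [hs.xe (by omega) (by omega), hs.xe (by omega) (by omega),
      hs.x_inj (by omega) le_rfl (by omega) (by omega),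
      hs.y_inj (by omega) le_rfl (by omega) (by omega)]
    have a1 := hs.x_ne_y (show 1 ≤ m + 1 by omega) le_rfl
      (show 1 ≤ m + 2 - (m + 1 - t.val) by omega) (by omega)
    have a2 := hs.x_ne_y (show 1 ≤ m + 2 - (m + 1 - (m - t.val)) by omega) (by omega)
      (show 1 ≤ m + 1 by omega) le_rfl
    simp only [a1, a2.symm, or_false, false_or]
    congr 1 <;> refine ite_eq_ite ?_ <;> omega
  · have hN : ¬ G e (m + 1) β := by
      rw [hs.ex (by omega) le_rfl, not_or]
      exact hn _ (by omega) le_rfl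
    refine cancel_eq (α := x (m + 1)) (β := β) h.star' (fun t => ?_) c
    have ht := t.isLt
    have hr : t.rev.val = m - t.val := by simp [Fin.val_rev]
    have hN2 : ¬ G β (m + 1 - t.rev.val) e := by
      rw [hs.xe (by omega) (by omega), not_or]
      exact hn _ (by omega) (by omega)
    simp only [count, hE, hN, hN2, if_true, if_false, mul_zero, zero_mul, add_zero]
    exact ite_eq_ite (h.outside hx hβ hx' hβ' (Or.inr hn))

/-- Arrows into a moving side from a side that stays. For an old companion `x i` the colours are `i`
(present before) and `i - 1` (added), and they cancel. -/
theorem cancel_of_right_last (h : IsExchange m G G' e e' x y x' y') {α : E}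
    (hα : α ≠ e) (hα' : α ≠ e') (hx : x (m + 1) ≠ e) (hx' : x (m + 1) ≠ e')
    (hαx : α ≠ x (m + 1)) (hαy : α ≠ y (m + 1)) (c : Fin (m + 1)) :
    count m G e α (x (m + 1)) c - ∑ t ∈ Finset.univ.erase c, count m G e α (x (m + 1)) t =
      if G' α (m + 1 - c.val) (x (m + 1)) then 1 else 0 := by
  have hm := h.one_le
  have hs := h.star
  have hE : G e (m + 1) (x (m + 1)) := (hs.ex (by omega) le_rfl).2 (Or.inl rfl)
  have hN : ¬ G e (m + 1) α := by
    rw [hs.ex (by omega) le_rfl, not_or]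
    exact ⟨hαx, hαy⟩
  have hcount : ∀ t, count m G e α (x (m + 1)) t =
      (if G α (m + 1 - t.val) (x (m + 1)) then 1 else 0) +
        if G α (m + 1 - t.val) e then 1 else 0 := by
    intro t
    simp only [count, hE, hN, if_true, if_false, mul_one, mul_zero, add_zero]
  rcases cases m x y α with ⟨i, hi, him, rfl⟩ | rfl | ⟨i, hi, him, rfl⟩ | rfl | hn
  · have hG : ¬ G' (x i) (m + 1 - c.val) (x (m + 1)) := by
      rw [← h.y_one, ← h.x_succ hi him]
      exact h.star'.xy (by omega) (by omega) le_rfl (by omega)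
    rw [if_neg hG]
    refine ColouredQuiver.cancel_eq_zero (a := i) (b := i - 1) (by omega) (by omega)
      (by omega) (fun t => ?_) c
    have ht := t.isLt
    rw [hcount, hs.xx hi (by omega) (by omega) le_rfl (by omega) (by omega),
      hs.xe (by omega) (by omega), hs.x_inj hi (by omega) (by omega) (by omega)]
    have := hs.x_ne_y hi (show i ≤ m + 1 by omega)
      (show 1 ≤ m + 2 - (m + 1 - t.val) by omega) (by omega)
    simp only [this, or_false]
    congr 1 <;> refine ite_eq_ite ?_ <;> omega
  · exact absurd rfl hαx
  · refine cancel_eq (α := y i) (β := x (m + 1)) h.star' (fun t => ?_) c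
    have ht := t.isLt
    rw [hcount, if_neg (hs.yx hi (by omega) (by omega) le_rfl), zero_add,
      hs.xe (by omega) (by omega), hs.y_inj hi (by omega) (by omega) (by omega),
      ← h.y_one, ← h.y_succ hi him, h.star'.yy (by omega) (by omega) le_rfl (by omega) (by omega)
        (by omega), h.y_succ hi him]
    have := hs.x_ne_y (show 1 ≤ m + 2 - (m + 1 - t.val) by omega) (by omega) hi
      (show i ≤ m + 1 by omega)
    simp only [this.symm, false_or]
    refine ite_eq_ite ?_
    omega
  · exact absurd rfl hαy
  · refine cancel_eq (α := α) (β := x (m + 1)) h.star' (fun t => ?_) c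
    have ht := t.isLt
    have hN2 : ¬ G α (m + 1 - t.val) e := by
      rw [hs.xe (by omega) (by omega), not_or]
      exact hn _ (by omega) (by omega)
    rw [hcount, if_neg hN2, add_zero]
    exact ite_eq_ite (h.outside hα hx hα' hx' (Or.inl hn))

/-- No arrow of colour `0` leads from `e` to either vertex, so nothing is added. Both keep their
cells, and the shift of indices by one preserves their distance. -/
theorem cancel_of_not_last (h : IsExchange m G G' e e' x y x' y') {α β : E}
    (hα : α ≠ e) (hα' : α ≠ e') (hβ : β ≠ e) (hβ' : β ≠ e')
    (hαx : α ≠ x (m + 1)) (hαy : α ≠ y (m + 1)) (hβx : β ≠ x (m + 1)) (hβy : β ≠ y (m + 1))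
    (c : Fin (m + 1)) : count m G e α β c - ∑ t ∈ Finset.univ.erase c, count m G e α β t =
      if G' α (m + 1 - c.val) β then 1 else 0 := by
  have hm := h.one_le
  have hs := h.star
  have hs' := h.star'
  have hN1 : ¬ G e (m + 1) α := by
    rw [hs.ex (by omega) le_rfl, not_or]
    exact ⟨hαx, hαy⟩
  have hN2 : ¬ G e (m + 1) β := by
    rw [hs.ex (by omega) le_rfl, not_or]
    exact ⟨hβx, hβy⟩
  refine cancel_eq (α := α) (β := β) h.star' (fun t => ?_) c
  have ht := t.isLt
  simp only [count, hN1, hN2, if_false, mul_zero, add_zero]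
  refine ite_eq_ite ?_
  rcases cases m x y α with ⟨i, hi, him, rfl⟩ | rfl | ⟨i, hi, him, rfl⟩ | rfl | hn
  · rcases cases m x y β with ⟨j, hj, hjm, rfl⟩ | rfl | ⟨j, hj, hjm, rfl⟩ | rfl | hn
    · rw [hs.xx hi (by omega) hj (by omega) (by omega) (by omega), ← h.x_succ hi him,
        ← h.x_succ hj hjm, hs'.xx (by omega) (by omega) (by omega) (by omega) (by omega) (by omega)]
      omega
    · exact absurd rfl hβx
    · rw [← h.x_succ hi him, ← h.y_succ hj hjm]
      refine iff_of_false ?_ (hs'.xy (by omega) (by omega) (by omega) (by omega))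
      rw [h.x_succ hi him, h.y_succ hj hjm]
      exact hs.xy hi (by omega) hj (by omega)
    · exact absurd rfl hβy
    · exact h.outside hα hβ hα' hβ' (Or.inr hn)
  · exact absurd rfl hαx
  · rcases cases m x y β with ⟨j, hj, hjm, rfl⟩ | rfl | ⟨j, hj, hjm, rfl⟩ | rfl | hn
    · rw [← h.y_succ hi him, ← h.x_succ hj hjm]
      refine iff_of_false ?_ (hs'.yx (by omega) (by omega) (by omega) (by omega))
      rw [h.y_succ hi him, h.x_succ hj hjm]
      exact hs.yx hi (by omega) hj (by omega)
    · exact absurd rfl hβx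
    · rw [hs.yy hi (by omega) hj (by omega) (by omega) (by omega), ← h.y_succ hi him,
        ← h.y_succ hj hjm, hs'.yy (by omega) (by omega) (by omega) (by omega) (by omega) (by omega)]
      omega
    · exact absurd rfl hβy
    · exact h.outside hα hβ hα' hβ' (Or.inr hn)
  · exact absurd rfl hαy
  · exact h.outside hα hβ hα' hβ' (Or.inl hn)

theorem cancel_count (h : IsExchange m G G' e e' x y x' y') {α β : E}
    (hα : α ≠ e) (hα' : α ≠ e') (hβ : β ≠ e) (hβ' : β ≠ e') (hne : α ≠ β) (c : Fin (m + 1)) :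
    count m G e α β c - ∑ t ∈ Finset.univ.erase c, count m G e α β t =
      if G' α (m + 1 - c.val) β then 1 else 0 := by
  by_cases h1 : α = x (m + 1)
  · subst h1
    exact h.cancel_of_left_last hβ hβ' hα hα' hne c
  by_cases h2 : α = y (m + 1)
  · subst h2
    exact h.swap.cancel_of_left_last hβ hβ' hα hα' hne c
  by_cases h3 : β = x (m + 1)
  · subst h3
    exact h.cancel_of_right_last hα hα' hβ hβ' h1 h2 c
  by_cases h4 : β = y (m + 1)
  · subst h4
    exact h.swap.cancel_of_right_last hα hα' hβ hβ' h2 h1 c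
  exact h.cancel_of_not_last hα hα' hβ hβ' h1 h2 h3 h4 c

/-- The wrap-around of colours from `m` to `0` corresponds to the side that crosses over: `x' 1 = y
(m + 1)` and `y' 1 = x (m + 1)`. -/
theorem out_iff (h : IsExchange m G G' e e' x y x' y') (β : E) (c : Fin (m + 1)) :
    G' e' (m + 1 - c.val) β ↔ G e (m + 1 - (c + 1).val) β := by
  have hc := c.isLt
  have hm := h.one_le
  have hc' := (c + 1).isLt
  rw [h.star'.ex (by omega) (by omega), h.star.ex (Nat.sub_pos_of_lt hc') (Nat.sub_le _ _),
    Fin.val_add_one]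
  split_ifs with h1
  · have h2 : m + 1 - c.val = 1 := by simp [h1]
    rw [h2, h.x_one, h.y_one, or_comm, Nat.sub_zero]
  · have h2 : c.val ≠ m := fun h2 => h1 (Fin.ext h2)
    have h3 : m + 1 - c.val = (m - c.val) + 1 := by omega
    rw [h3, h.x_succ (by omega) (by omega), h.y_succ (by omega) (by omega),
      show m + 1 - (c.val + 1) = m - c.val by omega]

theorem in_iff (h : IsExchange m G G' e e' x y x' y') (β : E) (c : Fin (m + 1)) :
    G' β (m + 1 - c.val) e' ↔ G β (m + 1 - (c - 1).val) e := by
  have hc := c.isLt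
  have hm := h.one_le
  have hc' := (c - 1).isLt
  rw [h.star'.xe (by omega) (by omega), h.star.xe (Nat.sub_pos_of_lt hc') (Nat.sub_le _ _),
    Fin.coe_sub_one]
  split_ifs with h1
  · rw [h1, Fin.val_zero, show m + 2 - (m + 1 - 0) = 1 by omega,
      show m + 2 - (m + 1 - m) = m + 1 by omega, h.x_one, h.y_one, or_comm]
  · have h2 : c.val ≠ 0 := fun h2 => h1 (Fin.ext h2)
    rw [show m + 2 - (m + 1 - c.val) = c.val + 1 by omega,
      show m + 2 - (m + 1 - (c.val - 1)) = c.val by omega, h.x_succ (by omega) (by omega),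
      h.y_succ (by omega) (by omega)]

/-- Rotating the diagonal `e` is the mutation of the coloured quiver at `e`. -/
theorem iso_mutate (h : IsExchange m G G' e e' x y x' y') {P P' : E → Prop} (he : P e)
    (he' : ¬ P e') (hP : ∀ z, P' z ↔ (P z ∧ z ≠ e) ∨ z = e') :
    ColouredQuiver.Iso (m := m)
      (ColouredQuiver.mutate
        ⟨{z // P z}, fun α β c => if G α.1 (m + 1 - c.val) β.1 then 1 else 0⟩ ⟨e, he⟩)
      ⟨{z // P' z}, fun α β c => if G' α.1 (m + 1 - c.val) β.1 then 1 else 0⟩ := by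
  have hne : ∀ {z}, P z → z ≠ e' := by
    rintro z hz rfl
    exact he' hz
  have hee : e ≠ e' := hne he
  let φ : {z // P z} ≃ {z // P' z} :=
    { toFun := fun z => if hz : z.1 = e then ⟨e', (hP _).2 (Or.inr rfl)⟩ else
        ⟨z.1, (hP _).2 (Or.inl ⟨z.2, hz⟩)⟩
      invFun := fun z => if hz : z.1 = e' then ⟨e, he⟩ else
        ⟨z.1, (((hP _).1 z.2).resolve_right hz).1⟩
      left_inv := by
        rintro ⟨z, hz⟩
        by_cases h1 : z = e
        · simp [h1]
        · simp [h1, hne hz]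
      right_inv := by
        rintro ⟨z, hz⟩
        by_cases h1 : z = e'
        · simp [h1]
        · have := (((hP _).1 hz).resolve_right h1).2
          simp [h1, this] }
  have φe : (φ ⟨e, he⟩).1 = e' := by simp [φ]
  have φne : ∀ z (hz : P z), z ≠ e → (φ ⟨z, hz⟩).1 = z := fun z hz h1 => by simp [φ, h1]
  refine ⟨φ, ?_⟩
  have hb : ∀ t : Fin (m + 1), 1 ≤ m + 1 - t.val ∧ m + 1 - t.val ≤ m + 1 := fun t => by
    have := t.isLt
    omega
  rintro ⟨α, hα⟩ ⟨β, hβ⟩ c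
  change (if G' (φ ⟨α, hα⟩).1 (m + 1 - c.val) (φ ⟨β, hβ⟩).1 then 1 else 0) = _
  simp only [ColouredQuiver.mutate, ColouredQuiver.shiftColours, ColouredQuiver.cancelArrows,
    ColouredQuiver.addArrows, Subtype.mk.injEq]
  have irr : ∀ {α d}, 1 ≤ d → d ≤ m + 1 → ¬ G α d α := h.star.irrefl
  by_cases h1 : α = e
  · subst h1
    by_cases h2 : β = α
    · subst h2
      rw [if_neg (by rw [φe]; exact h.star'.irrefl (hb _).1 (hb _).2)]
      rw [if_neg (irr (hb _).1 (hb _).2)]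
      simp
    · rw [φe, φne β hβ h2, if_neg h2, if_pos rfl]
      simp only [Ne.symm h2, if_false]
      symm
      -- Since `e` never follows itself, the first step adds no arrow at `e`; only the shift of
      -- colours acts there.
      refine (cancel_eq (f := count m G α α β) (α := α) (β := β) h.star (fun t => ?_)
        (c - 0 + 1)).trans ?_
      · simp [count, irr (hb t).1 (hb t).2, irr (α := α) (d := m + 1) (by omega) le_rfl]
      · rw [sub_zero]
        exact ite_eq_ite (h.out_iff β c).symm
  · by_cases h2 : β = e
    · subst h2
      rw [φe, φne α hα h1, if_neg h1, if_pos rfl]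
      symm
      simp only [if_neg h1]
      refine (cancel_eq (f := count m G β α β) (α := α) (β := β) h.star (fun t => ?_)
        (c - 1 + 0)).trans ?_
      · simp only [count, irr (hb t.rev).1 (hb t.rev).2,
          irr (α := β) (d := m + 1) (by omega) le_rfl, if_false, mul_zero, zero_mul, add_zero]
      · rw [add_zero]
        exact ite_eq_ite (h.in_iff α c).symm
    · rw [φne α hα h1, φne β hβ h2]
      simp only [if_neg h1, if_neg h2, sub_zero, add_zero]
      by_cases h3 : α = β
      · subst h3
        rw [if_neg (h.star'.irrefl (hb _).1 (hb _).2),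
          if_neg (irr (hb _).1 (hb _).2)]
        simp
      · simp only [if_neg h3]
        rw [← h.cancel_count h1 (hne hα) h2 (hne hβ) h3 c]
        simp only [count, Fin.val_zero, Nat.sub_zero]
        rfl

end IsExchange

end EdgeRel

/-! ### Flips of diagonals are mutations. -/

namespace EdgeRel

theorem add_mod_ne {m d : ℕ} (s : ℕ) (h1 : 1 ≤ d) (h2 : d ≤ m + 1) :
    s % (m + 2) ≠ (s + d) % (m + 2) := by
  intro h
  have h3 : s + 0 ≡ s + d [MOD m + 2] := h
  have h4 := h3.add_left_cancel'
  rw [Nat.ModEq, Nat.zero_mod, Nat.mod_eq_of_lt (by omega)] at h4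
  omega

theorem add_mod_eq_iff {m i j d : ℕ} (hi : 1 ≤ i) (hi' : i ≤ m + 1) (hj : 1 ≤ j)
    (hj' : j ≤ m + 1) (hd' : d ≤ m + 1) (k : ℕ) :
    (k + i + d) % (m + 2) = (k + j) % (m + 2) ↔ i + d = j ∨ i + d = j + m + 2 := by
  have h : (k + i + d) % (m + 2) = (k + j) % (m + 2) ↔ (i + d) % (m + 2) = j % (m + 2) := by
    rw [add_assoc]
    exact ⟨fun h => Nat.ModEq.add_left_cancel' k h, fun h => Nat.ModEq.add_left k h⟩
  rw [h, Nat.mod_eq_of_lt (show j < m + 2 by omega)]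
  rcases lt_or_ge (i + d) (m + 2) with h1 | h1
  · rw [Nat.mod_eq_of_lt h1]
    omega
  · rw [Nat.mod_eq_sub_mod h1, Nat.mod_eq_of_lt (by omega)]
    omega

namespace IsAngulation

variable {n m : ℕ} {R : ℕ → ℕ → Prop}

/-- Two distinct sides determine their cell by `cell_unique`, so the distance may be computed in any
cell known to contain both. -/
theorem follows_side (hR : IsAngulation n m R) {p : ℕ → ℕ} (hp : IsCell m R p) {i j d : ℕ}
    (h1 : 1 ≤ d) (h2 : d ≤ m + 1) :
    Follows m R (side m p i) d (side m p j) ↔ (i + d) % (m + 2) = j % (m + 2) := by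
  constructor
  · rintro ⟨r, hr, s, hs, hsd⟩
    have h := hR.cell_unique hr hp (add_mod_ne s h1 h2) hs hsd
    rw [side_congr h] at hs hsd
    have h3 : s ≡ i [MOD m + 2] := hR.side_inj hp hs
    have h4 := hR.side_inj hp hsd
    rw [← h4]
    exact (h3.add_right d).symm
  · intro h
    exact ⟨p, hp, i, rfl, by rw [← side_mod, h, side_mod]⟩

theorem follows_irrefl (hR : IsAngulation n m R) {α : ℕ × ℕ} {d : ℕ} (h1 : 1 ≤ d)
    (h2 : d ≤ m + 1) : ¬ Follows m R α d α := by
  rintro ⟨r, hr, s, hs, hsd⟩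
  exact add_mod_ne s h1 h2 (hR.side_inj hr (hs.trans hsd.symm))

theorem follows_uniq (hR : IsAngulation n m R) {α β : ℕ × ℕ} {d d' : ℕ} (_ : 1 ≤ d)
    (h2 : d ≤ m + 1) (h1' : 1 ≤ d') (h2' : d' ≤ m + 1) (h : Follows m R α d β)
    (h' : Follows m R α d' β) : d = d' := by
  obtain ⟨r, hr, s, rfl, rfl⟩ := h
  rw [hR.follows_side hr h1' h2'] at h'
  have h3 := Nat.ModEq.add_left_cancel' s h'
  rw [Nat.ModEq, Nat.mod_eq_of_lt (by omega), Nat.mod_eq_of_lt (by omega)] at h3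
  exact h3.symm

end IsAngulation

theorem Follows.symm {m : ℕ} {R : ℕ → ℕ → Prop} {α β : ℕ × ℕ} {d : ℕ} (h : Follows m R α d β)
    (hd : d ≤ m + 2) : Follows m R β (m + 2 - d) α := by
  obtain ⟨r, hr, s, rfl, rfl⟩ := h
  exact ⟨r, hr, s + d, rfl, by rw [show s + d + (m + 2 - d) = s + (m + 2) by omega, side_add]⟩

namespace IsDoubleCell

variable {n m : ℕ} {R : ℕ → ℕ → Prop} {v : ℕ → ℕ} {k : ℕ}

/-- With `side_inner`, this numbers the sides of both cells by the sides of the surrounding `(2 * m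
+ 2)`-gon, which do not depend on the chord; comparing two chords thus becomes arithmetic of
indices. -/
theorem side_outer (hk : k ≤ m) {i : ℕ} (hi : 1 ≤ i) (hi' : i ≤ m + 1) :
    side m (outerCell m v k) (k + i) = side (2 * m) v (k + m + i) := by
  rcases lt_trichotomy (k + i) (m + 1) with h | h | h
  · rw [side_of_le _ (by omega), side_of_le _ (by omega), outerCell, outerCell, if_neg (by omega),
      if_neg (by omega), show k + i + m = k + m + i by omega,
      show k + i + 1 + m = k + m + i + 1 by omega]
  · rw [h, side_top, show k + m + i = 2 * m + 1 by omega, side_top, outerCell, outerCell,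
      if_pos (by omega), if_neg (by omega), show m + 1 + m = 2 * m + 1 by omega]
  · obtain ⟨j, hj⟩ : ∃ j, k + i = j + (m + 2) := ⟨k + i - (m + 2), by omega⟩
    rw [hj, side_add, show k + m + i = j + (2 * m + 2) by omega, side_add,
      side_of_le _ (by omega), side_of_le _ (by omega), outerCell, outerCell, if_pos (by omega),
      if_pos (by omega)]

theorem side_inner (hk : k ≤ m) {i : ℕ} (hi : 1 ≤ i) (hi' : i ≤ m + 1) :
    side m (innerCell v k) (m + 1 + i) = side (2 * m) v (k + i - 1) := by
  rw [show m + 1 + i = i - 1 + (m + 2) by omega, side_add, side_of_le _ (by omega),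
    side_of_le _ (by omega), innerCell, innerCell, show k + (i - 1) = k + i - 1 by omega,
    show k + (i - 1 + 1) = k + i - 1 + 1 by omega]

theorem side_outer_self (hk : k ≤ m) :
    side m (outerCell m v k) k = (v k, v (k + m + 1)) := by
  rw [side_of_le _ hk, outerCell_left, outerCell_right]

theorem side_inner_top : side m (innerCell v k) (m + 1) = (v k, v (k + m + 1)) := by
  rw [side_top]
  rfl

/-- The only cells with the side `v k, v (k + m + 1)` are the two given ones. -/
theorem cell_eq (h : IsDoubleCell m R v k) (hR : IsAngulation n m R) {r : ℕ → ℕ}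
    (hr : IsCell m R r) {s : ℕ} (hs : side m r s = (v k, v (k + m + 1))) :
    ((∀ i, side m r i = side m (outerCell m v k) i) ∧ s % (m + 2) = k % (m + 2)) ∨
      ((∀ i, side m r i = side m (innerCell v k) i) ∧ s % (m + 2) = (m + 1) % (m + 2)) := by
  obtain ⟨t, ht, -, -, h1⟩ := IsAngulation.exists_side_eq (m := m) r s
  have hs' := hs
  rw [h1] at hs'
  rcases Nat.lt_or_eq_of_le ht with ht | rfl
  · rw [side_of_le _ (by omega), Prod.mk.injEq] at hs'
    have h2 := hR.cell_unique_step hr h.isCell_outer (show t ≤ m by omega) h.le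
      (hs'.1.trans outerCell_left.symm) (hs'.2.trans outerCell_right.symm)
    have h3 := side_congr (m := m) h2
    refine Or.inl ⟨h3, hR.side_inj h.isCell_outer ?_⟩
    rw [← h3, hs, side_outer_self h.le]
  · rw [side_top, Prod.mk.injEq] at hs'
    have h2 := hR.cell_unique_top hr h.isCell_inner hs'.1 hs'.2
    have h3 := side_congr (m := m) h2
    refine Or.inr ⟨h3, hR.side_inj h.isCell_inner ?_⟩
    rw [← h3, hs, side_inner_top]

/-- The arrows at the diagonal come from its only two cells (`cell_eq`), and `cell_unique_of_sub`
excludes arrows between an outer and an inner side. -/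
theorem isStar (h : IsDoubleCell m R v k) (hR : IsAngulation n m R) :
    IsStar m (Follows m R) (v k, v (k + m + 1)) (fun i => side m (outerCell m v k) (k + i))
      (fun i => side m (innerCell v k) (m + 1 + i)) := by
  have hk := h.le
  have e0 : innerCell v k 0 = outerCell m v k k := by simp [innerCell, outerCell]
  have e1 : innerCell v k (m + 1) = outerCell m v k (k + 1) := outerCell_right.symm
  have hmod : ∀ {j}, 1 ≤ j → j ≤ m + 1 → (m + 1 + j) % (m + 2) ≤ m := by
    intro j h1 h2
    rw [show m + 1 + j = j - 1 + (m + 2) by omega, Nat.add_mod_right, Nat.mod_eq_of_lt] <;> omega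
  have hmod' : ∀ {i}, 1 ≤ i → i ≤ m + 1 → (k + i) % (m + 2) ≠ k := by
    intro i h1 h2
    have := add_mod_ne k h1 h2
    rw [Nat.mod_eq_of_lt (by omega)] at this
    exact this.symm
  have hinj : ∀ {p : ℕ → ℕ}, IsCell m R p → ∀ (l : ℕ) {i j : ℕ}, i ≤ m + 1 → j ≤ m + 1 →
      (side m p (l + i) = side m p (l + j) ↔ i = j) := by
    intro p hp l i j hi hj
    refine ⟨fun h1 => ?_, fun h1 => by rw [h1]⟩
    have h2 := Nat.ModEq.add_left_cancel' l (hR.side_inj hp h1)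
    rw [Nat.ModEq, Nat.mod_eq_of_lt (by omega), Nat.mod_eq_of_lt (by omega)] at h2
    exact h2
  refine ⟨?_, ?_, ?_, ?_, ?_, ?_, ?_, ?_, ?_, hR.follows_irrefl, hR.follows_uniq⟩
  · intro i j d h1 h2 h3 h4 h5 h6
    rw [hR.follows_side h.isCell_outer h5 h6, add_mod_eq_iff h1 h2 h3 h4 h6]
  · intro i j d h1 h2 h3 h4 h5 h6
    rw [hR.follows_side h.isCell_inner h5 h6, add_mod_eq_iff h1 h2 h3 h4 h6]
  · rintro i j d h1 h2 h3 h4 ⟨r, hr, s, hs, hs'⟩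
    exact hmod' h1 h2 (hR.cell_unique_of_sub h.isCell_outer h.isCell_inner hr hk
      e0 e1 (hmod h3 h4) hs hs')
  · rintro i j d h1 h2 h3 h4 ⟨r, hr, s, hs, hs'⟩
    exact hmod' h3 h4 (hR.cell_unique_of_sub h.isCell_outer h.isCell_inner hr hk
      e0 e1 (hmod h1 h2) hs' hs)
  · intro d β h1 h2
    constructor
    · rintro ⟨r, hr, s, hs, rfl⟩
      rcases h.cell_eq hR hr hs with ⟨h3, h4⟩ | ⟨h3, h4⟩
      · left
        rw [h3, ← side_mod, Nat.ModEq.add_right d h4, side_mod]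
      · right
        rw [h3, ← side_mod, Nat.ModEq.add_right d h4, side_mod]
    · rintro (rfl | rfl)
      · exact ⟨_, h.isCell_outer, k, side_outer_self hk, rfl⟩
      · exact ⟨_, h.isCell_inner, m + 1, side_inner_top, rfl⟩
  · intro d β h1 h2
    have key : ∀ {s l : ℕ}, (s + d) % (m + 2) = l % (m + 2) →
        s % (m + 2) = (l + (m + 2 - d)) % (m + 2) := by
      intro s l h3
      have h4 := Nat.ModEq.add_right (m + 2 - d) h3
      rw [show s + d + (m + 2 - d) = s + (m + 2) by omega, Nat.ModEq, Nat.add_mod_right] at h4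
      exact h4
    constructor
    · rintro ⟨r, hr, s, rfl, hs⟩
      rcases h.cell_eq hR hr hs with ⟨h3, h4⟩ | ⟨h3, h4⟩
      · left
        rw [h3, ← side_mod, key h4, side_mod]
      · right
        rw [h3, ← side_mod, key h4, side_mod]
    · rintro (rfl | rfl)
      · refine ⟨_, h.isCell_outer, _, rfl, ?_⟩
        rw [show k + (m + 2 - d) + d = k + (m + 2) by omega, side_add, side_outer_self hk]
      · refine ⟨_, h.isCell_inner, _, rfl, ?_⟩
        rw [show m + 1 + (m + 2 - d) + d = m + 1 + (m + 2) by omega, side_add, side_inner_top]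
  · intro i j h1 h2 h3 h4
    exact hinj h.isCell_outer k h2 h4
  · intro i j h1 h2 h3 h4
    exact hinj h.isCell_inner (m + 1) h2 h4
  · intro i j h1 h2 h3 h4 h5
    exact hmod' h1 h2 (hR.side_ne_of_sub h.isCell_outer h.isCell_inner hk
      e0 e1 h5)

theorem exists_side_of_outer (hk : k ≤ m) {s : ℕ}
    (hs : side m (outerCell m v k) s ≠ (v k, v (k + m + 1))) :
    ∃ t, side m (outerCell m v k) s = side (2 * m) v t := by
  obtain ⟨j, hj, -, -, h1⟩ := IsAngulation.exists_side_eq (m := m) (outerCell m v k) s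
  rw [h1] at hs ⊢
  rcases lt_trichotomy j k with h2 | rfl | h2
  · obtain ⟨i, hi⟩ : ∃ i, j + (m + 2) = k + i := ⟨j + (m + 2) - k, by omega⟩
    refine ⟨k + m + i, ?_⟩
    rw [← side_add, hi, side_outer hk (by omega) (by omega)]
  · exact absurd (side_outer_self hk) hs
  · obtain ⟨i, rfl⟩ := Nat.exists_eq_add_of_lt h2
    refine ⟨k + m + (i + 1), ?_⟩
    rw [add_assoc k i, side_outer hk (by omega) (by omega)]

theorem exists_side_of_inner (hk : k ≤ m) {s : ℕ}
    (hs : side m (innerCell v k) s ≠ (v k, v (k + m + 1))) :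
    ∃ t, side m (innerCell v k) s = side (2 * m) v t := by
  obtain ⟨j, hj, -, -, h1⟩ := IsAngulation.exists_side_eq (m := m) (innerCell v k) s
  rw [h1] at hs ⊢
  rcases Nat.lt_or_eq_of_le hj with h2 | rfl
  · refine ⟨k + (j + 1) - 1, ?_⟩
    rw [← side_add, show j + (m + 2) = m + 1 + (j + 1) by omega,
      side_inner hk (by omega) (by omega)]
  · exact absurd side_inner_top hs

theorem exists_side_eq_outer_or_inner (hk : k ≤ m) (t : ℕ) : ∃ i, 1 ≤ i ∧ i ≤ m + 1 ∧
    (side (2 * m) v t = side m (outerCell m v k) (k + i) ∨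
      side (2 * m) v t = side m (innerCell v k) (m + 1 + i)) := by
  obtain ⟨j, hj, -, -, h1⟩ := IsAngulation.exists_side_eq (m := 2 * m) v t
  rw [h1]
  rcases lt_or_ge j k with h2 | h2
  · refine ⟨j + m + 2 - k, by omega, by omega, Or.inl ?_⟩
    rw [side_outer hk (by omega) (by omega),
      show k + m + (j + m + 2 - k) = j + (2 * m + 2) by omega, side_add]
  · rcases lt_or_ge (k + m) j with h3 | h3
    · refine ⟨j - k - m, by omega, by omega, Or.inl ?_⟩
      rw [side_outer hk (by omega) (by omega), show k + m + (j - k - m) = j by omega]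
    · refine ⟨j - k + 1, by omega, by omega, Or.inr ?_⟩
      rw [side_inner hk (by omega) (by omega), show k + (j - k + 1) - 1 = j by omega]

/-- A cell with a side other than the diagonal and outside the boundary of the `(2 * m + 2)`-gon is
neither of the two cells at the diagonal, so the flip leaves it intact. -/
theorem follows_flip (h : IsDoubleCell m R v k) (hR : IsAngulation n m R) {k' : ℕ}
    {α β : ℕ × ℕ} {d : ℕ} (hα : α ≠ (v k, v (k + m + 1))) (hβ : β ≠ (v k, v (k + m + 1)))
    (hor : (∀ t, α ≠ side (2 * m) v t) ∨ ∀ t, β ≠ side (2 * m) v t) (hf : Follows m R α d β) :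
    Follows m (EdgeRel.flip m R v k k') α d β := by
  obtain ⟨r, hr, s, rfl, rfl⟩ := hf
  by_cases hc : ∃ i, side m r i = (v k, v (k + m + 1))
  · exfalso
    obtain ⟨i, hi⟩ := hc
    rcases h.cell_eq hR hr hi with ⟨h1, -⟩ | ⟨h1, -⟩
    · simp only [h1] at hα hβ hor
      rcases hor with hor | hor
      · obtain ⟨t, ht⟩ := exists_side_of_outer h.le hα
        exact hor t ht
      · obtain ⟨t, ht⟩ := exists_side_of_outer h.le hβ
        exact hor t ht
    · simp only [h1] at hα hβ hor
      rcases hor with hor | hor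
      · obtain ⟨t, ht⟩ := exists_side_of_inner h.le hα
        exact hor t ht
      · obtain ⟨t, ht⟩ := exists_side_of_inner h.le hβ
        exact hor t ht
  · push Not at hc
    refine ⟨r, ⟨fun i hi => Or.inl ⟨hr.step i hi, fun h1 => hc i ?_⟩,
      Or.inl ⟨hr.top, fun h1 => hc (m + 1) ?_⟩⟩, s, rfl, rfl⟩
    · rw [side_of_le _ hi, h1.1, h1.2]
    · rw [side_top, h1.1, h1.2]

theorem isExchange (h : IsDoubleCell m R v k) (hR : IsAngulation n m R) {k' : ℕ} (hk' : k' ≤ m)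
    {x' y' : ℕ → ℕ × ℕ}
    (hs : IsStar m (Follows m (EdgeRel.flip m R v k k')) (v k', v (k' + m + 1)) x' y')
    (h1 : x' 1 = side m (innerCell v k) (m + 1 + (m + 1)))
    (h2 : y' 1 = side m (outerCell m v k) (k + (m + 1)))
    (h3 : ∀ {i}, 1 ≤ i → i ≤ m → x' (i + 1) = side m (outerCell m v k) (k + i))
    (h4 : ∀ {i}, 1 ≤ i → i ≤ m → y' (i + 1) = side m (innerCell v k) (m + 1 + i)) :
    IsExchange m (Follows m R) (Follows m (EdgeRel.flip m R v k k')) (v k, v (k + m + 1))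
      (v k', v (k' + m + 1)) (fun i => side m (outerCell m v k) (k + i))
      (fun i => side m (innerCell v k) (m + 1 + i)) x' y' where
  one_le := hR.one_le
  star := h.isStar hR
  star' := hs
  x_one := h1
  y_one := h2
  x_succ := h3
  y_succ := h4
  outside := by
    intro α β d a1 a2 a3 a4 a5
    have hS : ∀ {α : ℕ × ℕ}, (∀ i, 1 ≤ i → i ≤ m + 1 → α ≠ side m (outerCell m v k) (k + i) ∧
        α ≠ side m (innerCell v k) (m + 1 + i)) → ∀ t, α ≠ side (2 * m) v t := by
      intro α hα t ht
      obtain ⟨i, hi, hi', h5⟩ := exists_side_eq_outer_or_inner (v := v) h.le t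
      rcases h5 with h5 | h5
      · exact (hα i hi hi').1 (ht.trans h5)
      · exact (hα i hi hi').2 (ht.trans h5)
    have a6 : (∀ t, α ≠ side (2 * m) v t) ∨ ∀ t, β ≠ side (2 * m) v t := a5.imp hS hS
    refine ⟨h.follows_flip hR a1 a2 a6, fun h6 => ?_⟩
    -- For the converse, flip back.
    have h7 := (h.flip hR hk').follows_flip (k' := k) (h.isAngulation_flip hR hk') a3 a4 a6 h6
    rwa [h.flip_flip hR hk', h.flip_self] at h7

/-- The next diagonal, counterclockwise, of a double cell. -/
def prev (m k : ℕ) : ℕ := if k = 0 then m else k - 1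

theorem prev_le (hk : k ≤ m) : prev m k ≤ m := by
  unfold prev
  split_ifs <;> omega

theorem prev_ne (hm : 1 ≤ m) : prev m k ≠ k := by
  unfold prev
  split_ifs <;> omega

theorem exists_isExchange (h : IsDoubleCell m R v k) (hR : IsAngulation n m R) :
    ∃ x y x' y', IsExchange m (Follows m R) (Follows m (EdgeRel.flip m R v k (prev m k)))
      (v k, v (k + m + 1)) (v (prev m k), v (prev m k + m + 1)) x y x' y' := by
  have hk := h.le
  have hk' := prev_le hk
  have hs := (h.flip hR hk').isStar (h.isAngulation_flip hR hk')
  by_cases h0 : k = 0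
  · subst h0
    have e : prev m 0 = m := rfl
    rw [e] at hs ⊢
    -- At `k = 0` the endpoint `v 0` moves on to `v (2 * m + 1)`. The old outer cell, up to the
    -- exchanged side, becomes the new inner one, so the two halves of the star are interchanged.
    refine ⟨_, _, _, _, h.isExchange hR le_rfl hs.swap ?_ ?_ ?_ ?_⟩
    · rw [side_inner le_rfl le_rfl (by omega), side_inner hk (by omega) le_rfl]
      congr 1
      omega
    · rw [side_outer le_rfl le_rfl (by omega), side_outer hk (by omega) le_rfl]
      congr 1
      omega
    · intro i hi hi'
      rw [side_inner le_rfl (by omega) (by omega), side_outer hk hi (by omega)]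
      congr 1
      omega
    · intro i hi hi'
      rw [side_outer le_rfl (by omega) (by omega), side_inner hk hi (by omega), ← side_add _ _ (_ - 1)]
      congr 1
      omega
  · have e : prev m k = k - 1 := if_neg h0
    rw [e] at hs hk' ⊢
    refine ⟨_, _, _, _, h.isExchange hR hk' hs ?_ ?_ ?_ ?_⟩
    · rw [side_outer hk' le_rfl (by omega), side_inner hk (by omega) le_rfl]
      congr 1
      omega
    · rw [side_inner hk' le_rfl (by omega), side_outer hk (by omega) le_rfl, ← side_add _ _ (_ - 1)]
      congr 1
      omega
    · intro i hi hi'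
      rw [side_outer hk' (by omega) (by omega), side_outer hk hi (by omega)]
      congr 1
      omega
    · intro i hi hi'
      rw [side_inner hk' (by omega) (by omega), side_inner hk hi (by omega)]
      congr 1
      omega

theorem isDiag_of_le (h : IsDoubleCell m R v k) (hR : IsAngulation n m R) {k' : ℕ}
    (hk' : k' ≤ m) : (v k', v (k' + m + 1)).1 + 1 < (v k', v (k' + m + 1)).2 ∧
      ¬ ((v k', v (k' + m + 1)).1 = 0 ∧ (v k', v (k' + m + 1)).2 = n * m + 1) := by
  have hm := hR.one_le
  simp only
  constructor
  · have h1 := h.lt hR (show k' < k' + 1 by omega) (by omega)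
    have h2 := h.lt hR (show k' + 1 < k' + m + 1 by omega) (by omega)
    omega
  · rintro ⟨h1, h2⟩
    have h3 := hR.le h.top
    have h4 := h.le_of_le hR (show k' + m + 1 ≤ 2 * m + 1 by omega) le_rfl
    have h5 := h.inj hR (show k' + m + 1 ≤ 2 * m + 1 by omega) le_rfl (by omega)
    have h6 := h.le_of_le hR (Nat.zero_le k') (by omega)
    have h7 := h.inj hR (show k' ≤ 2 * m + 1 by omega) (Nat.zero_le _) (by omega)
    omega

theorem isDiag (h : IsDoubleCell m R v k) (hR : IsAngulation n m R) :
    IsDiag n m R (v k, v (k + m + 1)) :=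
  ⟨h.diag, h.isDiag_of_le hR h.le⟩

/-- The mutation of the quiver of `R` at a diagonal rotates this diagonal. -/
theorem iso_mutate (h : IsDoubleCell m R v k) (hR : IsAngulation n m R) :
    ColouredQuiver.Iso (ColouredQuiver.mutate (quiver n m R) ⟨(v k, v (k + m + 1)), h.isDiag hR⟩)
      (quiver n m (EdgeRel.flip m R v k (prev m k))) := by
  obtain ⟨x, y, x', y', hx⟩ := h.exists_isExchange hR
  have hk := h.le
  have hm := hR.one_le
  have hk' := prev_le hk
  refine hx.iso_mutate (h.isDiag hR) (fun hc => h.not_rel hR hk' (prev_ne hm) hc.1) ?_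
  rintro ⟨a, b⟩
  simp only [IsDiag, EdgeRel.flip, Prod.mk.injEq, ne_eq]
  constructor
  · tauto
  · rintro (h1 | ⟨rfl, rfl⟩)
    · tauto
    · exact ⟨Or.inr ⟨rfl, rfl⟩, h.isDiag_of_le hR hk'⟩

end IsDoubleCell

end EdgeRel

/-! ### Rotation of the polygon. -/

namespace EdgeRel

/-- The rotation of `R` by one step; `L` is the largest vertex. -/
def rotate (L : ℕ) (R : ℕ → ℕ → Prop) (a b : ℕ) : Prop :=
  R (a + 1) (b + 1) ∨ (b = L ∧ R 0 (a + 1))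

/-- The rotation of an edge by one step. -/
def shift (L : ℕ) (x : ℕ × ℕ) : ℕ × ℕ := if x.1 = 0 then (x.2 - 1, L) else (x.1 - 1, x.2 - 1)

/-- The rotation of a cell by one step. -/
def rotateCell (m L : ℕ) (p : ℕ → ℕ) (i : ℕ) : ℕ :=
  if p 0 = 0 then (if i ≤ m then p (i + 1) - 1 else L) else p i - 1

namespace IsAngulation

variable {n m : ℕ} {R : ℕ → ℕ → Prop}

theorem rotate_shift (hR : IsAngulation n m R) {x : ℕ × ℕ} (h : R x.1 x.2) :
    rotate (n * m + 1) R (shift (n * m + 1) x).1 (shift (n * m + 1) x).2 := by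
  have h1 := hR.lt h
  unfold shift rotate
  split_ifs with h0
  · refine Or.inr ⟨rfl, ?_⟩
    rw [h0] at h
    simpa [show x.2 - 1 + 1 = x.2 by omega] using h
  · left
    simpa [show x.2 - 1 + 1 = x.2 by omega, show x.1 - 1 + 1 = x.1 by omega] using h

theorem shift_inj (hR : IsAngulation n m R) {x y : ℕ × ℕ} (hx : R x.1 x.2) (hy : R y.1 y.2)
    (h : shift (n * m + 1) x = shift (n * m + 1) y) : x = y := by
  have h1 := hR.lt hx
  have h2 := hR.lt hy
  have h3 := hR.le hx
  have h4 := hR.le hy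
  unfold shift at h
  split_ifs at h <;> rw [Prod.mk.injEq] at h <;> ext <;> omega

theorem exists_shift_eq {x : ℕ × ℕ}
    (h : rotate (n * m + 1) R x.1 x.2) : ∃ y, R y.1 y.2 ∧ shift (n * m + 1) y = x := by
  rcases h with h | ⟨h1, h2⟩
  · exact ⟨(x.1 + 1, x.2 + 1), h, by simp [shift]⟩
  · refine ⟨(0, x.1 + 1), h2, ?_⟩
    simp only [shift, if_true, Nat.add_sub_cancel]
    rw [← h1]

theorem rotateCell_of_eq (L : ℕ) {p : ℕ → ℕ} (h0 : p 0 = 0) (i : ℕ) (hi : i ≤ m) :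
    rotateCell m L p i = p (i + 1) - 1 := by
  rw [rotateCell, if_pos h0, if_pos hi]

theorem rotateCell_top (L : ℕ) {p : ℕ → ℕ} (h0 : p 0 = 0) :
    rotateCell m L p (m + 1) = L := by
  rw [rotateCell, if_pos h0, if_neg (by omega)]

theorem rotateCell_of_ne (L : ℕ) {p : ℕ → ℕ} (h0 : p 0 ≠ 0) (i : ℕ) :
    rotateCell m L p i = p i - 1 := by
  rw [rotateCell, if_neg h0]

/-- When vertex `0` belongs to the cell it becomes the largest vertex, and the increasing listing of
the cell starts one place later. -/
theorem side_rotateCell (hR : IsAngulation n m R) {p : ℕ → ℕ} (hp : IsCell m R p) (i : ℕ) :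
    side m (rotateCell m (n * m + 1) p) i =
      shift (n * m + 1) (side m p (i + if p 0 = 0 then 1 else 0)) := by
  obtain ⟨j, hj, hij, hjj, h⟩ := exists_side_eq (m := m) (rotateCell m (n * m + 1) p) i
  have h' : ∀ l, side m p (i + l) = side m p (j + l) := by
    intro l
    have h1 : (i + l) % (m + 2) = (j + l) % (m + 2) := Nat.ModEq.add_right l (hij.trans hjj.symm)
    rw [← side_mod, h1, side_mod]
  rw [h, h']
  split_ifs with h0
  · rcases lt_trichotomy j m with h1 | rfl | h1
    · have := hR.cell_lt hp (show 0 < j + 1 by omega) (by omega)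
      rw [side_of_le _ (by omega), side_of_le _ (by omega), rotateCell_of_eq _ h0 _ (by omega),
        rotateCell_of_eq _ h0 _ (by omega), shift, if_neg (by simp; omega)]
    · rw [side_of_le _ le_rfl, side_top, rotateCell_of_eq _ h0 _ le_rfl, rotateCell_top _ h0,
        shift, if_pos h0]
    · obtain rfl : j = m + 1 := by omega
      rw [side_top, show m + 1 + 1 = 0 + (m + 2) by omega, side_add, side_of_le _ (by omega),
        rotateCell_of_eq _ h0 _ (by omega), rotateCell_top _ h0, shift, if_pos h0]
  · have hc := fun i (hi : i ≤ m + 1) => hR.cell_le hp (Nat.zero_le i) hi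
    rcases Nat.lt_or_eq_of_le hj with h1 | rfl
    · have := hc j hj
      rw [side_of_le _ (by omega), add_zero, side_of_le _ (by omega), rotateCell_of_ne _ h0,
        rotateCell_of_ne _ h0, shift, if_neg (by simp; omega)]
    · rw [side_top, add_zero, side_top, rotateCell_of_ne _ h0,
        rotateCell_of_ne _ h0, shift, if_neg h0]

theorem isCell_rotateCell (hR : IsAngulation n m R) {p : ℕ → ℕ} (hp : IsCell m R p) :
    IsCell m (rotate (n * m + 1) R) (rotateCell m (n * m + 1) p) := by
  have key : ∀ i, rotate (n * m + 1) R (side m (rotateCell m (n * m + 1) p) i).1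
      (side m (rotateCell m (n * m + 1) p) i).2 := by
    intro i
    rw [hR.side_rotateCell hp]
    exact hR.rotate_shift (side_rel hp _)
  refine ⟨fun i hi => ?_, ?_⟩
  · have := key i
    rwa [side_of_le _ hi] at this
  · have := key (m + 1)
    rwa [side_top] at this

theorem isAngulation_rotate (hR : IsAngulation n m R) :
    IsAngulation n m (rotate (n * m + 1) R) := by
  refine ⟨hR.one_le, ?_, ?_, ?_, ?_, ?_, ?_, ?_⟩
  · rintro a b (h | ⟨rfl, h⟩)
    · have := hR.lt h
      omega
    · have := hR.le h
      omega
  · rintro a b (h | ⟨rfl, h⟩)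
    · have := hR.le h
      omega
    · rfl
  · rintro a b (h | ⟨rfl, h⟩)
    · have := hR.dvd h
      push_cast at this
      rwa [show ((b : ℤ) + 1) - (a + 1) - 1 = b - a - 1 by ring] at this
    · have h1 := hR.dvd h
      push_cast at h1 ⊢
      have h2 : (m : ℤ) ∣ n * m := Dvd.intro_left _ rfl
      have h3 := dvd_sub h2 h1
      rwa [show (n : ℤ) * m - (a + 1 - 0 - 1) = n * m + 1 - a - 1 by ring] at h3
  · intro a ha
    by_cases h : a + 1 < n * m + 1
    · exact Or.inl (hR.border h)
    · obtain rfl : a = n * m := by omega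
      exact Or.inr ⟨rfl, hR.root⟩
  · exact Or.inr ⟨rfl, hR.border (by omega)⟩
  · rintro a b c d (h1 | ⟨rfl, h1⟩) (h2 | ⟨rfl, h2⟩) h3 h4 h5
    · exact hR.noncross h1 h2 (by omega) (by omega) (by omega)
    · exact hR.noncross h2 h1 (by omega) (by omega) (by omega)
    · have := hR.le h2
      omega
    · omega
  · rintro a b (h | ⟨rfl, h⟩) hab
    · obtain ⟨p, hp, h1, h2⟩ := hR.cell h (by omega)
      have h0 : p 0 ≠ 0 := by omega
      exact ⟨_, hR.isCell_rotateCell hp, by rw [rotateCell_of_ne _ h0]; omega,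
        by rw [rotateCell_of_ne _ h0]; omega⟩
    -- For an edge starting at `0` the rotation exchanges above and below, so the required cell is
    -- the rotated parent.
    · obtain ⟨p, hp, k, hk, h1, h2⟩ := hR.exists_parent h (by omega)
      obtain rfl : k = 0 := by
        by_contra h3
        have := hR.cell_lt hp (show 0 < k by omega) (by omega)
        omega
      exact ⟨_, hR.isCell_rotateCell hp, by rw [rotateCell_of_eq _ h1 _ (by omega)]; omega,
        rotateCell_top _ h1⟩

theorem exists_rotateCell_eq (hR : IsAngulation n m R) {q : ℕ → ℕ}
    (hq : IsCell m (rotate (n * m + 1) R) q) :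
    ∃ p, IsCell m R p ∧ ∀ i ≤ m + 1, rotateCell m (n * m + 1) p i = q i := by
  have hr := hR.isAngulation_rotate
  have h1 : ∀ {a b}, rotate (n * m + 1) R a b → b ≠ n * m + 1 → R (a + 1) (b + 1) :=
    fun h h' => h.resolve_right fun h2 => h' h2.1
  have h2 : ∀ {a}, rotate (n * m + 1) R a (n * m + 1) → R 0 (a + 1) := by
    rintro a (h | h)
    · have := hR.le h
      omega
    · exact h.2
  by_cases h : q (m + 1) = n * m + 1
  · have hlt : ∀ i ≤ m, q i ≠ n * m + 1 := fun i hi => by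
      have := hr.cell_lt hq (show i < m + 1 by omega) le_rfl
      omega
    refine ⟨fun i => if i = 0 then 0 else q (i - 1) + 1, ⟨fun i hi => ?_, ?_⟩, fun i hi => ?_⟩
    · rcases i with _ | i
      · simp only [if_true, zero_add, one_ne_zero, if_false, Nat.sub_self]
        exact h2 (h ▸ hq.top)
      · simp only [Nat.add_eq_zero_iff, one_ne_zero, and_false, if_false, Nat.add_sub_cancel]
        exact h1 (hq.step i (by omega)) (hlt _ hi)
    · simp only [if_true, Nat.add_eq_zero_iff, one_ne_zero, and_false, if_false,
        Nat.add_sub_cancel]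
      exact h2 (h ▸ hq.step m le_rfl)
    · rcases Nat.lt_or_eq_of_le hi with hi | rfl
      · rw [rotateCell_of_eq _ (by simp) _ (by omega)]
        simp
      · rw [rotateCell_top _ (by simp), h]
  · have hlt : ∀ i ≤ m + 1, q i ≠ n * m + 1 := fun i hi => by
      have := hr.cell_le hq hi le_rfl
      have := hr.le hq.top
      omega
    refine ⟨fun i => q i + 1, ⟨fun i hi => h1 (hq.step i hi) (hlt _ (by omega)),
      h1 hq.top h⟩, fun i hi => ?_⟩
    rw [rotateCell_of_ne _ (by simp)]
    simp

theorem follows_rotate (hR : IsAngulation n m R) {α β : ℕ × ℕ} {d : ℕ} (hα : R α.1 α.2)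
    (hβ : R β.1 β.2) : Follows m (rotate (n * m + 1) R) (shift (n * m + 1) α) d
      (shift (n * m + 1) β) ↔ Follows m R α d β := by
  constructor
  · rintro ⟨q, hq, i, hi, hid⟩
    obtain ⟨p, hp, hpq⟩ := hR.exists_rotateCell_eq hq
    rw [← side_congr hpq, hR.side_rotateCell hp] at hi hid
    refine ⟨p, hp, _, hR.shift_inj (side_rel hp _) hα hi, ?_⟩
    rw [add_right_comm]
    exact hR.shift_inj (side_rel hp _) hβ hid
  · rintro ⟨p, hp, i, rfl, rfl⟩
    -- The offset `m + 1` is inverse, modulo `m + 2`, to the shift by one in `side_rotateCell`.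
    refine ⟨_, hR.isCell_rotateCell hp, i + if p 0 = 0 then m + 1 else 0, ?_, ?_⟩
    · rw [hR.side_rotateCell hp]
      split_ifs
      · rw [show i + (m + 1) + 1 = i + (m + 2) by omega, side_add]
      · rfl
    · rw [hR.side_rotateCell hp]
      split_ifs
      · rw [show i + (m + 1) + d + 1 = i + d + (m + 2) by omega, side_add]
      · rfl

theorem isDiag_shift (hR : IsAngulation n m R) {x : ℕ × ℕ} (hx : R x.1 x.2) :
    IsDiag n m (rotate (n * m + 1) R) (shift (n * m + 1) x) ↔ IsDiag n m R x := by
  have h1 := hR.lt hx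
  have h2 := hR.le hx
  simp only [IsDiag, hx, hR.rotate_shift hx, true_and]
  unfold shift
  split_ifs <;> simp only [and_true] <;> omega

/-- Rotation by `i` steps is an isomorphism of coloured quivers. -/
theorem exists_rotate_iso (hR : IsAngulation n m R) (i : ℕ) :
    IsAngulation n m ((rotate (n * m + 1))^[i] R) ∧
    ∃ e : (quiver n m R).V ≃ (quiver n m ((rotate (n * m + 1))^[i] R)).V,
      (∀ α β c, (quiver n m ((rotate (n * m + 1))^[i] R)).arrows (e α) (e β) c =
        (quiver n m R).arrows α β c) ∧ ∀ α, (e α).1 = (shift (n * m + 1))^[i] α.1 := by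
  induction i with
  | zero => exact ⟨hR, Equiv.refl _, fun _ _ _ => rfl, fun _ => rfl⟩
  | succ i ih =>
    obtain ⟨h1, e, h2, h3⟩ := ih
    have h4 : ∀ S : ℕ → ℕ → Prop, IsAngulation n m S →
        ∃ f : (quiver n m S).V ≃ (quiver n m (rotate (n * m + 1) S)).V,
          (∀ α β c, (quiver n m (rotate (n * m + 1) S)).arrows (f α) (f β) c =
            (quiver n m S).arrows α β c) ∧ ∀ α, (f α).1 = shift (n * m + 1) α.1 := by
      intro S hS
      let g : (quiver n m S).V → (quiver n m (rotate (n * m + 1) S)).V :=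
        fun α => ⟨shift (n * m + 1) α.1, (hS.isDiag_shift α.2.1).2 α.2⟩
      refine ⟨Equiv.ofBijective g ⟨fun α β h => ?_, fun β => ?_⟩, fun α β c => ?_, fun _ => rfl⟩
      · exact Subtype.ext (hS.shift_inj α.2.1 β.2.1 (congrArg Subtype.val h))
      · obtain ⟨y, hy, hyx⟩ := exists_shift_eq β.2.1
        exact ⟨⟨y, (hS.isDiag_shift hy).1 (hyx ▸ β.2)⟩, Subtype.ext hyx⟩
      · exact ite_eq_ite (hS.follows_rotate α.2.1 β.2.1)
    rw [Function.iterate_succ_apply']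
    obtain ⟨f, h5, h6⟩ := h4 _ h1
    refine ⟨h1.isAngulation_rotate, e.trans f, fun α β c => ?_, fun α => ?_⟩
    · exact (h5 _ _ _).trans (h2 _ _ _)
    · rw [Function.iterate_succ_apply', ← h3]
      exact h6 _

end IsAngulation

end EdgeRel

/-! ### Maximal non-crossing families and existence of cells. -/

namespace EdgeRel

/-- A cell below an edge, for a family of non-crossing edges that is maximal. -/
theorem exists_cell_of_maximal {m L : ℕ} {R : ℕ → ℕ → Prop} (hm : 1 ≤ m)
    (hlt : ∀ {a b}, R a b → a < b) (hle : ∀ {a b}, R a b → b ≤ L)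
    (hdvd : ∀ {a b}, R a b → (m : ℤ) ∣ (b : ℤ) - a - 1)
    (hborder : ∀ {a}, a < L → R a (a + 1))
    (hnc : ∀ {a b c d}, R a b → R c d → a < c → c < b → b < d → False)
    (hmax : ∀ {a b : ℕ}, a + 1 < b → b ≤ L → (m : ℤ) ∣ (b : ℤ) - a - 1 →
      (∀ x y, R x y → ¬ (x < a ∧ a < y ∧ y < b) ∧ ¬ (a < x ∧ x < b ∧ b < y)) → R a b)
    {a b : ℕ} (hab : R a b) (h2 : a + 1 < b) : ∃ p, IsCell m R p ∧ p 0 = a ∧ p (m + 1) = b := by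
  have hbL := hle hab
  have hnext : ∀ x, ∃ y, a ≤ x → x < b → (x < y ∧ y ≤ b ∧ R x y ∧ ¬ (x = a ∧ y = b) ∧
      ∀ z ≤ b, R x z → ¬ (x = a ∧ z = b) → z ≤ y) := by
    intro x
    -- The cell is built greedily from `a`: always follow the longest edge that ends at or before
    -- `b` and is not `a, b` itself.
    refine ⟨Nat.findGreatest (fun y => R x y ∧ ¬ (x = a ∧ y = b)) b, fun hx hxb => ?_⟩
    have h3 := Nat.findGreatest_spec (P := fun y => R x y ∧ ¬ (x = a ∧ y = b))
      (Nat.succ_le_of_lt hxb) ⟨hborder (by omega), by omega⟩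
    exact ⟨hlt h3.1, Nat.findGreatest_le b, h3.1, h3.2,
      fun z hz h4 h5 => Nat.le_findGreatest hz ⟨h4, h5⟩⟩
  choose next hnext using hnext
  let p : ℕ → ℕ := fun i => next^[i] a
  have p0 : p 0 = a := rfl
  have ps : ∀ i, p (i + 1) = next (p i) := fun i => Function.iterate_succ_apply' _ _ _
  have key : ∀ i ≤ m, a ≤ p i ∧ p i < b ∧ (m : ℤ) ∣ (p i : ℤ) - a - i := by
    intro i
    induction i with
    | zero => exact fun _ => ⟨le_rfl, by omega, by simp [p0]⟩
    | succ i ih =>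
      intro hi
      obtain ⟨h3, h4, h5⟩ := ih (by omega)
      obtain ⟨h6, h7, h8, h9, -⟩ := hnext _ h3 h4
      rw [← ps] at h6 h7 h8 h9
      have h10 : (m : ℤ) ∣ (p (i + 1) : ℤ) - a - (i + 1 : ℕ) := by
        have := dvd_add h5 (hdvd h8)
        rwa [show (p i : ℤ) - a - i + (p (i + 1) - p i - 1) = p (i + 1) - a - (i + 1 : ℕ) by
          push_cast; ring] at this
      refine ⟨by omega, lt_of_le_of_ne h7 fun h11 => ?_, h10⟩
      -- Arriving at `b` after `i + 1 ≤ m` steps would give `m ∣ i`, hence `i = 0`, and the only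
      -- step would be the excluded edge `a, b`.
      have h12 := dvd_sub (hdvd hab) h10
      rw [h11, show (b : ℤ) - a - 1 - (b - a - (i + 1 : ℕ)) = i by push_cast; ring] at h12
      obtain rfl : i = 0 := by
        by_contra h13
        have := Int.le_of_dvd (by omega) h12
        omega
      exact h9 ⟨p0, h11⟩
  have hstep : ∀ i ≤ m, p i < p (i + 1) ∧ R (p i) (p (i + 1)) ∧
      ∀ z ≤ b, R (p i) z → ¬ (p i = a ∧ z = b) → z ≤ p (i + 1) := by
    intro i hi
    obtain ⟨h3, h4, -⟩ := key i hi
    obtain ⟨h6, -, h8, -, h9⟩ := hnext _ h3 h4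
    rw [ps]
    exact ⟨h6, h8, h9⟩
  have hmono : ∀ i j, i ≤ j → j ≤ m + 1 → p i ≤ p j := by
    intro i j hij
    induction j, hij using Nat.le_induction with
    | base => exact fun _ => le_rfl
    | succ j hij ih =>
      intro hj
      exact (ih (by omega)).trans (hstep j (by omega)).1.le
  have hlast : p (m + 1) = b := by
    by_contra hne
    obtain ⟨h3, h4, h5⟩ := key m le_rfl
    obtain ⟨h6, h7, h8, -, -⟩ := hnext _ h3 h4
    rw [← ps] at h6 h7 h8
    have h10 : (m : ℤ) ∣ (p (m + 1) : ℤ) - a - 1 := by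
      have := dvd_add (dvd_add h5 (hdvd h8)) (dvd_refl (m : ℤ))
      rwa [show (p m : ℤ) - a - m + (p (m + 1) - p m - 1) + m = p (m + 1) - a - 1 by
        ring] at this
    have hp01 := (hstep 0 (by omega)).1
    have hp1 : p 1 < p (m + 1) := lt_of_le_of_lt (hmono 1 m hm (by omega)) h6
    -- If the path stops short of `b`, this chord has an admissible length and crosses no edge,
    -- since each step was as long as possible. By maximality it is an edge, longer than the first
    -- step: a contradiction.
    have hR : R a (p (m + 1)) := by
      refine hmax (by simp only [zero_add] at hp01; omega) (by omega) h10 fun x y hxy => ⟨?_, ?_⟩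
      · rintro ⟨h11, h12, h13⟩
        exact hnc hxy hab h11 h12 (by omega)
      · rintro ⟨h11, h12, h13⟩
        have hyb : y ≤ b := by
          by_contra hyb
          exact hnc hab hxy h11 (by omega) (by omega)
        obtain ⟨i, hi, h14, h15⟩ := exists_step (m + 1) (p0.trans_le h11.le) h12
        have h16 := hmono (i + 1) (m + 1) (by omega) le_rfl
        by_cases h17 : p i = x
        · subst h17
          have := (hstep i (by omega)).2.2 y hyb hxy (by omega)
          omega
        · exact hnc (hstep i (by omega)).2.1 hxy (by omega) h15 (by omega)
    have := (hstep 0 (by omega)).2.2 (p (m + 1)) h7 hR (fun h => hne h.2)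
    simp only [zero_add] at this
    omega
  exact ⟨p, ⟨fun i hi => (hstep i hi).2.1, by rw [p0, hlast]; exact hab⟩, p0, hlast⟩

/-- The edges of an angulation form a maximal family of non-crossing edges. -/
theorem IsAngulation.rel_of_noncross {n m : ℕ} {R : ℕ → ℕ → Prop} (hR : IsAngulation n m R)
    {a b : ℕ} (hab : a < b) (hb : b ≤ n * m + 1) (hd : (m : ℤ) ∣ (b : ℤ) - a - 1)
    (hnc : ∀ x y, R x y → ¬ (x < a ∧ a < y ∧ y < b) ∧ ¬ (a < x ∧ x < b ∧ b < y)) : R a b := by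
  have hm := hR.one_le
  -- In the cell below a shortest edge above `a, b`, non-crossing makes `a` and `b` vertices of the
  -- cell, and divisibility makes the chord a side.
  have hex : ∃ l x y, R x y ∧ x ≤ a ∧ b ≤ y ∧ y - x = l :=
    ⟨_, 0, n * m + 1, hR.root, by omega, by omega, rfl⟩
  obtain ⟨x, y, hxy, hx, hy, hl⟩ := Nat.find_spec hex
  have hmin := fun l => Nat.find_min (m := l) hex
  by_cases hc : x = a ∧ y = b
  · rwa [hc.1, hc.2] at hxy
  obtain ⟨p, hp, rfl, rfl⟩ := hR.cell hxy (by omega)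
  have hsmall : ∀ i ≤ m, p i ≤ a → b ≤ p (i + 1) → False := by
    intro i hi h1 h2
    refine hmin (p (i + 1) - p i) ?_ ⟨_, _, hp.step i hi, h1, h2, rfl⟩
    have a1 := hR.cell_le hp (show 0 ≤ i by omega) (by omega)
    have a2 := hR.cell_le hp (show i + 1 ≤ m + 1 by omega) (by omega)
    have : 0 < i ∨ i + 1 < m + 1 := by omega
    rcases this with h3 | h3
    · have := hR.cell_lt hp h3 (by omega)
      omega
    · have := hR.cell_lt hp h3 (by omega)
      omega
  obtain ⟨i, hi, hi1, hi2⟩ := exists_step (p := p) (x := a) (m + 1) hx (by omega)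
  obtain ⟨l, hl', hl1, hl2⟩ := exists_step (p := p) (x := b - 1) (m + 1) (by omega) (by omega)
  have h1 : a = p i := by
    by_contra hne
    by_cases h2 : b ≤ p (i + 1)
    · exact hsmall i (by omega) hi1 h2
    · exact (hnc _ _ (hp.step i (by omega))).1 ⟨by omega, hi2, by omega⟩
  have h2 : b = p (l + 1) := by
    by_contra hne
    by_cases h2 : p l ≤ a
    · exact hsmall l (by omega) h2 (by omega)
    · exact (hnc _ _ (hp.step l (by omega))).2 ⟨by omega, by omega, by omega⟩
  subst h1 h2
  rcases hR.cell_chord_of_dvd hp ((hR.cell_lt_iff hp (by omega) (by omega)).1 hab) (by omega) hd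
    with h3 | ⟨h3, h4⟩
  · rw [h3]
    exact hp.step i (by omega)
  · rw [h3, h4]
    exact hp.top

end EdgeRel

/-! ### Translation between sets of segments and edge relations. -/

namespace Polygon

variable {n m : ℕ}

/-- The segment between two vertices given by natural numbers. -/
def toSegment (n m : ℕ) (x : ℕ × ℕ) : Segment n m :=
  s(Fin.ofNat (n * m + 2) x.1, Fin.ofNat (n * m + 2) x.2)

/-- The edges of `D`: the border edges and the elements of `D`. -/
def edges (D : Set (Segment n m)) (a b : ℕ) : Prop :=
  a < b ∧ b ≤ n * m + 1 ∧ (IsBorderEdge (toSegment n m (a, b)) ∨ toSegment n m (a, b) ∈ D)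

/-- The set of segments that are given by the diagonals of `R`. -/
def diagonals (n m : ℕ) (R : ℕ → ℕ → Prop) : Set (Segment n m) :=
  {e | ∃ x, EdgeRel.IsDiag n m R x ∧ x.2 ≤ n * m + 1 ∧ e = toSegment n m x}

theorem val_ofNat {a : ℕ} (h : a ≤ n * m + 1) : (Fin.ofNat (n * m + 2) a).val = a :=
  Nat.mod_eq_of_lt (by omega)

theorem ofNat_val (x : Vertex n m) : Fin.ofNat (n * m + 2) x.val = x :=
  Fin.ext (val_ofNat (by omega))

theorem ofNat_succ (a : ℕ) :
    Fin.ofNat (n * m + 2) (a + 1) = Fin.ofNat (n * m + 2) a + 1 := by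
  apply Fin.ext
  simp [Fin.val_add, Fin.ofNat]

theorem ofNat_last : Fin.ofNat (n * m + 2) (n * m + 1) + 1 = 0 := by
  rw [← ofNat_succ]
  apply Fin.ext
  simp [Fin.ofNat]

theorem toSegment_eq_iff {a b : ℕ} (hab : a < b) (hb : b ≤ n * m + 1) {x y : Vertex n m}
    (hxy : x < y) : toSegment n m (a, b) = s(x, y) ↔ x.val = a ∧ y.val = b := by
  have ha := val_ofNat (n := n) (m := m) (show a ≤ n * m + 1 by omega)
  have hb' := val_ofNat hb
  rw [toSegment, Sym2.eq_iff]
  dsimp only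
  constructor
  · rintro (⟨rfl, rfl⟩ | ⟨rfl, rfl⟩)
    · exact ⟨ha, hb'⟩
    · rw [Fin.lt_def] at hxy
      omega
  · rintro ⟨h1, h2⟩
    exact Or.inl ⟨Fin.ext (by omega), Fin.ext (by omega)⟩

theorem toSegment_inj {a b c d : ℕ} (hab : a < b) (hb : b ≤ n * m + 1) (hcd : c < d)
    (hd : d ≤ n * m + 1) (h : toSegment n m (a, b) = toSegment n m (c, d)) : a = c ∧ b = d := by
  have hc' := val_ofNat (n := n) (m := m) (show c ≤ n * m + 1 by omega)
  have hd' := val_ofNat hd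
  have h1 := (toSegment_eq_iff hab hb (x := Fin.ofNat _ c) (y := Fin.ofNat _ d)
    (by rw [Fin.lt_def]; omega)).1 h
  omega

theorem toSegment_val (x y : Vertex n m) : toSegment n m (x.val, y.val) = s(x, y) := by
  rw [toSegment, ofNat_val, ofNat_val]

theorem exists_toSegment_eq (e : Segment n m) (h : ∀ x, e ≠ s(x, x)) :
    ∃ a b, a < b ∧ b ≤ n * m + 1 ∧ e = toSegment n m (a, b) := by
  induction e using Sym2.ind with
  | _ x y =>
    rcases lt_trichotomy x y with h1 | rfl | h1
    · exact ⟨x.val, y.val, h1, by omega, (toSegment_val _ _).symm⟩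
    · exact absurd rfl (h x)
    · exact ⟨y.val, x.val, h1, by omega, by rw [toSegment_val, Sym2.eq_swap]⟩

theorem isBorderEdge_iff {a b : ℕ} (hab : a < b) (hb : b ≤ n * m + 1) :
    IsBorderEdge (toSegment n m (a, b)) ↔ b = a + 1 ∨ (a = 0 ∧ b = n * m + 1) := by
  constructor
  · rintro ⟨i, hi⟩
    rcases Nat.lt_or_ge i.val (n * m + 1) with h1 | h1
    · have h2 : (i + 1).val = i.val + 1 := by
        rw [Fin.val_add_one_of_lt']
        simpa using h1
      have := (toSegment_eq_iff hab hb (by rw [Fin.lt_def]; omega)).1 hi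
      omega
    · have hi' : i.val = n * m + 1 := by omega
      have h2 : i + 1 = 0 := by
        rw [← ofNat_val i, hi', ofNat_last]
      rw [h2, Sym2.eq_swap] at hi
      have := (toSegment_eq_iff hab hb (by rw [Fin.lt_def, hi']; simp)).1 hi
      simp at this
      omega
  · rintro (rfl | ⟨rfl, rfl⟩)
    · exact ⟨Fin.ofNat _ a, by rw [toSegment, ofNat_succ]⟩
    · refine ⟨Fin.ofNat _ (n * m + 1), ?_⟩
      rw [ofNat_last, toSegment, Sym2.eq_swap]
      rfl

theorem isMDiagonal_iff {a b : ℕ} (hab : a < b) (hb : b ≤ n * m + 1) :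
    IsMDiagonal (toSegment n m (a, b)) ↔
      a + 1 < b ∧ ¬ (a = 0 ∧ b = n * m + 1) ∧ (m : ℤ) ∣ (b : ℤ) - a - 1 := by
  have key : ∀ {a b : ℕ}, a < b → b ≤ n * m + 1 →
      ((m : ℤ) ∣ (b : ℤ) - a - 1 ↔ (b - a) + 1 ≡ 2 [MOD m]) ∧
      ((m : ℤ) ∣ (b : ℤ) - a - 1 ↔ (n * m + 2 - (b - a)) + 1 ≡ 2 [MOD m]) := by
    intro a b hab hb
    constructor
    · rw [Nat.ModEq.comm, Nat.modEq_iff_dvd]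
      push_cast [Nat.cast_sub hab.le]
      rw [show (b : ℤ) - a + 1 - 2 = b - a - 1 by ring]
    · rw [Nat.modEq_iff_dvd]
      push_cast [Nat.cast_sub (show b - a ≤ n * m + 2 by omega), Nat.cast_sub hab.le]
      have h2 : (m : ℤ) ∣ n * m := Dvd.intro_left _ rfl
      rw [show (2 : ℤ) - (n * m + 2 - (b - a) + 1) = b - a - 1 - n * m by ring]
      exact (dvd_sub_left h2).symm
  constructor
  · rintro ⟨x, y, hxy, h, h1, h2, h3, -⟩
    obtain ⟨h4, h5⟩ := (toSegment_eq_iff hab hb hxy).1 h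
    rw [h4, h5] at h1 h2 h3
    exact ⟨by omega, by omega, (key hab hb).1.2 h3⟩
  · rintro ⟨h1, h2, h3⟩
    have ha' := val_ofNat (n := n) (m := m) (show a ≤ n * m + 1 by omega)
    have hb' := val_ofNat hb
    refine ⟨Fin.ofNat _ a, Fin.ofNat _ b, by rw [Fin.lt_def]; omega, rfl, ?_⟩
    rw [ha', hb']
    exact ⟨by omega, by omega, (key hab hb).1.1 h3, (key hab hb).2.1 h3⟩

theorem cross_iff {a b c d : ℕ} (hab : a < b) (hb : b ≤ n * m + 1) (hcd : c < d)
    (hd : d ≤ n * m + 1) : Cross (toSegment n m (a, b)) (toSegment n m (c, d)) ↔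
      (a < c ∧ c < b ∧ b < d) ∨ (c < a ∧ a < d ∧ d < b) := by
  constructor
  · rintro ⟨x, y, z, w, h1, h2, h3, ⟨h4, h5⟩ | ⟨h4, h5⟩⟩
    · have h6 := (toSegment_eq_iff hab hb (h1.trans h2)).1 h4
      have h7 := (toSegment_eq_iff hcd hd (h2.trans h3)).1 h5
      rw [Fin.lt_def] at h1 h2 h3
      omega
    · have h6 := (toSegment_eq_iff hab hb (h2.trans h3)).1 h4
      have h7 := (toSegment_eq_iff hcd hd (h1.trans h2)).1 h5
      rw [Fin.lt_def] at h1 h2 h3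
      omega
  · have hv : ∀ {a b : ℕ}, a < b → b ≤ n * m + 1 →
        Fin.ofNat (n * m + 2) a < Fin.ofNat (n * m + 2) b := by
      intro a b hab hb
      rw [Fin.lt_def, val_ofNat hb, val_ofNat (by omega)]
      exact hab
    rintro (⟨h1, h2, h3⟩ | ⟨h1, h2, h3⟩)
    · exact ⟨_, _, _, _, hv h1 (by omega), hv h2 hb, hv h3 hd, Or.inl ⟨rfl, rfl⟩⟩
    · exact ⟨_, _, _, _, hv h1 (by omega), hv h2 hd, hv h3 hb, Or.inr ⟨rfl, rfl⟩⟩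

theorem edges_iff {D : Set (Segment n m)} {a b : ℕ} : edges D a b ↔ a < b ∧ b ≤ n * m + 1 ∧
    (b = a + 1 ∨ (a = 0 ∧ b = n * m + 1) ∨ toSegment n m (a, b) ∈ D) := by
  constructor
  · rintro ⟨h1, h2, h3⟩
    rw [isBorderEdge_iff h1 h2] at h3
    tauto
  · rintro ⟨h1, h2, h3⟩
    refine ⟨h1, h2, ?_⟩
    rw [isBorderEdge_iff h1 h2]
    tauto

theorem not_isMDiagonal_self (x : Vertex n m) : ¬ IsMDiagonal (n := n) (m := m) s(x, x) := by
  rintro ⟨a, b, hab, h, -⟩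
  rw [Sym2.eq_iff] at h
  rcases h with ⟨rfl, rfl⟩ | ⟨rfl, rfl⟩ <;> exact lt_irrefl _ hab

theorem exists_of_isMDiagonal {e : Segment n m} (h : IsMDiagonal e) :
    ∃ a b : ℕ, a + 1 < b ∧ b ≤ n * m + 1 ∧ ¬ (a = 0 ∧ b = n * m + 1) ∧ (m : ℤ) ∣ (b : ℤ) - a - 1 ∧
      e = toSegment n m (a, b) := by
  obtain ⟨a, b, h1, h2, rfl⟩ := exists_toSegment_eq e (by
    rintro x rfl
    exact not_isMDiagonal_self x h)
  obtain ⟨h3, h4, h5⟩ := (isMDiagonal_iff h1 h2).1 h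
  exact ⟨a, b, h3, h2, h4, h5, rfl⟩

/-- Maximality is needed only for the existence of cells: an admissible chord that crosses nothing
could be inserted into `D`, so it already belongs to `D`. -/
theorem isAngulation_edges {D : Set (Segment n m)} (hm : 1 ≤ m) (hD : IsAngulation D) :
    EdgeRel.IsAngulation n m (edges D) := by
  have hlt : ∀ {a b}, edges D a b → a < b := fun h => h.1
  have hle : ∀ {a b}, edges D a b → b ≤ n * m + 1 := fun h => h.2.1
  have hdvd : ∀ {a b}, edges D a b → (m : ℤ) ∣ (b : ℤ) - a - 1 := by
    intro a b h
    obtain ⟨h1, h2, rfl | ⟨rfl, rfl⟩ | h3⟩ := edges_iff.1 h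
    · simp
    · simp
    · exact ((isMDiagonal_iff h1 h2).1 (hD.prop.1 _ h3)).2.2
  have hborder : ∀ {a}, a < n * m + 1 → edges D a (a + 1) := fun h =>
    edges_iff.2 ⟨by omega, by omega, Or.inl rfl⟩
  have hnc : ∀ {a b c d}, edges D a b → edges D c d → a < c → c < b → b < d → False := by
    intro a b c d h h' h1 h2 h3
    obtain ⟨h4, h5, h6⟩ := edges_iff.1 h
    obtain ⟨h4', h5', h6'⟩ := edges_iff.1 h'
    have h7 : toSegment n m (a, b) ∈ D := by
      rcases h6 with h6 | h6 | h6
      · omega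
      · omega
      · exact h6
    have h7' : toSegment n m (c, d) ∈ D := by
      rcases h6' with h6' | h6' | h6'
      · omega
      · omega
      · exact h6'
    exact hD.prop.2 _ h7 _ h7' ((cross_iff h4 h5 h4' h5').2 (Or.inl ⟨h1, h2, h3⟩))
  refine ⟨hm, hlt, hle, hdvd, hborder, edges_iff.2 ⟨by omega, le_rfl, by omega⟩, hnc,
    EdgeRel.exists_cell_of_maximal hm hlt hle hdvd hborder hnc ?_⟩
  intro a b hab hb hd hcr
  by_cases h0 : a = 0 ∧ b = n * m + 1
  · exact edges_iff.2 ⟨by omega, hb, by omega⟩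
  have hcross : ∀ e ∈ D, ¬ Cross (toSegment n m (a, b)) e ∧ ¬ Cross e (toSegment n m (a, b)) := by
    intro e he
    obtain ⟨c, d, h1, h2, -, -, rfl⟩ := exists_of_isMDiagonal (hD.prop.1 e he)
    have h3 := hcr c d (edges_iff.2 ⟨by omega, h2, Or.inr (Or.inr he)⟩)
    rw [cross_iff (by omega) hb (by omega) h2, cross_iff (by omega) h2 (by omega) hb]
    omega
  have hself : ¬ Cross (toSegment n m (a, b)) (toSegment n m (a, b)) := by
    rw [cross_iff (by omega) hb (by omega) hb]
    omega
  have hmem : toSegment n m (a, b) ∈ D := by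
    refine hD.le_of_ge (y := insert (toSegment n m (a, b)) D) ⟨?_, ?_⟩ (Set.subset_insert _ _)
      (Set.mem_insert _ _)
    · rintro e (rfl | he)
      · exact (isMDiagonal_iff (by omega) hb).2 ⟨hab, h0, hd⟩
      · exact hD.prop.1 e he
    · rintro e (rfl | he) f (rfl | hf)
      · exact hself
      · exact (hcross f hf).1
      · exact (hcross e he).2
      · exact hD.prop.2 e he f hf
  exact edges_iff.2 ⟨by omega, hb, Or.inr (Or.inr hmem)⟩

theorem edges_diagonals {R : ℕ → ℕ → Prop} (hR : EdgeRel.IsAngulation n m R) :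
    edges (diagonals n m R) = R := by
  funext a b
  apply propext
  rw [edges_iff]
  constructor
  · rintro ⟨h1, h2, rfl | ⟨rfl, rfl⟩ | ⟨⟨c, d⟩, h3, h4, h5⟩⟩
    · exact hR.border (by omega)
    · exact hR.root
    · obtain ⟨rfl, rfl⟩ := toSegment_inj h1 h2 (hR.lt h3.1) h4 h5
      exact h3.1
  · intro h
    refine ⟨hR.lt h, hR.le h, ?_⟩
    by_cases h1 : b = a + 1
    · exact Or.inl h1
    by_cases h2 : a = 0 ∧ b = n * m + 1
    · exact Or.inr (Or.inl h2)
    have := hR.lt h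
    exact Or.inr (Or.inr ⟨(a, b), ⟨h, by simp only; omega, h2⟩, hR.le h, rfl⟩)

/-- Border edges and the root are never crossed, so an `m`-diagonal crossing no diagonal of `R`
crosses no edge, and `rel_of_noncross` applies. -/
theorem isAngulation_diagonals {R : ℕ → ℕ → Prop} (hR : EdgeRel.IsAngulation n m R) :
    IsAngulation (diagonals n m R) := by
  refine ⟨⟨?_, ?_⟩, fun E hE hsub e he => ?_⟩
  · rintro e ⟨⟨a, b⟩, h1, h2, rfl⟩
    exact (isMDiagonal_iff (hR.lt h1.1) h2).2 ⟨h1.2.1, h1.2.2, hR.dvd h1.1⟩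
  · rintro e ⟨⟨a, b⟩, h1, h2, rfl⟩ f ⟨⟨c, d⟩, h3, h4, rfl⟩
    rw [cross_iff (hR.lt h1.1) h2 (hR.lt h3.1) h4]
    rintro (⟨h5, h6, h7⟩ | ⟨h5, h6, h7⟩)
    · exact hR.noncross h1.1 h3.1 h5 h6 h7
    · exact hR.noncross h3.1 h1.1 h5 h6 h7
  · obtain ⟨a, b, h1, h2, h3, h4, rfl⟩ := exists_of_isMDiagonal (hE.1 e he)
    refine ⟨(a, b), ⟨?_, h1, h3⟩, h2, rfl⟩
    refine hR.rel_of_noncross (by omega) h2 h4 fun x y hxy => ?_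
    have hlt := hR.lt hxy
    by_cases h5 : EdgeRel.IsDiag n m R (x, y)
    · have h6 := hE.2 _ (hsub ⟨(x, y), h5, hR.le hxy, rfl⟩) _ he
      rw [cross_iff hlt (hR.le hxy) (by omega) h2] at h6
      omega
    · simp only [EdgeRel.IsDiag, hxy, true_and] at h5
      omega

theorem diagonals_edges_of_not_border {D : Set (Segment n m)}
    (hD : ∀ e ∈ D, ¬ IsBorderEdge e ∧ ∀ x, e ≠ s(x, x)) : diagonals n m (edges D) = D := by
  ext e
  constructor
  · rintro ⟨⟨a, b⟩, ⟨h1, h2, h3⟩, h4, rfl⟩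
    obtain ⟨-, -, h5⟩ := edges_iff.1 h1
    rcases h5 with h5 | h5 | h5
    · simp only at h2
      omega
    · exact absurd h5 h3
    · exact h5
  · intro he
    obtain ⟨a, b, h1, h2, rfl⟩ := exists_toSegment_eq e (hD e he).2
    have h3 := (hD _ he).1
    rw [isBorderEdge_iff h1 h2, not_or] at h3
    exact ⟨(a, b), ⟨⟨h1, h2, Or.inr he⟩, by simp only; omega, h3.2⟩, h2, rfl⟩

theorem IsMDiagonal.not_border {e : Segment n m} (h : IsMDiagonal e) :
    ¬ IsBorderEdge e ∧ ∀ x, e ≠ s(x, x) := by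
  refine ⟨?_, ?_⟩
  · obtain ⟨a, b, h1, h2, h3, -, rfl⟩ := exists_of_isMDiagonal h
    rw [isBorderEdge_iff (by omega) h2]
    omega
  · rintro x rfl
    exact not_isMDiagonal_self x h

theorem diagonals_edges {D : Set (Segment n m)} (hD : IsAngulation D) :
    diagonals n m (edges D) = D :=
  diagonals_edges_of_not_border fun e he => (hD.prop.1 e he).not_border

theorem isBorderEdge_add_one (x y : Vertex n m) : IsBorderEdge (n := n) (m := m) s(x, y) ↔
    IsBorderEdge (n := n) (m := m) s(x + 1, y + 1) := by
  simp only [IsBorderEdge, Sym2.eq_iff]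
  constructor
  · rintro ⟨i, ⟨rfl, rfl⟩ | ⟨rfl, rfl⟩⟩
    · exact ⟨x + 1, by simp⟩
    · exact ⟨y + 1, by simp⟩
  · rintro ⟨i, ⟨h1, h2⟩ | ⟨h1, h2⟩⟩
    · subst h1
      exact ⟨x, Or.inl ⟨rfl, add_right_cancel h2⟩⟩
    · subst h2
      exact ⟨y, Or.inr ⟨add_right_cancel h1, rfl⟩⟩

theorem isBorderEdge_map_rotation (e : Segment n m) :
    IsBorderEdge (n := n) (m := m) (Sym2.map (rotation n m) e) ↔ IsBorderEdge e := by
  induction e using Sym2.ind with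
  | _ x y =>
    rw [Sym2.map_mk, isBorderEdge_add_one]
    simp [rotation]

theorem isBorderEdge_map_rotation_pow (e : Segment n m) (i : ℕ) :
    IsBorderEdge (n := n) (m := m) (Sym2.map ((rotation n m) ^ i : Equiv.Perm (Vertex n m)) e) ↔
      IsBorderEdge e := by
  induction i with
  | zero => simp
  | succ i ih =>
    rw [pow_succ', Equiv.Perm.coe_mul, ← Sym2.map_map, isBorderEdge_map_rotation, ih]

/-- The rotation by one step, in terms of edges. -/
theorem edges_image_rotation (D : Set (Segment n m)) :
    edges (Sym2.map (rotation n m) '' D) = EdgeRel.rotate (n * m + 1) (edges D) := by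
  have hmem : ∀ x y : Vertex n m, s(x, y) ∈ Sym2.map (rotation n m) '' D ↔ s(x + 1, y + 1) ∈ D := by
    intro x y
    constructor
    · rintro ⟨e, he, h⟩
      induction e using Sym2.ind with
      | _ u v =>
        rw [Sym2.map_mk, Sym2.eq_iff] at h
        simp only [rotation, Equiv.subRight_apply] at h
        rcases h with ⟨rfl, rfl⟩ | ⟨rfl, rfl⟩
        · simpa using he
        · rw [Sym2.eq_swap]
          simpa using he
    · intro h
      exact ⟨_, h, by simp [rotation]⟩
  have hb := isBorderEdge_add_one (n := n) (m := m)
  funext a b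
  apply propext
  have key : ∀ {a b : ℕ}, edges (Sym2.map (rotation n m) '' D) a b ↔ a < b ∧ b ≤ n * m + 1 ∧
      (IsBorderEdge (toSegment n m (a + 1, b + 1)) ∨ toSegment n m (a + 1, b + 1) ∈ D) := by
    intro a b
    rw [edges, toSegment, hmem, hb, toSegment, ofNat_succ, ofNat_succ]
  rw [key, EdgeRel.rotate]
  -- The number `n * m + 2` stands for vertex `0`; this is the second alternative in `rotate`.
  have hswap : ∀ a, toSegment n m (a + 1, n * m + 1 + 1) = toSegment n m (0, a + 1) := by
    intro a
    rw [toSegment, toSegment, ofNat_succ (n * m + 1), ofNat_last, Sym2.eq_swap]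
    rfl
  constructor
  · rintro ⟨h1, h2, h3⟩
    rcases Nat.lt_or_eq_of_le h2 with h4 | rfl
    · exact Or.inl ⟨by omega, by omega, h3⟩
    · rw [hswap] at h3
      exact Or.inr ⟨rfl, by omega, by omega, h3⟩
  · rintro (⟨h1, h2, h3⟩ | ⟨rfl, h1, h2, h3⟩)
    · exact ⟨by omega, by omega, h3⟩
    · rw [hswap]
      exact ⟨by omega, le_rfl, h3⟩

theorem edges_image_rotation_pow (D : Set (Segment n m)) (i : ℕ) :
    edges (Sym2.map ((rotation n m) ^ i : Equiv.Perm (Vertex n m)) '' D) =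
      (EdgeRel.rotate (n * m + 1))^[i] (edges D) := by
  induction i with
  | zero => simp
  | succ i ih =>
    rw [Function.iterate_succ_apply', ← ih, ← edges_image_rotation, Set.image_image]
    simp only [pow_succ', Equiv.Perm.coe_mul, ← Sym2.map_map]

/-- Colour `c`, counted counterclockwise, is the clockwise distance `m + 1 - c` used in `Follows`.
-/
theorem sub_sub_one_val {k : ℕ} (i j : Fin (k + 2)) {c : ℕ} (hc : c ≤ k) :
    (i ≠ j ∧ c = (i - j - 1).val) ↔ (i.val + (k + 1 - c)) % (k + 2) = j.val := by
  have h1 : (i - j - 1 : Fin (k + 2)) = i - (j + 1) := by rw [sub_sub]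
  have hi := i.isLt
  have hj := j.isLt
  have hval : (i - j - 1).val = if j.val < i.val then i.val - j.val - 1 else
      k + 1 + i.val - j.val := by
    rw [h1]
    by_cases h2 : j.val < i.val
    · have h3 : (j + 1).val = j.val + 1 := by
        rw [Fin.val_add_one_of_lt']
        omega
      rw [if_pos h2, Fin.sub_val_of_le (by rw [Fin.le_def]; omega), h3]
      omega
    · rw [if_neg h2]
      by_cases h3 : j.val = k + 1
      · have h4 : j + 1 = 0 := by
          apply Fin.ext
          simp [Fin.val_add, h3]
        rw [h4, sub_zero, h3]
        omega
      · have h4 : (j + 1).val = j.val + 1 := by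
          rw [Fin.val_add_one_of_lt']
          omega
        rw [Fin.val_sub, h4, Nat.mod_eq_of_lt (by omega)]
        omega
  rw [hval, ne_eq, Fin.ext_iff]
  rcases lt_or_ge (i.val + (k + 1 - c)) (k + 2) with h2 | h2
  · rw [Nat.mod_eq_of_lt h2]
    split_ifs <;> omega
  · rw [Nat.mod_eq_sub_mod h2, Nat.mod_eq_of_lt (by omega)]
    split_ifs <;> omega

theorem side_eq_toSegment {p : Fin (m + 2) → Vertex n m} {q : ℕ → ℕ}
    (h : ∀ i : Fin (m + 2), p i = Fin.ofNat _ (q i.val)) (i : Fin (m + 2)) :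
    side p i = toSegment n m (EdgeRel.side m q i.val) := by
  have hi := i.isLt
  rcases Nat.lt_or_ge i.val (m + 1) with h1 | h1
  · have h2 : (i + 1).val = i.val + 1 := by
      rw [Fin.val_add_one_of_lt']
      omega
    rw [EdgeRel.side_of_le _ (by omega), side, h, h, h2, toSegment]
  · have h3 : i.val = m + 1 := by omega
    have h2 : i + 1 = 0 := by
      apply Fin.ext
      simp [Fin.val_add, h3]
    rw [h3, EdgeRel.side_top, side, h, h, h2, h3, toSegment, Sym2.eq_swap]
    rfl

theorem exists_isCell {D : Set (Segment n m)} {p : Fin (m + 2) → Vertex n m} (hp : IsCell D p) :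
    ∃ q, EdgeRel.IsCell m (edges D) q ∧ ∀ i : Fin (m + 2), p i = Fin.ofNat _ (q i.val) := by
  obtain ⟨q, hq⟩ : ∃ q : ℕ → ℕ, ∀ i (hi : i < m + 2), q i = (p ⟨i, hi⟩).val :=
    ⟨fun i => if h : i < m + 2 then (p ⟨i, h⟩).val else 0, fun i hi => dif_pos hi⟩
  have h1 : ∀ i : Fin (m + 2), p i = Fin.ofNat _ (q i.val) := by
    intro i
    rw [hq _ i.isLt, ofNat_val]
  refine ⟨q, ⟨fun i hi => ?_, ?_⟩, h1⟩
  · have h2 := hp.2 ⟨i, by omega⟩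
    rw [side_eq_toSegment h1, EdgeRel.side_of_le _ hi] at h2
    refine ⟨?_, ?_, h2⟩
    · rw [hq i (by omega), hq (i + 1) (by omega)]
      exact hp.1 (by simp [Fin.lt_def])
    · rw [hq (i + 1) (by omega)]
      omega
  · have h2 := hp.2 ⟨m + 1, by omega⟩
    rw [side_eq_toSegment h1, EdgeRel.side_top] at h2
    refine ⟨?_, ?_, h2⟩
    · rw [hq 0 (by omega), hq (m + 1) (by omega)]
      exact hp.1 (by simp [Fin.lt_def])
    · rw [hq (m + 1) (by omega)]
      omega

theorem isCell_ofNat {D : Set (Segment n m)} (hR : EdgeRel.IsAngulation n m (edges D))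
    {q : ℕ → ℕ} (hq : EdgeRel.IsCell m (edges D) q) :
    IsCell D (fun i : Fin (m + 2) => Fin.ofNat (n * m + 2) (q i.val)) := by
  have hle : ∀ i ≤ m + 1, q i ≤ n * m + 1 := fun i hi =>
    (hR.cell_le hq hi le_rfl).trans (hR.le hq.top)
  refine ⟨fun i j hij => ?_, fun i => ?_⟩
  · rw [Fin.lt_def, val_ofNat (hle _ (by omega)), val_ofNat (hle _ (by omega))]
    exact hR.cell_lt hq hij (by omega)
  · rw [side_eq_toSegment (q := q) (fun _ => rfl)]
    exact (EdgeRel.IsAngulation.side_rel hq i.val).2.2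

/-- The coloured quiver of `D`, in terms of edges. -/
theorem quiver_iso (D : Angulation n m) (hm : 1 ≤ m) :
    ColouredQuiver.Iso (EdgeRel.quiver n m (edges D.1)) (quiver D) := by
  have hR := isAngulation_edges hm D.2
  have hmem : ∀ x, EdgeRel.IsDiag n m (edges D.1) x → toSegment n m x ∈ D.1 := by
    intro x hx
    rw [← diagonals_edges D.2]
    exact ⟨x, hx, hR.le hx.1, rfl⟩
  let g : (EdgeRel.quiver n m (edges D.1)).V → (quiver D).V :=
    fun x => ⟨toSegment n m x.1, hmem x.1 x.2⟩
  have hg : Function.Bijective g := by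
    constructor
    · intro x y hxy
      obtain ⟨h1, h2⟩ := toSegment_inj (hR.lt x.2.1) (hR.le x.2.1) (hR.lt y.2.1) (hR.le y.2.1)
        (congrArg Subtype.val hxy)
      exact Subtype.ext (Prod.ext h1 h2)
    · rintro ⟨e, he⟩
      have he' := he
      rw [← diagonals_edges D.2] at he'
      obtain ⟨x, hx, -, rfl⟩ := he'
      exact ⟨⟨x, hx⟩, rfl⟩
  refine ⟨Equiv.ofBijective g hg, fun α β c => ?_⟩
  refine EdgeRel.ite_eq_ite ?_
  change (∃ (p : Fin (m + 2) → Vertex n m) (i j : Fin (m + 2)), IsCell D.1 p ∧ i ≠ j ∧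
    side p i = toSegment n m α.1 ∧ side p j = toSegment n m β.1 ∧ c.val = (i - j - 1).val) ↔ _
  have hinj : ∀ {q : ℕ → ℕ}, EdgeRel.IsCell m (edges D.1) q → ∀ {s : ℕ} {x : ℕ × ℕ},
      edges D.1 x.1 x.2 → toSegment n m (EdgeRel.side m q s) = toSegment n m x →
      EdgeRel.side m q s = x := by
    intro q hq s x hx h
    have h1 := EdgeRel.IsAngulation.side_rel hq s
    obtain ⟨h2, h3⟩ := toSegment_inj (hR.lt h1) (hR.le h1) (hR.lt hx) (hR.le hx) h
    exact Prod.ext h2 h3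
  constructor
  · rintro ⟨p, i, j, hp, hij, h1, h2, h3⟩
    obtain ⟨q, hq, hpq⟩ := exists_isCell hp
    rw [side_eq_toSegment hpq] at h1 h2
    refine ⟨q, hq, i.val, hinj hq α.2.1 h1, ?_⟩
    rw [← EdgeRel.side_mod, (sub_sub_one_val i j (by omega)).1 ⟨hij, h3⟩]
    exact hinj hq β.2.1 h2
  · rintro ⟨q, hq, s, h1, h2⟩
    have hs := Nat.mod_lt s (show 0 < m + 2 by omega)
    have hs' := Nat.mod_lt (s + (m + 1 - c.val)) (show 0 < m + 2 by omega)
    obtain ⟨h3, h4⟩ := (sub_sub_one_val (k := m) ⟨s % (m + 2), hs⟩ ⟨_, hs'⟩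
      (show c.val ≤ m by omega)).2 (by simp)
    refine ⟨_, ⟨s % (m + 2), hs⟩, ⟨_, hs'⟩, isCell_ofNat hR hq, h3, ?_, ?_, h4⟩
    · rw [side_eq_toSegment (q := q) (fun _ => rfl), EdgeRel.side_mod, h1]
    · rw [side_eq_toSegment (q := q) (fun _ => rfl), EdgeRel.side_mod, h2]

end Polygon

/-! ### Recovering an angulation, up to rotation, from its quiver. -/

namespace EdgeRel

/-- Two different edges are sides of a common cell. -/
def Adj (m : ℕ) (R : ℕ → ℕ → Prop) (α β : ℕ × ℕ) : Prop :=
  ∃ d, 1 ≤ d ∧ d ≤ m + 1 ∧ Follows m R α d β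

/-- The edge `α` lies below the edge `β`. -/
def Below (α β : ℕ × ℕ) : Prop := β.1 ≤ α.1 ∧ α.2 ≤ β.2

theorem adj_of_cell {m : ℕ} {R : ℕ → ℕ → Prop} {p : ℕ → ℕ} (hp : IsCell m R p) {i j : ℕ}
    (hij : i % (m + 2) ≠ j % (m + 2)) : Adj m R (side m p i) (side m p j) := by
  have hi := Nat.mod_lt i (show 0 < m + 2 by omega)
  have hj := Nat.mod_lt j (show 0 < m + 2 by omega)
  rw [← side_mod m p i, ← side_mod m p j]
  rcases lt_or_gt_of_ne hij with h | h
  · exact ⟨j % (m + 2) - i % (m + 2), by omega, by omega, p, hp, _, rfl, by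
      rw [Nat.add_sub_cancel' h.le]⟩
  · exact ⟨j % (m + 2) + (m + 2) - i % (m + 2), by omega, by omega, p, hp, _, rfl, by
      rw [Nat.add_sub_cancel' (by omega), side_add]⟩

namespace IsAngulation

variable {n m : ℕ} {R R' : ℕ → ℕ → Prop}

theorem mod_top (m : ℕ) : (m + 1) % (m + 2) = m + 1 := Nat.mod_eq_of_lt (by omega)

/-- A neighbour of a side `γ` of `p` either is another side of `p`, or is a side of the cell `q`
below `γ`. -/
theorem adj_cases (hR : IsAngulation n m R) {p q : ℕ → ℕ} (hp : IsCell m R p) (hq : IsCell m R q)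
    {k : ℕ} (hk : k ≤ m) (h0 : q 0 = p k) (h1 : q (m + 1) = p (k + 1)) {δ : ℕ × ℕ}
    (h : Adj m R (p k, p (k + 1)) δ) : (∃ j, j % (m + 2) ≠ k ∧ δ = side m p j) ∨
      ∃ l ≤ m, δ = side m q l := by
  obtain ⟨d, hd, hd', r, hr, s, hs, rfl⟩ := h
  obtain ⟨t, ht, hst, -, h2⟩ := exists_side_eq (m := m) r s
  have hs' := hs
  have hne := add_mod_ne s hd hd'
  rw [h2] at hs'
  rcases Nat.lt_or_eq_of_le ht with ht | rfl
  · rw [side_of_le _ (by omega), Prod.mk.injEq] at hs'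
    have h3 := hR.cell_unique_step hr hp (show t ≤ m by omega) hk hs'.1 hs'.2
    left
    rw [side_congr h3, ← side_of_le p hk] at hs
    have h4 := hR.side_inj hp hs
    rw [Nat.mod_eq_of_lt (show k < m + 2 by omega)] at h4
    exact ⟨s + d, by omega, side_congr h3 _⟩
  · rw [side_top, Prod.mk.injEq] at hs'
    have h3 := hR.cell_unique_top hr hq (by omega) (by omega)
    have h4 := Nat.mod_lt (s + d) (show 0 < m + 2 by omega)
    exact Or.inr ⟨(s + d) % (m + 2), by omega, by rw [side_mod, side_congr h3]⟩

/-- The diagonals in the cell below a side `γ` of `p` are the neighbours of `γ` that are not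
linked to the longest side of `p`. -/
theorem below_iff (hR : IsAngulation n m R) {p : ℕ → ℕ} (hp : IsCell m R p)
    {k : ℕ} (hk : k ≤ m) (hbig : p k + 1 < p (k + 1)) {δ : ℕ × ℕ}
    (h : Adj m R (p k, p (k + 1)) δ) : Below δ (p k, p (k + 1)) ↔
      ¬ (δ = (p 0, p (m + 1)) ∨ Adj m R δ (p 0, p (m + 1))) := by
  obtain ⟨q, hq, h0, h1⟩ := hR.cell (hp.step k hk) hbig
  rw [← side_top m p]
  rcases hR.adj_cases hp hq hk h0 h1 h with ⟨j, hj, rfl⟩ | ⟨l, hl, rfl⟩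
  · constructor
    · intro h2
      exact absurd (hR.side_eq_of_sub hp hk h2.1 h2.2) hj
    · intro h2
      refine absurd ?_ h2
      by_cases h3 : j % (m + 2) = (m + 1) % (m + 2)
      · exact Or.inl (by rw [← side_mod, h3, side_mod])
      · exact Or.inr (adj_of_cell hp h3)
  · have h2 := hR.side_sub hq l
    refine iff_of_true ⟨by simp only; omega, by simp only; omega⟩ ?_
    rintro (h3 | ⟨d, -, -, r, hr, s, hs, hs'⟩)
    · have := hR.side_ne_of_sub hp hq hk h0 h1 h3.symm
      rw [mod_top] at this
      omega
    · have := hR.cell_unique_of_sub hp hq hr hk h0 h1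
        (by rw [Nat.mod_eq_of_lt (by omega)]; exact hl) hs' hs
      rw [mod_top] at this
      omega

theorem border_of_not_isDiag (hR : IsAngulation n m R) {p : ℕ → ℕ} (hp : IsCell m R p) {i : ℕ}
    (hi : i ≤ m) (h : ¬ IsDiag n m R (p i, p (i + 1))) : p (i + 1) = p i + 1 := by
  have hm := hR.one_le
  have h1 := hR.cell_lt hp (show i < i + 1 by omega) (by omega)
  have h2 := hR.le hp.top
  have h3 : ¬ (p i = 0 ∧ p (i + 1) = n * m + 1) := by
    rintro ⟨h3, h4⟩
    have h5 := hR.cell_inj hp (show i ≤ m + 1 by omega) (Nat.zero_le _)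
      (le_antisymm (by omega) (hR.cell_le hp (Nat.zero_le i) (by omega)))
    have h6 := hR.cell_inj hp (show i + 1 ≤ m + 1 by omega) le_rfl
      (le_antisymm (hR.cell_le hp (by omega) (by omega)) (by omega))
    omega
  by_contra h4
  exact h ⟨hp.step i hi, by simp only; omega, h3⟩

theorem cell_side_lt (hR : IsAngulation n m R) {p : ℕ → ℕ} (hp : IsCell m R p) {i : ℕ}
    (hi : i ≤ m) : p (i + 1) - p i < p (m + 1) - p 0 := by
  have hm := hR.one_le
  have a1 := hR.cell_le hp (show 0 ≤ i by omega) (by omega)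
  have a2 := hR.cell_le hp (show i + 1 ≤ m + 1 by omega) (by omega)
  have a3 := hR.cell_lt hp (show i < i + 1 by omega) (by omega)
  have : 0 < i ∨ i + 1 < m + 1 := by omega
  rcases this with h3 | h3
  · have := hR.cell_lt hp h3 (by omega)
    omega
  · have := hR.cell_lt hp h3 (by omega)
    omega

theorem follows_iff_of_arrows {e : (quiver n m R).V ≃ (quiver n m R').V}
    (he : ∀ α β c, (quiver n m R').arrows (e α) (e β) c = (quiver n m R).arrows α β c)
    (α β : (quiver n m R).V) {d : ℕ} (hd : 1 ≤ d) (hd' : d ≤ m + 1) :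
    Follows m R α.1 d β.1 ↔ Follows m R' (e α).1 d (e β).1 := by
  have h : (if Follows m R' (e α).1 (m + 1 - (m + 1 - d)) (e β).1 then 1 else 0) =
      if Follows m R α.1 (m + 1 - (m + 1 - d)) β.1 then 1 else 0 := he α β ⟨m + 1 - d, by omega⟩
  rw [show m + 1 - (m + 1 - d) = d by omega] at h
  split_ifs at h with h1 h2 h2
  · exact iff_of_true h2 h1
  · exact iff_of_false h2 h1

section Iso

/-- The positions of the sides of the cell below `α` are preserved. -/
theorem map_side (hR' : IsAngulation n m R')
    (e : (quiver n m R).V ≃ (quiver n m R').V)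
    (he : ∀ α β d, 1 ≤ d → d ≤ m + 1 →
      (Follows m R α.1 d β.1 ↔ Follows m R' (e α).1 d (e β).1))
    {p p' : ℕ → ℕ} (hR : IsAngulation n m R) (hp : IsCell m R p) (hp' : IsCell m R' p')
    {α : (quiver n m R).V} (h0 : α.1 = (p 0, p (m + 1))) (h1 : (e α).1 = (p' 0, p' (m + 1)))
    (hb : ∀ γ, Adj m R α.1 γ.1 → (Below γ.1 α.1 ↔ Below (e γ).1 (e α).1))
    {i : ℕ} (hi : i ≤ m) {γ : (quiver n m R).V} (hγ : γ.1 = (p i, p (i + 1))) :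
    (e γ).1 = (p' i, p' (i + 1)) := by
  have h2 : Follows m R α.1 (i + 1) γ.1 := by
    refine ⟨p, hp, m + 1, by rw [h0, side_top], ?_⟩
    rw [show m + 1 + (i + 1) = i + (m + 2) by omega, side_add, side_of_le _ hi, hγ]
  have h3 : Below (e γ).1 (e α).1 := by
    refine (hb γ ⟨_, by omega, by omega, h2⟩).1 ?_
    rw [h0, hγ]
    exact ⟨hR.cell_le hp (by omega) (by omega), hR.cell_le hp (by omega) (by omega)⟩
  obtain ⟨r, hr, s, hs, hs'⟩ := (he _ _ _ (by omega) (by omega)).1 h2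
  obtain ⟨t, ht, hst, -, h4⟩ := exists_side_eq (m := m) r s
  have hne := add_mod_ne s (show 1 ≤ i + 1 by omega) (show i + 1 ≤ m + 1 by omega)
  rw [← hs, ← hs', h4] at h3
  -- The image of `γ` lies below that of `α`, which is possible within one cell only if the image of
  -- `α` is the longest side. So `r` is the cell `p'`, and the equal distance gives the equal index.
  rcases Nat.lt_or_eq_of_le ht with ht | rfl
  · rw [side_of_le _ (show t ≤ m by omega)] at h3
    have := hR'.side_eq_of_sub hr (show t ≤ m by omega) h3.1 h3.2
    omega
  · rw [h4, side_top, h1, Prod.mk.injEq] at hs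
    have h5 := hR'.cell_unique_top hr hp' hs.1 hs.2
    have h6 : (s + (i + 1)) % (m + 2) = i % (m + 2) := by
      have : s + (i + 1) ≡ m + 1 + (i + 1) [MOD m + 2] :=
        Nat.ModEq.add_right _ (hst.trans (mod_top m).symm)
      rw [this, show m + 1 + (i + 1) = i + (m + 2) by omega, Nat.add_mod_right]
    rw [← hs', side_congr h5, ← side_mod, h6, side_mod, side_of_le _ hi]

/-- An isomorphism of quivers that is compatible with the cells below `α` and its image preserves
everything below `α`. -/
theorem rel_of_iso (hR : IsAngulation n m R) (hR' : IsAngulation n m R')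
    (e : (quiver n m R).V ≃ (quiver n m R').V)
    (he : ∀ α β d, 1 ≤ d → d ≤ m + 1 →
      (Follows m R α.1 d β.1 ↔ Follows m R' (e α).1 d (e β).1)) (N : ℕ) :
    ∀ α : (quiver n m R).V, α.1.2 - α.1.1 < N →
      (∀ γ, Adj m R α.1 γ.1 → (Below γ.1 α.1 ↔ Below (e γ).1 (e α).1)) →
      α.1.2 - α.1.1 = (e α).1.2 - (e α).1.1 ∧ ∀ s t, α.1.1 + t ≤ α.1.2 →
        R (α.1.1 + s) (α.1.1 + t) → R' ((e α).1.1 + s) ((e α).1.1 + t) := by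
  have hm := hR.one_le
  induction N with
  | zero => exact fun _ h => absurd h (Nat.not_lt_zero _)
  | succ N ih =>
    intro α hN hb
    obtain ⟨p, hp, h0, h1⟩ := hR.cell α.2.1 α.2.2.1
    obtain ⟨p', hp', h0', h1'⟩ := hR'.cell (e α).2.1 (e α).2.2.1
    have hα : α.1 = (p 0, p (m + 1)) := by rw [h0, h1]
    have hα' : (e α).1 = (p' 0, p' (m + 1)) := by rw [h0', h1']
    have hadj : ∀ γ δ : (quiver n m R).V, Adj m R γ.1 δ.1 ↔ Adj m R' (e γ).1 (e δ).1 :=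
      fun γ δ => ⟨fun ⟨d, h1, h2, h3⟩ => ⟨d, h1, h2, (he _ _ _ h1 h2).1 h3⟩,
        fun ⟨d, h1, h2, h3⟩ => ⟨d, h1, h2, (he _ _ _ h1 h2).2 h3⟩⟩
    have hside : ∀ i ≤ m, ∀ γ : (quiver n m R).V, γ.1 = (p i, p (i + 1)) →
        (e γ).1 = (p' i, p' (i + 1)) := fun i hi γ hγ =>
      map_side hR' e he hR hp hp' hα hα' hb hi hγ
    -- The inverse isomorphism shows that the two cells have diagonals, and thus border edges, at
    -- the same positions.
    have hside' : ∀ i ≤ m, IsDiag n m R' (p' i, p' (i + 1)) → IsDiag n m R (p i, p (i + 1)) := by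
      intro i hi hd
      have h2 := map_side hR e.symm (fun α β d hd hd' => by rw [he _ _ _ hd hd']; simp) hR' hp' hp
        (α := e α) hα' (by rw [e.symm_apply_apply, hα]) (fun γ hγ => by
          rw [e.symm_apply_apply, hb, e.apply_symm_apply]
          rwa [hadj, e.apply_symm_apply]) hi (γ := ⟨_, hd⟩) rfl
      rw [← h2]
      exact (e.symm ⟨_, hd⟩).2
    have hsub : ∀ i ≤ m, ∀ γ : (quiver n m R).V, γ.1 = (p i, p (i + 1)) →
        p (i + 1) - p i = p' (i + 1) - p' i ∧ ∀ s t, p i + t ≤ p (i + 1) →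
          R (p i + s) (p i + t) → R' (p' i + s) (p' i + t) := by
      intro i hi γ hγ
      have hγ' := hside i hi γ hγ
      have a1 := hR.cell_le hp (show 0 ≤ i by omega) (by omega)
      have a2 := hR.cell_le hp (show i + 1 ≤ m + 1 by omega) (by omega)
      have a3 := hR.cell_side_lt hp hi
      have h2 := ih γ (by rw [hγ]; simp only; rw [hα] at hN; simp only at hN; omega) ?_
      · rw [hγ, hγ'] at h2
        exact h2
      -- The hypothesis for the next level: by `below_iff`, lying below `γ` is expressed by
      -- adjacency to `α` and equality with `α`, which the isomorphism preserves.
      · intro δ hδ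
        have hδ' := (hadj _ _).1 hδ
        rw [hγ] at hδ ⊢
        rw [hγ'] at hδ' ⊢
        have b1 := γ.2.2.1
        have b2 := (e γ).2.2.1
        rw [hγ] at b1
        rw [hγ'] at b2
        have hval : δ.1 = α.1 ↔ (e δ).1 = (e α).1 :=
          ⟨fun h => congrArg (fun x => (e x).1) (Subtype.ext h : δ = α),
            fun h => congrArg Subtype.val (e.injective (Subtype.ext h))⟩
        rw [hR.below_iff hp hi b1 hδ, hR'.below_iff hp' hi b2 hδ', ← hα, ← hα', hadj δ α, hval]
    have hlen : ∀ i ≤ m, p (i + 1) - p i = p' (i + 1) - p' i := by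
      intro i hi
      by_cases hd : IsDiag n m R (p i, p (i + 1))
      · exact (hsub i hi ⟨_, hd⟩ rfl).1
      · rw [hR.border_of_not_isDiag hp hi hd,
          hR'.border_of_not_isDiag hp' hi (fun h => hd (hside' i hi h))]
        omega
    have hpos : ∀ i ≤ m + 1, p i - p 0 = p' i - p' 0 := by
      intro i
      induction i with
      | zero => simp
      | succ i ih =>
        intro hi
        have := ih (by omega)
        have := hlen i (by omega)
        have := hR.cell_le hp (show 0 ≤ i by omega) (by omega)
        have := hR'.cell_le hp' (show 0 ≤ i by omega) (by omega)
        have := hR.cell_lt hp (show i < i + 1 by omega) (by omega)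
        have := hR'.cell_lt hp' (show i < i + 1 by omega) (by omega)
        omega
    rw [hα, hα']
    refine ⟨hpos _ le_rfl, fun s t ht hst => ?_⟩
    simp only at ht hst ⊢
    have hlt := hR.lt hst
    have c1 := hpos (m + 1) le_rfl
    have c2 := hR'.lt hp'.top
    rcases hR.locate hp hst with ⟨i, hi, h2, h3⟩ | ⟨h2, h3⟩ | h2 | h2
    · have d1 := hpos i (by omega)
      have d2 := hlen i hi
      have d3 := hR.cell_le hp (show 0 ≤ i by omega) (by omega)
      have d4 := hR'.cell_le hp' (show 0 ≤ i by omega) (by omega)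
      by_cases hd : IsDiag n m R (p i, p (i + 1))
      · have h4 := (hsub i hi ⟨_, hd⟩ rfl).2 (s - (p i - p 0)) (t - (p i - p 0)) (by omega)
          (by rwa [show p i + (s - (p i - p 0)) = p 0 + s by omega,
            show p i + (t - (p i - p 0)) = p 0 + t by omega])
        rwa [show p' i + (s - (p i - p 0)) = p' 0 + s by omega,
            show p' i + (t - (p i - p 0)) = p' 0 + t by omega] at h4
      · have h4 := hR.border_of_not_isDiag hp hi hd
        obtain rfl : t = s + 1 := by omega
        have := hR'.le hp'.top
        exact hR'.border (by omega)
    · rw [show p' 0 + s = p' 0 by omega, show p' 0 + t = p' (m + 1) by omega]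
      exact hp'.top
    · omega
    · omega

end Iso

theorem cell_add_le (hR : IsAngulation n m R) {p : ℕ → ℕ} (hp : IsCell m R p) {i j : ℕ}
    (hij : i ≤ j) (hj : j ≤ m + 1) : p i + (j - i) ≤ p j := by
  induction j, hij using Nat.le_induction with
  | base => simp
  | succ j hij ih =>
    have := ih (by omega)
    have := hR.cell_lt hp (show j < j + 1 by omega) hj
    omega

/-- If the cell of the root cuts off only one diagonal, the other ones lie below it. -/
theorem below_of_isDiag (hR : IsAngulation n m R) {X : ℕ} (hX : X + m = n * m + 1) (h : R 0 X)
    {γ : ℕ × ℕ} (hγ : IsDiag n m R γ) : Below γ (0, X) := by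
  have hm := hR.one_le
  obtain ⟨p, hp, k, hk, h0, h1⟩ := hR.exists_parent h (by omega)
  obtain rfl : k = 0 := by
    by_contra hc
    have := hR.cell_lt hp (show 0 < k by omega) (by omega)
    omega
  rw [zero_add] at h1
  have hlast := hR.cell_add_le hp (show 1 ≤ m + 1 by omega) le_rfl
  have hle := hR.le hp.top
  have hγlt := hR.lt hγ.1
  have hγle := hR.le hγ.1
  have hγ1 := hγ.2.1
  have hγ2 := hγ.2.2
  refine ⟨Nat.zero_le _, ?_⟩
  rcases hR.locate hp hγ.1 with ⟨i, hi, h2, h3⟩ | ⟨h2, h3⟩ | h2 | h2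
  · rcases Nat.eq_zero_or_pos i with rfl | h4
    · simp only [zero_add] at h3
      simp only
      omega
    · have := hR.cell_add_le hp (show 1 ≤ i by omega) (by omega)
      have := hR.cell_add_le hp (show i + 1 ≤ m + 1 by omega) le_rfl
      omega
  · omega
  · omega
  · omega

/-- Every diagonal lies below `(0, X)` in both angulations, so the hypothesis of `rel_of_iso` about
lower neighbours is automatic and the recursion covers everything. -/
theorem eq_of_iso_of_root (hR : IsAngulation n m R) (hR' : IsAngulation n m R') {X : ℕ}
    (hX : X + m = n * m + 1) (e : (quiver n m R).V ≃ (quiver n m R').V)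
    (he : ∀ α β c, (quiver n m R').arrows (e α) (e β) c = (quiver n m R).arrows α β c)
    (α : (quiver n m R).V) (hα : α.1 = (0, X)) (hα' : (e α).1 = (0, X)) : R = R' := by
  have he' : ∀ α β d, 1 ≤ d → d ≤ m + 1 →
      (Follows m R α.1 d β.1 ↔ Follows m R' (e α).1 d (e β).1) :=
    fun α β _ => follows_iff_of_arrows he α β
  have key : ∀ {R R' : ℕ → ℕ → Prop}, IsAngulation n m R → IsAngulation n m R' →
      ∀ e : (quiver n m R).V ≃ (quiver n m R').V, (∀ α β d, 1 ≤ d → d ≤ m + 1 →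
        (Follows m R α.1 d β.1 ↔ Follows m R' (e α).1 d (e β).1)) → ∀ α : (quiver n m R).V,
      α.1 = (0, X) → (e α).1 = (0, X) → ∀ x y, R x y → R' x y := by
    intro R R' hR hR' e he α hα hα' x y hxy
    have hRX := α.2.1
    have hRX' := (e α).2.1
    rw [hα] at hRX
    rw [hα'] at hRX'
    have h1 := (hR.rel_of_iso hR' e he _ α (Nat.lt_succ_self _) (fun γ _ => by
      rw [hα, hα']
      exact iff_of_true (hR.below_of_isDiag hX hRX γ.2)
        (hR'.below_of_isDiag hX hRX' (e γ).2))).2 x y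
    rw [hα, hα'] at h1
    simp only [zero_add] at h1
    have hlt := hR.lt hxy
    have hle := hR.le hxy
    by_cases h2 : y = x + 1
    · subst h2
      exact hR'.border (by omega)
    by_cases h3 : x = 0 ∧ y = n * m + 1
    · rw [h3.1, h3.2]
      exact hR'.root
    exact h1 (hR.below_of_isDiag hX hRX (γ := (x, y)) ⟨hxy, by simp only; omega, h3⟩).2 hxy
  funext x y
  refine propext ⟨key hR hR' e he' α hα hα' x y, key hR' hR e.symm ?_ (e α) hα' ?_ x y⟩
  · intro α β d hd hd'
    rw [he' _ _ _ hd hd']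
    simp
  · rw [e.symm_apply_apply, hα]

theorem iterate_shift (L k c d : ℕ) : (shift L)^[k] (c + k, d + k) = (c, d) := by
  induction k with
  | zero => rfl
  | succ k ih =>
    rw [Function.iterate_succ_apply, shift, if_neg (by simp)]
    exact ih

/-- A diagonal with only border edges below it can be rotated to `(0, X)`. -/
theorem exists_shift_of_inner (hR : IsAngulation n m R) {X : ℕ} (hX : X + m = n * m + 1)
    {p : ℕ → ℕ} (hp : IsCell m R p) (h : ∀ i ≤ m, ¬ IsDiag n m R (p i, p (i + 1))) :
    ∃ k, (shift (n * m + 1))^[k] (p 0, p (m + 1)) = (0, X) := by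
  have h1 : ∀ i ≤ m + 1, p i = p 0 + i := by
    intro i
    induction i with
    | zero => simp
    | succ i ih =>
      intro hi
      rw [hR.border_of_not_isDiag hp (by omega) (h i (by omega)), ih (by omega), add_assoc]
  -- After `p 0` steps the diagonal is `(0, m + 1)`; one more step turns it into `(m, n * m + 1)`,
  -- and `m` further steps lead to `(0, X)`.
  refine ⟨m + 1 + p 0, ?_⟩
  have h2 := iterate_shift (n * m + 1) (p 0) 0 (m + 1)
  rw [zero_add] at h2
  rw [Function.iterate_add_apply, h1 (m + 1) le_rfl, add_comm (p 0) (m + 1), h2,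
    Function.iterate_add_apply]
  have h3 := iterate_shift (n * m + 1) m 0 X
  rw [zero_add, hX] at h3
  exact h3

/-- A diagonal with only border edges in the cell above it can be rotated to `(0, X)`. -/
theorem exists_shift_of_outer (hR : IsAngulation n m R) {X : ℕ} (hX : X + m = n * m + 1)
    {p : ℕ → ℕ} (hp : IsCell m R p) {k : ℕ} (hk : k ≤ m)
    (h : ∀ i, i % (m + 2) ≠ k → ¬ IsDiag n m R (side m p i)) :
    ∃ k', (shift (n * m + 1))^[k'] (p k, p (k + 1)) = (0, X) := by
  have hm := hR.one_le
  have htop : p 0 = 0 ∧ p (m + 1) = n * m + 1 := by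
    by_contra hc
    refine h (m + 1) (by rw [mod_top]; omega) ?_
    rw [side_top]
    have := hR.cell_add_le hp (Nat.zero_le (m + 1)) le_rfl
    exact ⟨hp.top, by simp only; omega, hc⟩
  have h1 : ∀ i ≤ m, i ≠ k → p (i + 1) = p i + 1 := by
    intro i hi hik
    refine hR.border_of_not_isDiag hp hi ?_
    rw [← side_of_le p hi]
    exact h i (by rw [Nat.mod_eq_of_lt (by omega)]; exact hik)
  have h2 : ∀ i ≤ k, p i = i := by
    intro i
    induction i with
    | zero => exact fun _ => htop.1
    | succ i ih =>
      intro hi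
      rw [h1 i (by omega) (by omega), ih (by omega)]
  have h3 : ∀ j ≤ m - k, p (k + 1 + j) = p (k + 1) + j := by
    intro j
    induction j with
    | zero => simp
    | succ j ih =>
      intro hj
      rw [← add_assoc, h1 _ (by omega) (by omega), ih (by omega), add_assoc]
  have h4 := h3 (m - k) le_rfl
  rw [show k + 1 + (m - k) = m + 1 by omega] at h4
  have h5 := iterate_shift (n * m + 1) k 0 X
  rw [zero_add] at h5
  refine ⟨k, ?_⟩
  rw [h2 k le_rfl, show p (k + 1) = X + k by omega]
  exact h5

/-- An angulation is determined, up to rotation, by its coloured quiver. -/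
theorem rotate_eq_of_iso (hn : 1 ≤ n) (hR : IsAngulation n m R) (hR' : IsAngulation n m R')
    (h : ColouredQuiver.Iso (quiver n m R) (quiver n m R')) :
    ∃ i j, (rotate (n * m + 1))^[i] R = (rotate (n * m + 1))^[j] R' := by
  obtain ⟨e, he⟩ := h
  obtain ⟨X, hX⟩ : ∃ X, X + m = n * m + 1 := by
    refine ⟨n * m + 1 - m, ?_⟩
    have := Nat.le_mul_of_pos_left m hn
    omega
  have hadj : ∀ α β, Adj m R α.1 β.1 ↔ Adj m R' (e α).1 (e β).1 := by
    intro α β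
    refine exists_congr fun d => and_congr_right fun h1 => and_congr_right fun h2 => ?_
    exact follows_iff_of_arrows he α β h1 h2
  by_cases hne : Nonempty (quiver n m R).V
  -- A shortest diagonal has only border edges below it.
  · obtain ⟨α, -, hα⟩ := (measure fun α : (quiver n m R).V => α.1.2 - α.1.1).wf.has_min Set.univ
      (Set.nonempty_iff_univ_nonempty.1 hne)
    obtain ⟨p, hp, h0, h1⟩ := hR.cell α.2.1 α.2.2.1
    have hα1 : α.1 = (p 0, p (m + 1)) := by rw [h0, h1]
    have hin : ∀ i ≤ m, ¬ IsDiag n m R (p i, p (i + 1)) := by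
      intro i hi hd
      refine hα ⟨_, hd⟩ trivial ?_
      have := hR.cell_side_lt hp hi
      change p (i + 1) - p i < α.1.2 - α.1.1
      omega
    obtain ⟨k, hk⟩ := hR.exists_shift_of_inner hX hp hin
    -- The neighbours of `α` all lie in the parent `r` of `α`, so any two are equal or adjacent.
    -- Diagonals in both cells at the image of `α` would give two neighbours sharing no cell; hence
    -- one of these cells is free of other diagonals.
    obtain ⟨k', hk'⟩ : ∃ k', (shift (n * m + 1))^[k'] (e α).1 = (0, X) := by
      obtain ⟨p', hp', t, ht, g0, g1⟩ := hR'.exists_parent (e α).2.1 (e α).2.2.2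
      obtain ⟨q', hq', f0, f1⟩ := hR'.cell (e α).2.1 (e α).2.2.1
      have g2 : (e α).1 = (p' t, p' (t + 1)) := by rw [g0, g1]
      have f2 : (e α).1 = (q' 0, q' (m + 1)) := by rw [f0, f1]
      by_cases c1 : ∀ i ≤ m, ¬ IsDiag n m R' (q' i, q' (i + 1))
      · rw [f2]
        exact hR'.exists_shift_of_inner hX hq' c1
      by_cases c2 : ∀ i, i % (m + 2) ≠ t → ¬ IsDiag n m R' (side m p' i)
      · rw [g2]
        exact hR'.exists_shift_of_outer hX hp' ht c2
      exfalso
      push Not at c1 c2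
      obtain ⟨l, hl, hγ⟩ := c1
      obtain ⟨i, hi, hδ⟩ := c2
      obtain ⟨r, hr, s, hs, b0, b1⟩ := hR.exists_parent α.2.1 α.2.2.2
      have b2 : α.1 = (r s, r (s + 1)) := by rw [b0, b1]
      have hadj' : ∀ x, IsDiag n m R' x → Adj m R' (e α).1 x →
          ∃ β : (quiver n m R).V, (e β).1 = x ∧ ∃ j, β.1 = side m r j := by
        intro x hx hadjx
        let γ' : (quiver n m R').V := ⟨x, hx⟩
        have a0 : e (e.symm γ') = γ' := e.apply_symm_apply γ'
        refine ⟨e.symm γ', congrArg Subtype.val a0, ?_⟩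
        have a1 : Adj m R α.1 (e.symm γ').1 := by
          rw [hadj, a0]
          exact hadjx
        rw [b2] at a1
        rcases hR.adj_cases hr hp hs (by rw [h0, b0]) (by rw [h1, b1]) a1 with
          ⟨j, -, hj⟩ | ⟨j, hj, hj'⟩
        · exact ⟨j, hj⟩
        · refine absurd ?_ (hin j hj)
          rw [← side_of_le p hj, ← hj']
          exact (e.symm γ').2
      rw [← side_of_le q' hl] at hγ
      obtain ⟨β, hβ, j, hj⟩ := hadj' _ hγ (by
        rw [f2, ← side_top]
        refine adj_of_cell hq' ?_
        rw [mod_top, Nat.mod_eq_of_lt (by omega)]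
        omega)
      obtain ⟨β', hβ', j', hj'⟩ := hadj' _ hδ (by
        rw [g2, ← side_of_le p' ht]
        refine adj_of_cell hp' ?_
        rw [Nat.mod_eq_of_lt (by omega)]
        exact hi.symm)
      have hgf0 : q' 0 = p' t := by rw [g0, f0]
      have hgf1 : q' (m + 1) = p' (t + 1) := by rw [g1, f1]
      by_cases hjj : j % (m + 2) = j' % (m + 2)
      · have a1 : β.1 = β'.1 := by rw [hj, hj', ← side_mod, hjj, side_mod]
        refine hi (hR'.side_ne_of_sub hp' hq' ht hgf0 hgf1 (l := l) ?_)
        rw [← hβ, ← hβ', (Subtype.ext a1 : β = β')]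
      · have a1 := adj_of_cell hr hjj
        rw [← hj, ← hj', hadj, hβ, hβ'] at a1
        obtain ⟨d, -, -, w, hw, u, hu, hu'⟩ := a1
        refine hi (hR'.cell_unique_of_sub hp' hq' hw ht hgf0 hgf1 (l := l) ?_ hu' hu)
        rwa [Nat.mod_eq_of_lt (by omega)]
    obtain ⟨hA, e1, he1, hs1⟩ := hR.exists_rotate_iso k
    obtain ⟨hA', e2, he2, hs2⟩ := hR'.exists_rotate_iso k'
    refine ⟨k, k', hA.eq_of_iso_of_root hA' hX (e1.symm.trans (e.trans e2)) ?_ (e1 α) ?_ ?_⟩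
    · intro β γ c
      rw [← e1.apply_symm_apply β, ← e1.apply_symm_apply γ, he1]
      simp only [Equiv.trans_apply, e1.symm_apply_apply]
      rw [he2, he]
    · rw [hs1, hα1, hk]
    · simp only [Equiv.trans_apply, e1.symm_apply_apply]
      rw [hs2, hk']
  -- Without diagonals there are only the border edges and the root.
  · refine ⟨0, 0, ?_⟩
    have key : ∀ {R R' : ℕ → ℕ → Prop}, IsAngulation n m R → IsAngulation n m R' →
        ¬ Nonempty (quiver n m R).V → ∀ x y, R x y → R' x y := by
      intro R R' hR hR' hne x y hxy
      have hlt := hR.lt hxy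
      have hle := hR.le hxy
      by_cases h2 : y = x + 1
      · subst h2
        exact hR'.border (by omega)
      by_cases h3 : x = 0 ∧ y = n * m + 1
      · rw [h3.1, h3.2]
        exact hR'.root
      · exact absurd ⟨⟨(x, y), hxy, by simp only; omega, h3⟩⟩ hne
    funext x y
    exact propext ⟨key hR hR' hne x y, key hR' hR (fun ⟨β⟩ => hne ⟨e.symm β⟩) x y⟩

end IsAngulation

end EdgeRel

/-! ### Mutation and isomorphism classes. -/

namespace ColouredQuiver

variable {m : ℕ}

theorem iso_mutate {Q S : ColouredQuiver m} {e : Q.V ≃ S.V}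
    (he : ∀ i k c, S.arrows (e i) (e k) c = Q.arrows i k c) (j : Q.V) :
    Iso (mutate Q j) (mutate S (e j)) := by
  have key : ∀ (i k : Q.V) c, (mutate S (e j)).arrows (e i) (e k) c = (mutate Q j).arrows i k c := by
    intro i k c
    simp only [mutate, shiftColours, cancelArrows, addArrows, he, e.apply_eq_iff_eq]
    congr!
  exact ⟨e, key⟩

/-- The class is defined by mutating actual quivers, so a mutation of another representative has to
be transported along the isomorphism. -/
theorem mutate_mem_mutationClass {Q S : ColouredQuiver m}
    (h : (Quotient.mk (isoSetoid m) S) ∈ mutationClass Q) (j : S.V) :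
    (Quotient.mk (isoSetoid m) (mutate S j)) ∈ mutationClass Q := by
  obtain ⟨T, hT, hST⟩ := h
  obtain ⟨e, he⟩ := Quotient.exact hST
  exact ⟨mutate T (e j), hT.tail ⟨e j, rfl⟩, Quotient.sound (iso_mutate he j)⟩

end ColouredQuiver

namespace EdgeRel

variable {n m : ℕ}

/-! ### Flips connect all angulations. -/

section Flips

/-- A property of angulations that is preserved by the rotation of a diagonal by one step is
preserved by all rotations of a diagonal. -/
theorem flip_of_prev {P : (ℕ → ℕ → Prop) → Prop}
    (hP : ∀ R v k, IsAngulation n m R → IsDoubleCell m R v k → P R →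
      P (flip m R v k (IsDoubleCell.prev m k)))
    {R : ℕ → ℕ → Prop} {v : ℕ → ℕ} {k k' : ℕ} (hR : IsAngulation n m R)
    (h : IsDoubleCell m R v k) (hk' : k' ≤ m) (hPR : P R) : P (flip m R v k k') := by
  have hk := h.le
  have step : ∀ t ≤ m, P (flip m R v k t) → P (flip m R v k (IsDoubleCell.prev m t)) := by
    intro t ht hPt
    have := hP _ v t (h.isAngulation_flip hR ht) (h.flip hR ht) hPt
    rwa [h.flip_flip hR ht] at this
  have down : ∀ t ≤ m, P (flip m R v k t) → ∀ j, P (flip m R v k (t - j)) := by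
    intro t ht hPt j
    induction j with
    | zero => exact hPt
    | succ j ih =>
      by_cases h0 : t - j = 0
      · rwa [show t - (j + 1) = t - j by omega]
      · have := step (t - j) (by omega) ih
        rwa [IsDoubleCell.prev, if_neg h0, Nat.sub_sub] at this
  -- The positions are cyclic: descend from `k` to `0`, pass to `m`, and descend to `k'`.
  have h0 := down k hk (by rwa [h.flip_self]) k
  rw [Nat.sub_self] at h0
  have h1 := step 0 (Nat.zero_le _) h0
  rw [IsDoubleCell.prev, if_pos rfl] at h1
  have h2 := down m le_rfl h1 (m - k')
  rwa [Nat.sub_sub_self hk'] at h2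

/-- The finite set of diagonals. -/
def diagFinset (n m : ℕ) (R : ℕ → ℕ → Prop) : Finset (ℕ × ℕ) :=
  (Finset.range (n * m + 2) ×ˢ Finset.range (n * m + 2)).filter (IsDiag n m R)

theorem mem_diagFinset {R : ℕ → ℕ → Prop} (hR : IsAngulation n m R) {x : ℕ × ℕ} :
    x ∈ diagFinset n m R ↔ IsDiag n m R x := by
  simp only [diagFinset, Finset.mem_filter, Finset.mem_product, Finset.mem_range,
    and_iff_right_iff_imp]
  intro h
  have := hR.lt h.1
  have := hR.le h.1
  omega

/-- The sum of left endpoints is the measure that terminates the reduction to the fan at `0`. -/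
theorem sum_flip_lt {R : ℕ → ℕ → Prop} {v : ℕ → ℕ} {k k' : ℕ} (hR : IsAngulation n m R)
    (h : IsDoubleCell m R v k) (hk : k' < k) :
    ∑ x ∈ diagFinset n m (flip m R v k k'), x.1 < ∑ x ∈ diagFinset n m R, x.1 := by
  have hkm := h.le
  have hmem : (v k, v (k + m + 1)) ∈ diagFinset n m R := (mem_diagFinset hR).2 (h.isDiag hR)
  have hsub : diagFinset n m (flip m R v k k') ⊆
      insert (v k', v (k' + m + 1)) ((diagFinset n m R).erase (v k, v (k + m + 1))) := by
    intro x hx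
    rw [mem_diagFinset (h.isAngulation_flip hR (by omega))] at hx
    rw [Finset.mem_insert, Finset.mem_erase, mem_diagFinset hR]
    obtain ⟨h1 | h1, h2⟩ := hx
    · refine Or.inr ⟨fun h3 => h1.2 ?_, h1.1, h2⟩
      rw [h3]
      exact ⟨rfl, rfl⟩
    · exact Or.inl (Prod.ext h1.1 h1.2)
  have h1 := Finset.sum_le_sum_of_subset (f := fun x : ℕ × ℕ => x.1) hsub
  have h2 := Finset.add_sum_erase _ (fun x : ℕ × ℕ => x.1) hmem
  have h3 : ∑ x ∈ insert (v k', v (k' + m + 1))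
      ((diagFinset n m R).erase (v k, v (k + m + 1))), x.1 ≤
      v k' + ∑ x ∈ (diagFinset n m R).erase (v k, v (k + m + 1)), x.1 := by
    by_cases h4 : (v k', v (k' + m + 1)) ∈ (diagFinset n m R).erase (v k, v (k + m + 1))
    · rw [Finset.insert_eq_of_mem h4]
      exact Nat.le_add_left _ _
    · rw [Finset.sum_insert h4]
  have h4 := h.lt hR hk (by omega)
  simp only at h2
  omega

/-- The angulations all of whose diagonals start at `0` are equal. -/
theorem eq_of_fan {R R' : ℕ → ℕ → Prop} (hR : IsAngulation n m R) (hR' : IsAngulation n m R')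
    (h : ∀ x, IsDiag n m R x → x.1 = 0) (h' : ∀ x, IsDiag n m R' x → x.1 = 0) : R = R' := by
  have key : ∀ {R R' : ℕ → ℕ → Prop}, IsAngulation n m R → IsAngulation n m R' →
      (∀ x, IsDiag n m R x → x.1 = 0) → (∀ x, IsDiag n m R' x → x.1 = 0) →
      ∀ a b, R a b → R' a b := by
    intro R R' hR hR' h h' a b hab
    have hlt := hR.lt hab
    have hle := hR.le hab
    by_cases h1 : b = a + 1
    · subst h1
      exact hR'.border (by omega)
    by_cases h2 : a = 0 ∧ b = n * m + 1
    · rw [h2.1, h2.2]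
      exact hR'.root
    have h3 : a = 0 := h (a, b) ⟨hab, by simp only; omega, h2⟩
    -- Chords with the common endpoint `0` never cross, so maximality puts every diagonal of one fan
    -- into the other.
    refine hR'.rel_of_noncross hlt hle (hR.dvd hab) fun x y hxy => ⟨by omega, ?_⟩
    rintro ⟨h4, h5, h6⟩
    have := h' (x, y) ⟨hxy, by simp only; omega, by simp only; omega⟩
    simp only at this
    omega
  funext a b
  exact propext ⟨key hR hR' h h' a b, key hR' hR h' h a b⟩

/-- Flip a longest diagonal not starting at `0` to its leftmost position, until none is left. Each
flip can be undone by a further flip, so invariance in one direction gives the equivalence. -/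
theorem exists_fan {P : (ℕ → ℕ → Prop) → Prop}
    (hP : ∀ R v k, IsAngulation n m R → IsDoubleCell m R v k → P R →
      P (flip m R v k (IsDoubleCell.prev m k))) (N : ℕ) :
    ∀ R, IsAngulation n m R → ∑ x ∈ diagFinset n m R, x.1 < N →
      ∃ F, IsAngulation n m F ∧ (∀ x, IsDiag n m F x → x.1 = 0) ∧ (P R ↔ P F) := by
  induction N with
  | zero => exact fun _ _ h => absurd h (Nat.not_lt_zero _)
  | succ N ih =>
    intro R hR hN
    by_cases hfan : ∀ x, IsDiag n m R x → x.1 = 0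
    · exact ⟨R, hR, hfan, Iff.rfl⟩
    have hne : ((diagFinset n m R).filter fun x => x.1 ≠ 0).Nonempty := by
      push Not at hfan
      obtain ⟨x, hx, hx0⟩ := hfan
      exact ⟨x, Finset.mem_filter.2 ⟨(mem_diagFinset hR).2 hx, hx0⟩⟩
    obtain ⟨x, hx, hmax⟩ := Finset.exists_max_image _ (fun x : ℕ × ℕ => x.2 - x.1) hne
    rw [Finset.mem_filter, mem_diagFinset hR] at hx
    obtain ⟨v, k, h, rfl⟩ := hR.exists_doubleCell hx.1
    have hk := h.le
    -- In position `0` the diagonal would lie below `v 0, v (2 * m + 1)`, a longer diagonal with the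
    -- same nonzero left endpoint.
    have hk0 : 0 < k := by
      by_contra h0
      obtain rfl : k = 0 := by omega
      have hx0 : v 0 ≠ 0 := hx.2
      have h1 := h.lt hR (show 0 < 0 + m + 1 by omega) (by omega)
      have h2 := h.lt hR (show 0 + m + 1 < 2 * m + 1 by have := hR.one_le; omega) le_rfl
      have h3 := hmax (v 0, v (2 * m + 1)) (Finset.mem_filter.2 ⟨(mem_diagFinset hR).2
        ⟨h.top, by simp only; omega, by simp only; omega⟩, hx0⟩)
      simp only at h3
      omega
    have hA := h.isAngulation_flip hR (Nat.zero_le m)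
    obtain ⟨F, hF, hfan', hPF⟩ := ih _ hA (by
      have := sum_flip_lt hR h hk0
      omega)
    refine ⟨F, hF, hfan', Iff.trans ⟨flip_of_prev hP hR h (Nat.zero_le m), fun h1 => ?_⟩ hPF⟩
    have h2 := flip_of_prev hP hA (h.flip hR (Nat.zero_le m)) hk h1
    rwa [h.flip_flip hR (Nat.zero_le m), h.flip_self] at h2

/-- Any two angulations are connected by rotations of diagonals. -/
theorem of_flip_invariant {P : (ℕ → ℕ → Prop) → Prop}
    (hP : ∀ R v k, IsAngulation n m R → IsDoubleCell m R v k → P R →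
      P (flip m R v k (IsDoubleCell.prev m k)))
    {R R' : ℕ → ℕ → Prop} (hR : IsAngulation n m R) (hR' : IsAngulation n m R') (h : P R) :
    P R' := by
  obtain ⟨F, hF, h1, h2⟩ := exists_fan hP _ R hR (Nat.lt_succ_self _)
  obtain ⟨F', hF', h1', h2'⟩ := exists_fan hP _ R' hR' (Nat.lt_succ_self _)
  rw [eq_of_fan hF hF' h1 h1'] at h2
  exact h2'.2 (h2.1 h)

end Flips

/-! ### Chains of nested diagonals realise the orientations of type `A`. -/

section Chain

/-- The nested segments `lo k, hi k`, for `k ≤ N`, each arising from the preceding one by the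
addition of `m` vertices on one side. -/
structure IsChain (n m N : ℕ) (ε : ℕ → Bool) (lo hi : ℕ → ℕ) : Prop where
  one_le : 1 ≤ m
  right : ∀ {k}, k < N → ε k = true → lo (k + 1) = lo k ∧ hi (k + 1) = hi k + m
  left : ∀ {k}, k < N → ε k = false → lo (k + 1) + m = lo k ∧ hi (k + 1) = hi k
  zero : hi 0 = lo 0 + m + 1
  lo_last : lo N = 0
  hi_last : hi N = n * m + 1

theorem exists_isChain (hn : 1 ≤ n) (hm : 1 ≤ m) (ε : ℕ → Bool) :
    ∃ lo hi, IsChain n m (n - 1) ε lo hi := by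
  -- The left endpoint is the number of vertices still to be added on the left.
  let lo : ℕ → ℕ := fun k => ∑ t ∈ Finset.Ico k (n - 1), if ε t then 0 else m
  have hlo : ∀ k < n - 1, lo k = (if ε k then 0 else m) + lo (k + 1) := fun k hk =>
    Finset.sum_eq_sum_Ico_succ_bot hk _
  refine ⟨lo, fun k => lo k + (k + 1) * m + 1, hm, fun {k} hk he => ?_, fun {k} hk he => ?_,
    by ring, by simp [lo], ?_⟩
  · have h1 := hlo k hk
    rw [if_pos he, zero_add] at h1
    exact ⟨h1.symm, by rw [h1]; ring⟩
  · have h1 := hlo k hk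
    rw [if_neg (by simp [he])] at h1
    exact ⟨by omega, by rw [h1]; ring⟩
  · rw [Nat.sub_add_cancel hn]
    simp [lo]

/-- The edges of a chain. -/
def chainRel (n m N : ℕ) (lo hi : ℕ → ℕ) (a b : ℕ) : Prop :=
  (b = a + 1 ∧ a < n * m + 1) ∨ ∃ k ≤ N, a = lo k ∧ b = hi k

namespace IsChain

variable {N : ℕ} {ε : ℕ → Bool} {lo hi : ℕ → ℕ}

theorem step (h : IsChain n m N ε lo hi) {k : ℕ} (hk : k < N) :
    lo (k + 1) ≤ lo k ∧ hi k ≤ hi (k + 1) ∧ hi (k + 1) + lo k = hi k + lo (k + 1) + m := by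
  cases he : ε k
  · have := h.left hk he
    omega
  · have := h.right hk he
    omega

theorem mono (h : IsChain n m N ε lo hi) {k l : ℕ} (hkl : k ≤ l) (hl : l ≤ N) :
    lo l ≤ lo k ∧ hi k ≤ hi l ∧ hi k + lo l + (l - k) ≤ hi l + lo k := by
  have hm := h.one_le
  induction l, hkl using Nat.le_induction with
  | base => simp
  | succ l hkl ih =>
    have := ih (by omega)
    have := h.step (show l < N by omega)
    omega

theorem wide (h : IsChain n m N ε lo hi) {k : ℕ} (hk : k ≤ N) : lo k + m + 1 ≤ hi k := by
  have := h.mono (Nat.zero_le k) hk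
  have := h.zero
  omega

theorem le (h : IsChain n m N ε lo hi) {k : ℕ} (hk : k ≤ N) : hi k ≤ n * m + 1 := by
  have := h.mono hk le_rfl
  have := h.hi_last
  omega

theorem dvd (h : IsChain n m N ε lo hi) {k : ℕ} (hk : k ≤ N) :
    (m : ℤ) ∣ (hi k : ℤ) - lo k - 1 := by
  induction k with
  | zero =>
    rw [h.zero]
    push_cast
    rw [show (lo 0 : ℤ) + m + 1 - lo 0 - 1 = m by ring]
  | succ k ih =>
    have h1 := (h.step (show k < N by omega)).2.2
    have h2 := dvd_add (ih (by omega)) (dvd_refl (m : ℤ))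
    rwa [show (hi k : ℤ) - lo k - 1 + m = hi (k + 1) - lo (k + 1) - 1 by omega] at h2

/-- The position of `lo k, hi k` in the cell below `lo (k + 1), hi (k + 1)`. -/
def slot (m : ℕ) (ε : ℕ → Bool) (k : ℕ) : ℕ := if ε k then 0 else m

/-- The cell below `lo (k + 1), hi (k + 1)`. -/
theorem exists_cell (h : IsChain n m N ε lo hi) {k : ℕ} (hk : k < N) :
    ∃ p, IsCell m (chainRel n m N lo hi) p ∧ p 0 = lo (k + 1) ∧ p (m + 1) = hi (k + 1) ∧
      p (slot m ε k) = lo k ∧ p (slot m ε k + 1) = hi k ∧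
      ∀ i ≤ m, i ≠ slot m ε k → p (i + 1) = p i + 1 := by
  have hm := h.one_le
  have hle := h.le (show k + 1 ≤ N by omega)
  have hwide := h.wide hk.le
  cases he : ε k
  · have h1 := h.left hk he
    have hs : slot m ε k = m := by simp [slot, he]
    have e : ∀ i ≤ m, (if i ≤ m then lo (k + 1) + i else hi k) = lo (k + 1) + i :=
      fun i hi => if_pos hi
    have e' : (if m + 1 ≤ m then lo (k + 1) + (m + 1) else hi k) = hi k := if_neg (by omega)
    refine ⟨fun i => if i ≤ m then lo (k + 1) + i else hi k, ⟨fun i hi => ?_, ?_⟩, ?_⟩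
    · rcases Nat.lt_or_eq_of_le hi with hi | rfl
      · simp only [e i (by omega), e (i + 1) (by omega)]
        exact Or.inl ⟨rfl, by omega⟩
      · simp only [e i le_rfl, e']
        exact Or.inr ⟨k, hk.le, by omega, rfl⟩
    · simp only [e 0 (by omega), e']
      exact Or.inr ⟨k + 1, hk, by omega, by omega⟩
    · simp only [hs, e 0 (by omega), e m le_rfl, e']
      refine ⟨by omega, by omega, by omega, trivial, fun i hi hi' => ?_⟩
      rw [e (i + 1) (by omega), e i hi]
      rfl
  · have h1 := h.right hk he
    have hs : slot m ε k = 0 := by simp [slot, he]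
    refine ⟨fun i => if i = 0 then lo k else hi k + (i - 1), ⟨fun i hi => ?_, ?_⟩, ?_⟩
    · rcases i with _ | i
      · exact Or.inr ⟨k, hk.le, by simp, by simp⟩
      · simp only [Nat.add_eq_zero_iff, one_ne_zero, and_false, if_false, Nat.add_sub_cancel]
        exact Or.inl ⟨by omega, by omega⟩
    · exact Or.inr ⟨k + 1, hk, by simp [h1.1], by simp [h1.2]⟩
    · simp only [hs, if_true, zero_add, one_ne_zero, if_false, Nat.add_eq_zero_iff, and_false,
        Nat.add_sub_cancel, Nat.sub_self, add_zero]
      refine ⟨h1.1.symm, h1.2.symm, trivial, trivial, fun i hi hi' => ?_⟩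
      rw [if_neg hi']
      omega

theorem isAngulation (h : IsChain n m N ε lo hi) : IsAngulation n m (chainRel n m N lo hi) := by
  have hm := h.one_le
  refine ⟨hm, ?_, ?_, ?_, fun ha => Or.inl ⟨rfl, ha⟩, Or.inr ⟨N, le_rfl, h.lo_last.symm,
    h.hi_last.symm⟩, ?_, ?_⟩
  · rintro a b (⟨rfl, -⟩ | ⟨k, hk, rfl, rfl⟩)
    · omega
    · have := h.wide hk
      omega
  · rintro a b (⟨rfl, h1⟩ | ⟨k, hk, rfl, rfl⟩)
    · omega
    · exact h.le hk
  · rintro a b (⟨rfl, h1⟩ | ⟨k, hk, rfl, rfl⟩)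
    · simp
    · exact h.dvd hk
  · rintro a b c d (⟨rfl, -⟩ | ⟨k, hk, rfl, rfl⟩) (⟨rfl, -⟩ | ⟨l, hl, rfl, rfl⟩) h1 h2 h3
    · omega
    · omega
    · omega
    · rcases le_total k l with h4 | h4
      · have := h.mono h4 hl
        omega
      · have := h.mono h4 hk
        omega
  · rintro a b (⟨rfl, -⟩ | ⟨k, hk, rfl, rfl⟩) hab
    · omega
    · rcases k with _ | k
      · refine ⟨fun i => lo 0 + i, ⟨fun i hi => Or.inl ⟨rfl, ?_⟩, Or.inr ⟨0, hk, rfl, ?_⟩⟩, rfl, ?_⟩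
        · have := h.zero
          have := h.le hk
          omega
        · rw [h.zero, add_assoc]
        · rw [h.zero, add_assoc]
      · obtain ⟨p, hp, h1, h2, -⟩ := h.exists_cell (show k < N by omega)
        exact ⟨p, hp, h1, h2⟩

theorem isDiag_iff (h : IsChain n m N ε lo hi) (x : ℕ × ℕ) :
    IsDiag n m (chainRel n m N lo hi) x ↔ ∃ k < N, x = (lo k, hi k) := by
  have hm := h.one_le
  constructor
  · rintro ⟨⟨h1, -⟩ | ⟨k, hk, h1, h2⟩, h3, h4⟩
    · omega
    · refine ⟨k, lt_of_le_of_ne hk ?_, Prod.ext h1 h2⟩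
      rintro rfl
      exact h4 ⟨h1.trans h.lo_last, h2.trans h.hi_last⟩
  · rintro ⟨k, hk, rfl⟩
    have h1 := h.wide hk.le
    have h2 := h.mono hk.le le_rfl
    have h3 := h.lo_last
    have h4 := h.hi_last
    exact ⟨Or.inr ⟨k, hk.le, rfl, rfl⟩, by simp only; omega, by simp only; omega⟩

theorem inj (h : IsChain n m N ε lo hi) {k l : ℕ} (hk : k ≤ N) (hl : l ≤ N)
    (h1 : (lo k, hi k) = (lo l, hi l)) : k = l := by
  rw [Prod.mk.injEq] at h1
  rcases le_total k l with h2 | h2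
  · have := h.mono h2 hl
    omega
  · have := h.mono h2 hk
    omega

/-- The cell between two consecutive segments has only border edges besides them, so only
consecutive segments are linked. The colour `m + 1 - d` of the arrow is the slot: `0` for growth on
the right, `m` for growth on the left. -/
theorem follows_iff (h : IsChain n m N ε lo hi) {k l d : ℕ} (hkl : k < l) (hl : l < N)
    (hd : 1 ≤ d) (hd' : d ≤ m + 1) :
    Follows m (chainRel n m N lo hi) (lo k, hi k) d (lo l, hi l) ↔
      l = k + 1 ∧ d = m + 1 - slot m ε k := by
  have hA := h.isAngulation
  have hm := h.one_le
  have hs : slot m ε k ≤ m := by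
    unfold slot
    split_ifs <;> omega
  obtain ⟨p, hp, h0, h1, h2, h3, h4⟩ := h.exists_cell (show k < N by omega)
  have hF : Follows m (chainRel n m N lo hi) (lo k, hi k) (m + 1 - slot m ε k)
      (lo (k + 1), hi (k + 1)) := by
    refine ⟨p, hp, slot m ε k, by rw [side_of_le _ hs, h2, h3], ?_⟩
    rw [show slot m ε k + (m + 1 - slot m ε k) = m + 1 by omega, side_top, h0, h1]
  constructor
  · intro hf
    have hlk : l = k + 1 := by
      obtain ⟨q, hq, h5, h6⟩ := hA.cell (Or.inr ⟨k, by omega, rfl, rfl⟩ :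
        chainRel n m N lo hi (lo k) (hi k)) (by have := h.wide (show k ≤ N by omega); omega)
      have h7 := h.mono hkl.le hl.le
      rcases hA.adj_cases hp hq hs (by rw [h5, h2]) (by rw [h6, h3]) (δ := (lo l, hi l))
        ⟨d, hd, hd', by rwa [h2, h3]⟩ with ⟨j, hj, h8⟩ | ⟨j, hj, h8⟩
      · obtain ⟨t, ht, hjt, -, h9⟩ := IsAngulation.exists_side_eq (m := m) p j
        rw [h9] at h8
        rcases Nat.lt_or_eq_of_le ht with ht | rfl
        · rw [side_of_le _ (by omega), Prod.mk.injEq, h4 t (by omega) (by omega)] at h8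
          have := h.wide hl.le
          omega
        · rw [side_top, h0, h1] at h8
          exact h.inj hl.le (by omega) h8
      · have h9 := hA.side_sub hq j
        rw [← h8] at h9
        simp only at h9
        omega
    subst hlk
    exact ⟨rfl, hA.follows_uniq hd hd' (by omega) (by omega) hf hF⟩
  · rintro ⟨rfl, rfl⟩
    exact hF

/-- The quiver of a chain is an orientation of the Dynkin diagram of type `A`. -/
theorem iso_dynkinA (ε : Fin N → Bool)
    (h : IsChain n m N (fun k => if hk : k < N then ε ⟨k, hk⟩ else true) lo hi) :
    ColouredQuiver.Iso (ColouredQuiver.dynkinA m N ε) (quiver n m (chainRel n m N lo hi)) := by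
  have hm := h.one_le
  let g : Fin N → {x // IsDiag n m (chainRel n m N lo hi) x} :=
    fun k => ⟨(lo k, hi k), (h.isDiag_iff _).2 ⟨k, k.isLt, rfl⟩⟩
  have hg : Function.Bijective g := by
    constructor
    · intro k l hkl
      exact Fin.ext (h.inj k.isLt.le l.isLt.le (congrArg Subtype.val hkl))
    · rintro ⟨x, hx⟩
      obtain ⟨k, hk, rfl⟩ := (h.isDiag_iff _).1 hx
      exact ⟨⟨k, hk⟩, rfl⟩
  have hslot : ∀ k : Fin N, slot m (fun k => if hk : k < N then ε ⟨k, hk⟩ else true) k.val =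
      if ε k then 0 else m := fun k => by simp [slot]
  suffices key : ∀ (k l : Fin N) (c : Fin (m + 1)),
      (if Follows m (chainRel n m N lo hi) (lo k.val, hi k.val) (m + 1 - c.val)
        (lo l.val, hi l.val) then 1 else 0) = (ColouredQuiver.dynkinA m N ε).arrows k l c from
    ⟨Equiv.ofBijective g hg, key⟩
  intro k l c
  have hc := c.isLt
  simp only [ColouredQuiver.dynkinA]
  rcases lt_trichotomy k.val l.val with hkl | hkl | hkl
  · rw [h.follows_iff hkl l.isLt (by omega) (by omega), hslot]
    rw [if_neg (show ¬ l.val + 1 = k.val by omega)]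
    by_cases h1 : k.val + 1 = l.val
    · rw [if_pos h1]
      refine ite_eq_ite ?_
      cases ε k <;>
        simp only [Bool.false_eq_true, if_false, if_true, Fin.ext_iff, Fin.val_last, Fin.val_zero] <;> omega
    · rw [if_neg h1, if_neg]
      omega
  · rw [hkl, if_neg (h.isAngulation.follows_irrefl (by omega) (by omega))]
    simp
  · have hsymm : Follows m (chainRel n m N lo hi) (lo k.val, hi k.val) (m + 1 - c.val) (lo l.val, hi l.val) ↔
        Follows m (chainRel n m N lo hi) (lo l.val, hi l.val) (c.val + 1) (lo k.val, hi k.val) := by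
      constructor
      · intro hf
        have := hf.symm (by omega)
        rwa [show m + 2 - (m + 1 - c.val) = c.val + 1 by omega] at this
      · intro hf
        have := hf.symm (by omega)
        rwa [show m + 2 - (c.val + 1) = m + 1 - c.val by omega] at this
    rw [hsymm, h.follows_iff hkl k.isLt (by omega) (by omega), hslot,
      if_neg (show ¬ k.val + 1 = l.val by omega)]
    by_cases h1 : l.val + 1 = k.val
    · rw [if_pos h1]
      refine ite_eq_ite ?_
      cases ε l <;>
        simp only [Bool.false_eq_true, if_false, if_true, Fin.ext_iff, Fin.val_last, Fin.val_zero] <;> omega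
    · rw [if_neg h1, if_neg]
      omega

end IsChain

end Chain

/-! ### The mutation class of type `A`. -/

/-- The mutation class of type `A` consists of the quivers of angulations. -/
theorem mem_mutationClass_iff (hn : 1 ≤ n) (hm : 1 ≤ m) (ε : Fin (n - 1) → Bool)
    (x : ColouredQuiver.IsoClass m) :
    x ∈ ColouredQuiver.mutationClass (ColouredQuiver.dynkinA m (n - 1) ε) ↔
      ∃ R, IsAngulation n m R ∧ x = Quotient.mk (ColouredQuiver.isoSetoid m) (quiver n m R) := by
  -- The value of `ε` at the last vertex belongs to no edge of the diagram; it only places the last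
  -- diagonal below the root, which is not a vertex of the quiver.
  obtain ⟨lo, hi, hc⟩ := exists_isChain (n := n) hn hm
    (fun k => if hk : k < n - 1 then ε ⟨k, hk⟩ else true)
  have hiso := hc.iso_dynkinA ε
  constructor
  · rintro ⟨S, hS, rfl⟩
    suffices h : ∃ R, IsAngulation n m R ∧ ColouredQuiver.Iso S (quiver n m R) by
      obtain ⟨R, hR, h⟩ := h
      exact ⟨R, hR, Quotient.sound h⟩
    induction hS with
    | refl => exact ⟨_, hc.isAngulation, hiso⟩
    | tail _ hstep ih =>
      obtain ⟨R, hR, e, he⟩ := ih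
      obtain ⟨j, rfl⟩ := hstep
      obtain ⟨v, k, h, hj⟩ := hR.exists_doubleCell (e j).2
      have h1 := h.iso_mutate hR
      have h2 : e j = ⟨(v k, v (k + m + 1)), h.isDiag hR⟩ := Subtype.ext hj
      rw [← h2] at h1
      exact ⟨_, h.isAngulation_flip hR (IsDoubleCell.prev_le h.le),
        (ColouredQuiver.isoSetoid m).trans (ColouredQuiver.iso_mutate he j) h1⟩
  · rintro ⟨R, hR, rfl⟩
    refine of_flip_invariant (P := fun R => Quotient.mk (ColouredQuiver.isoSetoid m)
      (quiver n m R) ∈ ColouredQuiver.mutationClass (ColouredQuiver.dynkinA m (n - 1) ε))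
      (fun R v k hR h hmem => ?_) hc.isAngulation hR
      ⟨_, Relation.ReflTransGen.refl, Quotient.sound ((ColouredQuiver.isoSetoid m).symm hiso)⟩
    have h1 := ColouredQuiver.mutate_mem_mutationClass hmem ⟨(v k, v (k + m + 1)), h.isDiag hR⟩
    rwa [Quotient.sound (h.iso_mutate hR)] at h1

end EdgeRel

/-! ### Rotation classes of angulations, and the theorem. -/

namespace Polygon

variable {n m : ℕ}

theorem quiver_iso_of_pow (hm : 1 ≤ m) {D E : Angulation n m} {i : ℕ}
    (h : E.1 = Sym2.map ((rotation n m) ^ i : Equiv.Perm (Vertex n m)) '' D.1) :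
    ColouredQuiver.Iso (quiver D) (quiver E) := by
  have h1 := quiver_iso D hm
  have h2 := quiver_iso E hm
  obtain ⟨-, e, he, -⟩ := (isAngulation_edges hm D.2).exists_rotate_iso i
  rw [h, edges_image_rotation_pow] at h2
  exact (ColouredQuiver.isoSetoid m).trans ((ColouredQuiver.isoSetoid m).symm h1)
    ((ColouredQuiver.isoSetoid m).trans ⟨e, he⟩ h2)

theorem quiver_iso_of_rel (hm : 1 ≤ m) {D E : Angulation n m}
    (h : (rotationSetoid n m).r D E) : ColouredQuiver.Iso (quiver D) (quiver E) := by
  obtain ⟨i, hi⟩ := h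
  obtain ⟨k, rfl | rfl⟩ := i.eq_nat_or_neg
  · rw [zpow_natCast] at hi
    exact quiver_iso_of_pow hm hi
  · refine (ColouredQuiver.isoSetoid m).symm (quiver_iso_of_pow hm (i := k) ?_)
    rw [hi, Set.image_image]
    simp [Sym2.map_map]

theorem rel_of_rotate_eq {D E : Angulation n m} {i j : ℕ}
    (h : (EdgeRel.rotate (n * m + 1))^[i] (edges D.1) =
      (EdgeRel.rotate (n * m + 1))^[j] (edges E.1)) : (rotationSetoid n m).r D E := by
  have key : ∀ (D : Angulation n m) (i : ℕ),
      diagonals n m ((EdgeRel.rotate (n * m + 1))^[i] (edges D.1)) =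
        Sym2.map ((rotation n m) ^ i : Equiv.Perm (Vertex n m)) '' D.1 := by
    intro D i
    rw [← edges_image_rotation_pow]
    refine diagonals_edges_of_not_border ?_
    rintro _ ⟨e, he, rfl⟩
    obtain ⟨h1, h2⟩ := (D.2.prop.1 e he).not_border
    refine ⟨by rwa [isBorderEdge_map_rotation_pow], fun x hx => ?_⟩
    refine h2 (((rotation n m) ^ i : Equiv.Perm (Vertex n m)).symm x) ?_
    apply Sym2.map.injective ((rotation n m) ^ i : Equiv.Perm (Vertex n m)).injective
    rw [hx, Sym2.map_mk]
    simp
  have h1 := key D i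
  rw [h, key E j] at h1
  -- Rotating `D` by `i` steps and `E` by `j` steps gives the same set, so `E` is `D` rotated by `i
  -- - j`.
  refine ⟨-(j : ℤ) + i, ?_⟩
  have h2 : E.1 = Sym2.map ((rotation n m) ^ (-(j : ℤ)) : Equiv.Perm (Vertex n m)) ''
      (Sym2.map ((rotation n m) ^ j : Equiv.Perm (Vertex n m)) '' E.1) := by
    rw [Set.image_image]
    simp [Sym2.map_map]
  rw [h2, h1, Set.image_image]
  simp [Sym2.map_map, zpow_add, Function.comp_def]

end Polygon

end

theorem mainTheorem1 (n m : ℕ) (hn : 1 ≤ n) (hm : 1 ≤ m) (ε : Fin (n - 1) → Bool) :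
    ∃ σ : Quotient (Polygon.rotationSetoid n m) →
        (ColouredQuiver.mutationClass (ColouredQuiver.dynkinA m (n - 1) ε) :
          Set (ColouredQuiver.IsoClass m)),
      (∀ D : Polygon.Angulation n m,
        (σ (Quotient.mk (Polygon.rotationSetoid n m) D) : ColouredQuiver.IsoClass m) =
          Quotient.mk (ColouredQuiver.isoSetoid m) (Polygon.quiver D)) ∧
      Function.Bijective σ := by
  have hmem : ∀ D : Polygon.Angulation n m,
      Quotient.mk (ColouredQuiver.isoSetoid m) (Polygon.quiver D) ∈
        ColouredQuiver.mutationClass (ColouredQuiver.dynkinA m (n - 1) ε) := fun D =>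
    (EdgeRel.mem_mutationClass_iff hn hm ε _).2 ⟨_, Polygon.isAngulation_edges hm D.2,
      (Quotient.sound (Polygon.quiver_iso D hm)).symm⟩
  refine ⟨Quotient.lift (fun D => ⟨_, hmem D⟩) fun D E h =>
    Subtype.ext (Quotient.sound (Polygon.quiver_iso_of_rel hm h)), fun _ => rfl, ?_, ?_⟩
  · intro x y
    induction x using Quotient.ind with
    | _ D =>
    induction y using Quotient.ind with
    | _ E =>
    intro h
    have h1 : ColouredQuiver.Iso (Polygon.quiver D) (Polygon.quiver E) :=
      Quotient.exact (congrArg Subtype.val h)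
    have h2 := (ColouredQuiver.isoSetoid m).trans (Polygon.quiver_iso D hm)
      ((ColouredQuiver.isoSetoid m).trans h1
        ((ColouredQuiver.isoSetoid m).symm (Polygon.quiver_iso E hm)))
    obtain ⟨i, j, h3⟩ := (Polygon.isAngulation_edges hm D.2).rotate_eq_of_iso hn
      (Polygon.isAngulation_edges hm E.2) h2
    exact Quotient.sound (Polygon.rel_of_rotate_eq h3)
  · rintro ⟨x, hx⟩
    obtain ⟨R, hR, rfl⟩ := (EdgeRel.mem_mutationClass_iff hn hm ε x).1 hx
    let D : Polygon.Angulation n m := ⟨_, Polygon.isAngulation_diagonals hR⟩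
    have h := Polygon.quiver_iso D hm
    rw [show Polygon.edges D.1 = R from Polygon.edges_diagonals hR] at h
    exact ⟨Quotient.mk _ D, Subtype.ext (Quotient.sound ((ColouredQuiver.isoSetoid m).symm h))⟩
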